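/- Let $\beta>0$ and let $J$ be a real random variable with symmetric distribution and $\mathbb E|J|<\infty$. Write $P_\zeta$ for a Poisson variable of mean $\zeta$. **Model.** For $\alpha\ge 0$, $N\ge1$ and $\sigma\in\{\pm1\}^N$ let $H_N(\sigma)=-\sum_{\nu=1}^{P_{\alpha N}}J_\nu\sigma_{i_\nu}\sigma_{j_\nu}$, where the $J_\nu$ are i.i.d. copies of $J$, the $i_\nu,j_\nu$ are i.i.d. uniform on $\{1,\dots,N\}$, and all variables are independent. Put $-\beta f_N(\beta,\alpha)=\frac1N\mathbb E\ln\sum_\sigma e^{-\beta H_N(\sigma)}$ and $f(\beta,\alpha)=\lim_N f_N(\beta,\alpha)$. **Auxiliary system.** For $0\le\tilde\alpha<\infty$ consider $M$ spins $\rho_k=\pm1$ with the one-body Hamiltonian $-\sum_{\nu=1}^{P_{2\tilde\alpha M}}J_\nu\rho_{k_\nu}$ ($k_\nu$ i.i.d. uniform sites, everything independent) and its Gibbs average at inverse temperature $\beta$. Let $\tilde\omega_{\tilde\alpha}(\rho_k)$ be a random variable whose law is the limit in distribution, as $M\to\infty$, of the Gibbs average of a uniformly chosen spin. Let $\tilde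 q_{2n}(\tilde\alpha)$ be the limit of the expected Gibbs average of the multi-overlap $\frac1M\sum_k\rho_k^{(1)}\cdots\rho_k^{(2n)}$ of $2n$ replicas. For $\tilde\alpha=\infty$ the law of $\tilde\omega_\infty(\rho_k)$ and $\tilde q_{2n}(\infty)$ are the limits as $\tilde\alpha\to\infty$. **Fields.** Let $\tilde\omega_{\tilde\alpha}(\rho_k),\tilde\omega_{\tilde\alpha}(\rho_l)$ be independent copies of this variable, independent of $J$, and define $\tilde J,\hat J$ by $$\tanh(\beta\tilde J)=\tanh(\beta J)\,\tilde\omega_{\tilde\alpha}(\rho_k),\qquad \tanh(\beta\hat J)=\tanh(\beta J)\,\tilde\omega_{\tilde\alpha}(\rho_k)\,\tilde\omega_{\tilde\alpha}(\rho_l).$$ Let $(J_\nu,\tilde J_\nu)$ and $(J'_\nu,\hat J_\nu)$ be independent sequences of i.i.d. copies of $(J,\tilde J)$ and $(J,\hat J)$, independent of the $i_\nu$ and of the Poisson variables, which are independent of each other, and set $$\tilde H(\sigma)=-\sum_{\nu=1}^{P_{2\alpha N}}\Big(\tfrac1\beta\ln\tfrac{\cosh(\beta J_\nu)}{\cosh(\beta\tilde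 J_\nu)}+\tilde J_\nu\sigma_{i_\nu}\Big),\qquad \hat H=-\sum_{\nu=1}^{P_{\alpha N}}\Big(\tfrac1\beta\ln\tfrac{\cosh(\beta J'_\nu)}{\cosh(\beta\hat J_\nu)}+\hat J_\nu\Big),$$ $$G_N=\frac1N\,\mathbb E\ln\frac{\sum_\sigma e^{-\beta\tilde H(\sigma)}}{e^{-\beta\hat H}} .$$ **Theorem.** All the limits above exist. At every finite connectivity the Gibbs averages of two independently and uniformly chosen auxiliary spins become independent as $M\to\infty$. For every $\tilde\alpha\in[0,\infty]$, all expectations below are finite, all series converge, $\tilde q_{2n}(\tilde\alpha)=\mathbb E\,\tilde\omega_{\tilde\alpha}(\rho_k)^{2n}$, and the following hold. (i) For every $N\ge1$, every $\alpha\ge0$ (with the one-sided derivative at $\alpha=0$) and every fixed $\sigma\in\{\pm1\}^N$ (for $N=1$ the field $\tilde H$ is the one-site cavity field), $$\frac{d}{d\alpha}\frac1N\mathbb E\ln e^{-\beta\tilde H(\sigma)}=2\sum_{n\ge1}\frac1{2n}\,\mathbb E\tanh^{2n}(\beta J)\,\big(1-\tilde q_{2n}(\tilde\alpha)\big),$$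 $$\frac{d}{d\alpha}\frac1N\mathbb E\ln e^{-\beta\hat H}=\sum_{n\ge1}\frac1{2n}\,\mathbb E\tanh^{2n}(\beta J)\,\big(1-\tilde q_{2n}(\tilde\alpha)^2\big).$$ (ii) For every $\alpha\ge0$ and every $N\ge 1$, $G_N$ does not depend on $N$: it equals $$G_{RS}(\tilde\alpha)=\ln2+\mathbb E\ln\cosh\Big(\beta\sum_{\nu=1}^{P_{2\alpha}}\tilde J_\nu\Big)+\alpha\,\mathbb E\ln\cosh(\beta J)-2\alpha\,\mathbb E\ln\cosh(\beta\tilde J)+\alpha\,\mathbb E\ln\cosh(\beta\hat J).$$ (iii) For every $\alpha\ge0$, $$-\beta f(\beta,\alpha)\le G_{RS}(\tilde\alpha)=F_{RS}(\tilde\alpha):=\ln2+\mathbb E\ln\cosh\Big(\beta\sum_{\nu=1}^{P_{2\alpha}}\tilde J_\nu\Big)+\alpha\sum_{n\ge1}\frac1{2n}\,\mathbb E\tanh^{2n}(\beta J)\,\big(1-\tilde q_{2n}(\tilde\alpha)\big)^2 .$$ -/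

import Mathlib

open MeasureTheory ProbabilityTheory Filter Topology
open scoped NNReal ENNReal

namespace DilutedSpinGlass

noncomputable section

/-! ### Disorder -/

/-- The law of `(P, (xᵥ)ᵥ)`: a Poisson variable `P` of mean `r` and, independently of it, an
independent identically distributed sequence `(xᵥ)ᵥ` with common law `ν`. -/
def poissonMarks {S : Type} [MeasurableSpace S] (r : ℝ≥0) (ν : Measure S)
    [IsProbabilityMeasure ν] : Measure (ℕ × (ℕ → S)) :=
  (poissonMeasure r).prod (Measure.infinitePi fun _ : ℕ => ν)

instance {S : Type} [MeasurableSpace S] (r : ℝ≥0) (ν : Measure S) [IsProbabilityMeasure ν] :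
    IsProbabilityMeasure (poissonMarks r ν) := by
  unfold poissonMarks; infer_instance

/-- The uniform distribution on the `N` sites. -/
def uniformSite (N : ℕ) [NeZero N] : Measure (Fin N) := (PMF.uniformOfFintype (Fin N)).toMeasure

instance (N : ℕ) [NeZero N] : IsProbabilityMeasure (uniformSite N) := by
  unfold uniformSite; infer_instance

/-! ### Ising configurations, partition function, Gibbs average -/

/-- Configurations of `N` Ising spins, each spin being `+1` or `-1`. -/
abbrev Config (N : ℕ) : Type := Fin N → ℤˣ

/-- The value `±1` of the spin at site `i`, as a real number. -/
def spin {N : ℕ} (σ : Config N) (i : Fin N) : ℝ := ((σ i : ℤ) : ℝ)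

/-- Partition function of the Hamiltonian `H` at inverse temperature `β`. -/
def partitionFn {N : ℕ} (β : ℝ) (H : Config N → ℝ) : ℝ :=
  ∑ σ : Config N, Real.exp (-β * H σ)

/-- Boltzmann-Gibbs average of the observable `O`. -/
def gibbs {N : ℕ} (β : ℝ) (H : Config N → ℝ) (O : Config N → ℝ) : ℝ :=
  (partitionFn β H)⁻¹ * ∑ σ : Config N, O σ * Real.exp (-β * H σ)

/-- Average of an observable of `n` replicas (independent copies with the same disorder). -/
def replicaGibbs {N : ℕ} (n : ℕ) (β : ℝ) (H : Config N → ℝ) (O : (Fin n → Config N) → ℝ) : ℝ :=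
  ((partitionFn β H)⁻¹) ^ n *
    ∑ ρ : Fin n → Config N, O ρ * ∏ a : Fin n, Real.exp (-β * H (ρ a))

/-- The multi-overlap of `n` replicas. -/
def multiOverlap {N : ℕ} (n : ℕ) (ρ : Fin n → Config N) : ℝ :=
  (1 / (N : ℝ)) * ∑ i : Fin N, ∏ a : Fin n, spin (ρ a) i

/-! ### The Viana-Bray model -/

/-- The Viana-Bray Hamiltonian with `m` two-body interactions; the mark of the interaction `ν` is
`(Jᵥ, iᵥ, jᵥ)`. -/
def vianaBrayHam {N : ℕ} (m : ℕ) (x : ℕ → ℝ × Fin N × Fin N) (σ : Config N) : ℝ :=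
  -∑ ν ∈ Finset.range m, (x ν).1 * spin σ (x ν).2.1 * spin σ (x ν).2.2

/-- The quenched disorder of the Viana-Bray model: `P_{αN}` interactions, couplings of law `μ`,
uniform independent sites. -/
def vianaBrayDisorder (α : ℝ≥0) (μ : Measure ℝ) [IsProbabilityMeasure μ] (N : ℕ) [NeZero N] :
    Measure (ℕ × (ℕ → ℝ × Fin N × Fin N)) :=
  poissonMarks (α * N) (μ.prod ((uniformSite N).prod (uniformSite N)))

/-- The quenched free energy per site `f_N(β, α)`. -/
def finiteFreeEnergy (β : ℝ) (α : ℝ≥0) (μ : Measure ℝ) [IsProbabilityMeasure μ]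
    (N : ℕ) [NeZero N] : ℝ :=
  -(1 / β) * ((1 / (N : ℝ)) *
    ∫ d, Real.log (partitionFn β (vianaBrayHam d.1 d.2)) ∂vianaBrayDisorder α μ N)

/-- The free energy per site `f(β, α) = lim_N f_N(β, α)`. -/
def freeEnergy (β : ℝ) (α : ℝ≥0) (μ : Measure ℝ) [IsProbabilityMeasure μ] : ℝ :=
  limUnder atTop fun N : ℕ => finiteFreeEnergy β α μ (N + 1)

/-! ### The auxiliary one-body system -/

/-- The one-body Viana-Bray Hamiltonian with `m` interactions; the mark of the interaction `ν` is
`(Jᵥ, kᵥ)`. -/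
def auxHam {M : ℕ} (m : ℕ) (x : ℕ → ℝ × Fin M) (ρ : Config M) : ℝ :=
  -∑ ν ∈ Finset.range m, (x ν).1 * spin ρ (x ν).2

/-- The quenched disorder of the auxiliary system at connectivity `a`: there are `P_{2aM}` one-body
interactions. -/
def auxDisorder (μ : Measure ℝ) [IsProbabilityMeasure μ] (a : ℝ≥0) (M : ℕ) [NeZero M] :
    Measure (ℕ × (ℕ → ℝ × Fin M)) :=
  poissonMarks (2 * a * M) (μ.prod (uniformSite M))

instance (μ : Measure ℝ) [IsProbabilityMeasure μ] (a : ℝ≥0) (M : ℕ) [NeZero M] :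
    IsProbabilityMeasure (auxDisorder μ a M) := by
  unfold auxDisorder; infer_instance

/-- The Boltzmann-Gibbs average of the spin `ρ_k` in the auxiliary system, as a function of the
disorder and of the site. -/
def auxSpin {M : ℕ} (β : ℝ) (d : ℕ × (ℕ → ℝ × Fin M)) (k : Fin M) : ℝ :=
  gibbs β (auxHam d.1 d.2) fun ρ => spin ρ k

theorem measurable_auxSpin {M : ℕ} (β : ℝ) :
    Measurable fun p : (ℕ × (ℕ → ℝ × Fin M)) × Fin M => auxSpin β p.1 p.2 := by
  have hsite : ∀ k : Fin M, Measurable fun d : ℕ × (ℕ → ℝ × Fin M) => auxSpin β d k := by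
    intro k
    refine measurable_from_prod_countable_right fun m => ?_
    have hH : ∀ ρ : Config M, Measurable fun x : ℕ → ℝ × Fin M => auxHam m x ρ := by
      intro ρ
      have hs : Measurable fun i : Fin M => spin ρ i := measurable_of_finite _
      unfold auxHam
      refine (Finset.measurable_sum _ fun ν _ => ?_).neg
      exact ((measurable_pi_apply ν).fst).mul (hs.comp (measurable_pi_apply ν).snd)
    unfold auxSpin gibbs partitionFn
    refine Measurable.mul ?_ ?_
    · exact (Finset.measurable_sum _ fun ρ _ =>
        Real.measurable_exp.comp ((hH ρ).const_mul (-β))).inv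
    · exact Finset.measurable_sum _ fun ρ _ =>
        (Real.measurable_exp.comp ((hH ρ).const_mul (-β))).const_mul _
  exact measurable_from_prod_countable_left fun k => hsite k

/-- The law, in volume `M`, of the Gibbs average of a random (uniformly chosen) auxiliary spin. -/
def auxLawFinite (β : ℝ) (μ : Measure ℝ) [IsProbabilityMeasure μ] (a : ℝ≥0) (M : ℕ) [NeZero M] :
    ProbabilityMeasure ℝ :=
  ProbabilityMeasure.map (⟨(auxDisorder μ a M).prod (uniformSite M), inferInstance⟩ :
      ProbabilityMeasure ((ℕ × (ℕ → ℝ × Fin M)) × Fin M))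
    (measurable_auxSpin β).aemeasurable

theorem measurable_auxSpin_pair {M : ℕ} (β : ℝ) :
    Measurable fun p : (ℕ × (ℕ → ℝ × Fin M)) × (Fin M × Fin M) =>
      (auxSpin β p.1 p.2.1, auxSpin β p.1 p.2.2) := by
  have h1 : Measurable fun p : (ℕ × (ℕ → ℝ × Fin M)) × (Fin M × Fin M) => (p.1, p.2.1) :=
    measurable_fst.prodMk measurable_snd.fst
  have h2 : Measurable fun p : (ℕ × (ℕ → ℝ × Fin M)) × (Fin M × Fin M) => (p.1, p.2.2) :=
    measurable_fst.prodMk measurable_snd.snd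
  have h3 := (measurable_auxSpin (M := M) β).comp h1
  have h4 := (measurable_auxSpin (M := M) β).comp h2
  exact h3.prodMk h4

/-- The joint law, in volume `M`, of the Gibbs averages of two independently chosen random spins
of the same auxiliary system. -/
def auxPairLawFinite (β : ℝ) (μ : Measure ℝ) [IsProbabilityMeasure μ] (a : ℝ≥0) (M : ℕ)
    [NeZero M] : ProbabilityMeasure (ℝ × ℝ) :=
  ProbabilityMeasure.map (⟨(auxDisorder μ a M).prod ((uniformSite M).prod (uniformSite M)),
      inferInstance⟩ : ProbabilityMeasure ((ℕ × (ℕ → ℝ × Fin M)) × (Fin M × Fin M)))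
    (measurable_auxSpin_pair β).aemeasurable

/-- The law of `ω̃_a(ρ_k)`, the infinite volume limit, at finite connectivity `a`. -/
def auxLawAt (β : ℝ) (μ : Measure ℝ) [IsProbabilityMeasure μ] (a : ℝ≥0) : ProbabilityMeasure ℝ :=
  limUnder atTop fun M : ℕ => auxLawFinite β μ a (M + 1)

open Classical in
/-- The law of `ω̃_α̃(ρ_k)` for `α̃ ∈ [0, ∞]`; the value at `∞` is the limit `α̃ → ∞`. -/
def auxLaw (β : ℝ) (μ : Measure ℝ) [IsProbabilityMeasure μ] (α' : ℝ≥0∞) : ProbabilityMeasure ℝ :=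
  if α' = ⊤ then limUnder atTop (auxLawAt β μ) else auxLawAt β μ α'.toNNReal

/-- The averaged multi-overlap `⟨q̃_n⟩` of `n` replicas of the auxiliary system in volume `M`. -/
def auxOverlapFinite (β : ℝ) (μ : Measure ℝ) [IsProbabilityMeasure μ] (n : ℕ) (a : ℝ≥0) (M : ℕ)
    [NeZero M] : ℝ :=
  ∫ d, replicaGibbs n β (auxHam d.1 d.2) (multiOverlap n) ∂auxDisorder μ a M

/-- The infinite volume multi-overlap `q̃_n(a)` at finite connectivity `a`. -/
def auxOverlapAt (β : ℝ) (μ : Measure ℝ) [IsProbabilityMeasure μ] (n : ℕ) (a : ℝ≥0) : ℝ :=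
  limUnder atTop fun M : ℕ => auxOverlapFinite β μ n a (M + 1)

open Classical in
/-- The multi-overlap `q̃_n(α̃)` for `α̃ ∈ [0, ∞]`; the value at `∞` is the limit `α̃ → ∞`. -/
def auxOverlap (β : ℝ) (μ : Measure ℝ) [IsProbabilityMeasure μ] (n : ℕ) (α' : ℝ≥0∞) : ℝ :=
  if α' = ⊤ then limUnder atTop (auxOverlapAt β μ n) else auxOverlapAt β μ n α'.toNNReal

/-! ### Cavity and internal fields -/

/-- The number `y` with `tanh (β y) = tanh (β J) * w`, for `|w| ≤ 1`. -/
def modulatedCoupling (β J w : ℝ) : ℝ := Real.artanh (Real.tanh (β * J) * w) / β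

theorem tanh_modulatedCoupling {β : ℝ} (hβ : 0 < β) (J : ℝ) {w : ℝ} (hw : |w| ≤ 1) :
    Real.tanh (β * modulatedCoupling β J w) = Real.tanh (β * J) * w := by
  have h1 : |Real.tanh (β * J) * w| < 1 := by
    rw [abs_mul]
    have := Real.abs_tanh_lt_one (β * J)
    nlinarith [abs_nonneg (Real.tanh (β * J)), abs_nonneg w]
  unfold modulatedCoupling
  rw [mul_div_cancel₀ _ hβ.ne']
  exact Real.tanh_artanh (abs_lt.mp h1)

/-- The cavity coupling `J̃`, `tanh (β J̃) = tanh (β J) ω̃(ρ_k)`, of the pair `p = (J, ω̃(ρ_k))`. -/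
def cavityCoupling (β : ℝ) (p : ℝ × ℝ) : ℝ := modulatedCoupling β p.1 p.2

/-- The internal coupling `Ĵ`, `tanh (β Ĵ) = tanh (β J) ω̃(ρ_k) ω̃(ρ_l)`, of the triple
`p = (J, ω̃(ρ_k), ω̃(ρ_l))`. -/
def internalCoupling (β : ℝ) (p : ℝ × ℝ × ℝ) : ℝ := modulatedCoupling β p.1 (p.2.1 * p.2.2)

/-- The joint law of `(J, ω̃(ρ_k))`. -/
def cavityMark (β : ℝ) (μ : Measure ℝ) [IsProbabilityMeasure μ] (α' : ℝ≥0∞) : Measure (ℝ × ℝ) :=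
  μ.prod (auxLaw β μ α' : Measure ℝ)

instance (β : ℝ) (μ : Measure ℝ) [IsProbabilityMeasure μ] (α' : ℝ≥0∞) :
    IsProbabilityMeasure (cavityMark β μ α') := by
  unfold cavityMark; infer_instance

/-- The joint law of `(J, ω̃(ρ_k), ω̃(ρ_l))`. -/
def internalMark (β : ℝ) (μ : Measure ℝ) [IsProbabilityMeasure μ] (α' : ℝ≥0∞) :
    Measure (ℝ × ℝ × ℝ) :=
  μ.prod ((auxLaw β μ α' : Measure ℝ).prod (auxLaw β μ α' : Measure ℝ))

instance (β : ℝ) (μ : Measure ℝ) [IsProbabilityMeasure μ] (α' : ℝ≥0∞) :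
    IsProbabilityMeasure (internalMark β μ α') := by
  unfold internalMark; infer_instance

/-- The cavity Hamiltonian `H̃(σ) = H(0)`, with `m` terms; the mark of the term `ν` is
`((Jᵥ, ω̃(ρ_{kᵥ})), iᵥ)`. For `N = 1` this is the one-site cavity field. -/
def cavityHam {N : ℕ} (β : ℝ) (m : ℕ) (x : ℕ → (ℝ × ℝ) × Fin N) (σ : Config N) : ℝ :=
  -∑ ν ∈ Finset.range m,
    ((1 / β) * Real.log (Real.cosh (β * (x ν).1.1) / Real.cosh (β * cavityCoupling β (x ν).1))
      + cavityCoupling β (x ν).1 * spin σ (x ν).2)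

/-- The internal Hamiltonian `Ĥ = H(1) - H^{VB}`, with `m` terms; the mark of the term `ν` is
`(Jᵥ, ω̃(ρ_{kᵥ}), ω̃(ρ_{lᵥ}))`. -/
def internalHam (β : ℝ) (m : ℕ) (y : ℕ → ℝ × ℝ × ℝ) : ℝ :=
  -∑ ν ∈ Finset.range m,
    ((1 / β) * Real.log (Real.cosh (β * (y ν).1) / Real.cosh (β * internalCoupling β (y ν)))
      + internalCoupling β (y ν))

/-- Disorder of the cavity Hamiltonian at connectivity `α`: `P_{2αN}` terms. -/
def cavityDisorder (β : ℝ) (μ : Measure ℝ) [IsProbabilityMeasure μ] (α' : ℝ≥0∞) (α : ℝ≥0) (N : ℕ)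
    [NeZero N] : Measure (ℕ × (ℕ → (ℝ × ℝ) × Fin N)) :=
  poissonMarks (2 * α * N) ((cavityMark β μ α').prod (uniformSite N))

/-- Disorder of the internal Hamiltonian at connectivity `α`: `P_{αN}` terms. -/
def internalDisorder (β : ℝ) (μ : Measure ℝ) [IsProbabilityMeasure μ] (α' : ℝ≥0∞) (α : ℝ≥0) (N : ℕ)
    [NeZero N] : Measure (ℕ × (ℕ → ℝ × ℝ × ℝ)) :=
  poissonMarks (α * N) (internalMark β μ α')

/-! ### The constraints on the fields

The replica symmetric structure has a single point, of weight `1`, so that the sums over the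
structure reduce to one term, and `⟨q̃_{2n}⟩ = q̃_{2n}(α̃)`, `⟨q̃_{2n}²⟩ = q̃_{2n}(α̃)²`. The series
over `n ≥ 1` are written as series over `n ≥ 0` with `n + 1` in place of `n`. -/

/-- The constraint on the cavity field, for `N` sites (divided by `N`) and every value of the
spins: the expectations are finite and
`d/dα (1/N) E ln e^{-β H̃(σ)} = 2 ∑_{n ≥ 1} (1/2n) E tanh^{2n}(βJ) (1 - q̃_{2n}(α̃))`
at every `α ≥ 0` (the derivative at `0` is one-sided). -/
def CavityConstraint (β : ℝ) (μ : Measure ℝ) [IsProbabilityMeasure μ] (α' : ℝ≥0∞) (N : ℕ)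
    [NeZero N] : Prop :=
  ∀ (σ : Config N) (α : ℝ≥0),
    Integrable (fun d => Real.log (Real.exp (-β * cavityHam β d.1 d.2 σ)))
      (cavityDisorder β μ α' α N) ∧
    (Summable fun n : ℕ => 1 / (2 * ((n : ℝ) + 1)) * (∫ J, Real.tanh (β * J) ^ (2 * (n + 1)) ∂μ) *
      (1 - auxOverlap β μ (2 * (n + 1)) α')) ∧
    HasDerivWithinAt
      (fun a : ℝ => (1 / (N : ℝ)) *
        ∫ d, Real.log (Real.exp (-β * cavityHam β d.1 d.2 σ)) ∂cavityDisorder β μ α' a.toNNReal N)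
      (2 * ∑' n : ℕ, 1 / (2 * ((n : ℝ) + 1)) * (∫ J, Real.tanh (β * J) ^ (2 * (n + 1)) ∂μ) *
        (1 - auxOverlap β μ (2 * (n + 1)) α'))
      (Set.Ici 0) α

/-- The constraint on the internal field: the expectations are finite and
`d/dα (1/N) E ln e^{-β Ĥ} = ∑_{n ≥ 1} (1/2n) E tanh^{2n}(βJ) (1 - q̃_{2n}(α̃)²)`
at every `α ≥ 0` (the derivative at `0` is one-sided). -/
def InternalConstraint (β : ℝ) (μ : Measure ℝ) [IsProbabilityMeasure μ] (α' : ℝ≥0∞) (N : ℕ)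
    [NeZero N] : Prop :=
  ∀ α : ℝ≥0,
    Integrable (fun d => Real.log (Real.exp (-β * internalHam β d.1 d.2)))
      (internalDisorder β μ α' α N) ∧
    (Summable fun n : ℕ => 1 / (2 * ((n : ℝ) + 1)) * (∫ J, Real.tanh (β * J) ^ (2 * (n + 1)) ∂μ) *
      (1 - auxOverlap β μ (2 * (n + 1)) α' ^ 2)) ∧
    HasDerivWithinAt
      (fun a : ℝ => (1 / (N : ℝ)) *
        ∫ d, Real.log (Real.exp (-β * internalHam β d.1 d.2))
          ∂internalDisorder β μ α' a.toNNReal N)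
      (∑' n : ℕ, 1 / (2 * ((n : ℝ) + 1)) * (∫ J, Real.tanh (β * J) ^ (2 * (n + 1)) ∂μ) *
        (1 - auxOverlap β μ (2 * (n + 1)) α' ^ 2))
      (Set.Ici 0) α

/-! ### Trial functions -/

/-- `ln (∑_σ e^{-β H̃(σ)} / e^{-β Ĥ})`, as a function of the disorder of the two fields. -/
def trialLog {N : ℕ} (β : ℝ)
    (d : (ℕ × (ℕ → (ℝ × ℝ) × Fin N)) × (ℕ × (ℕ → ℝ × ℝ × ℝ))) : ℝ :=
  Real.log (partitionFn β (cavityHam β d.1.1 d.1.2) /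
    Real.exp (-β * internalHam β d.2.1 d.2.2))

/-- The trial function `G_N`. -/
def trialG (β : ℝ) (α : ℝ≥0) (μ : Measure ℝ) [IsProbabilityMeasure μ] (α' : ℝ≥0∞) (N : ℕ)
    [NeZero N] : ℝ :=
  (1 / (N : ℝ)) *
    ∫ d, trialLog β d ∂(cavityDisorder β μ α' α N).prod (internalDisorder β μ α' α N)

/-- `ln cosh (β ∑_{ν ≤ m} J̃ᵥ)`. -/
def cavityLogCosh (β : ℝ) (d : ℕ × (ℕ → ℝ × ℝ)) : ℝ :=
  Real.log (Real.cosh (β * ∑ ν ∈ Finset.range d.1, cavityCoupling β (d.2 ν)))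

/-- `G_RS(α̃)`. -/
def GRS (β : ℝ) (α : ℝ≥0) (μ : Measure ℝ) [IsProbabilityMeasure μ] (α' : ℝ≥0∞) : ℝ :=
  Real.log 2 + (∫ d, cavityLogCosh β d ∂poissonMarks (2 * α) (cavityMark β μ α'))
    + α * (∫ J, Real.log (Real.cosh (β * J)) ∂μ)
    - 2 * α * (∫ p, Real.log (Real.cosh (β * cavityCoupling β p)) ∂cavityMark β μ α')
    + α * (∫ p, Real.log (Real.cosh (β * internalCoupling β p)) ∂internalMark β μ α')

/-- The general term, of index `n + 1`, of the series in `F_RS(α̃)`. -/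
def rsTerm (β : ℝ) (μ : Measure ℝ) [IsProbabilityMeasure μ] (α' : ℝ≥0∞) (n : ℕ) : ℝ :=
  1 / (2 * ((n : ℝ) + 1)) * (∫ J, Real.tanh (β * J) ^ (2 * (n + 1)) ∂μ) *
    (1 - auxOverlap β μ (2 * (n + 1)) α') ^ 2

/-- `F_RS(α̃)`. -/
def FRS (β : ℝ) (α : ℝ≥0) (μ : Measure ℝ) [IsProbabilityMeasure μ] (α' : ℝ≥0∞) : ℝ :=
  Real.log 2 + (∫ d, cavityLogCosh β d ∂poissonMarks (2 * α) (cavityMark β μ α'))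
    + α * ∑' n : ℕ, rsTerm β μ α' n

/-- The auxiliary system has an infinite volume limit: at every finite connectivity the Gibbs
average of a random spin converges in law, those of two random spins become independent, and the
averaged multi-overlaps converge; all these limits converge as the connectivity tends to `∞`. -/
def HasAuxLimits (β : ℝ) (μ : Measure ℝ) [IsProbabilityMeasure μ] : Prop :=
  (∀ a : ℝ≥0,
    Tendsto (fun M : ℕ => auxLawFinite β μ a (M + 1)) atTop (𝓝 (auxLaw β μ a)) ∧
    Tendsto (fun M : ℕ => auxPairLawFinite β μ a (M + 1)) atTop
      (𝓝 ((auxLaw β μ a).prod (auxLaw β μ a))) ∧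
    ∀ n : ℕ, Tendsto (fun M : ℕ => auxOverlapFinite β μ (2 * n) a (M + 1)) atTop
      (𝓝 (auxOverlap β μ (2 * n) a))) ∧
  Tendsto (fun a : ℝ≥0 => auxLaw β μ a) atTop (𝓝 (auxLaw β μ ⊤)) ∧
  ∀ n : ℕ, Tendsto (fun a : ℝ≥0 => auxOverlap β μ (2 * n) a) atTop
    (𝓝 (auxOverlap β μ (2 * n) ⊤))

end

end DilutedSpinGlass

namespace DilutedSpinGlass

noncomputable section

set_option linter.unusedSectionVars false

/-! ### Compound Poisson laws -/

section CompoundPoisson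

variable {E : Type} [NormedAddCommGroup E] [NormedSpace ℝ E] [MeasurableSpace E] [BorelSpace E]
  [SecondCountableTopology E]

/-! All the Hamiltonians are treated as random vectors of log-weights indexed by the configurations.
A bond contributes the vector `log (cosh (βJ) + u σ * sinh (βJ))` with `|u σ| ≤ 1`: `u` is a product
of two spins for a Viana-Bray bond, `w` times a spin for a cavity bond, and the constant `w * w'`
for an internal bond. The identity `log_cosh_div_cosh_add` shows that the modulated couplings,
together with their `log cosh` corrections, are exactly of this form. The log-weights of a system
are then a Poisson number of independent bond vectors, and the expected log-partition function is
the integral of `logSumExp` against a compound Poisson law.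

The exponential of a bond vector is affine in `u`. Adding a bond to log-weights `v` therefore
increases `logSumExp` by the same expression with `u` replaced by its Gibbs mean
(`logSumExp_add_bondLog`). For symmetric `J` the expected increment is `energy 1 - energy ⟨u⟩`,
where `energy c` is a power series in `c ^ 2` with nonnegative coefficients. Comparing two kinds of
bond thus reduces to comparing even moments of `⟨u⟩`. In terms of replicas, with `Q` the
multi-overlap and `q` the corresponding moment of the auxiliary spin, this is the inequality `⟨(Q -
q) ^ 2⟩ ≥ 0` (`bond_increment_le`).

No interpolation derivative is needed. The Viana-Bray bonds of rate `αN` and the internal bonds of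
rate `αN` together form one compound Poisson sum of rate `2αN` with an evenly mixed bond law. It has
the same number of terms as the cavity sum, so `compoundPoisson_comparison` exchanges the terms one
by one. This gives the bound at every `N`. The cavity system consists of free spins, and Poisson
thinning makes its sites identical with rate `2α`, so the trial function is computed exactly and `N`
cancels. The series form is `1 - 2q + q ^ 2 = (1 - q) ^ 2` applied coefficientwise.

The same comparison, with two separate blocks of sites against one system, gives superadditivity and
hence the limit of the free energy. The auxiliary spins are free as well: a Gibbs average is `tanh`
of a compound Poisson field whose law does not depend on the volume. At infinite connectivity this
symmetric field escapes to infinity unless `J = 0` almost surely, and the Gibbs average becomes a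
fair sign. -/

/-- The law of the sum of `m` independent variables of law `ν`. -/
def sumLaw (ν : Measure E) [IsProbabilityMeasure ν] (m : ℕ) : Measure E :=
  (Measure.infinitePi fun _ : ℕ => ν).map fun x => ∑ i ∈ Finset.range m, x i

/-- The law of the sum of a Poisson number of independent variables of law `ν`. -/
def compoundPoisson (r : ℝ≥0) (ν : Measure E) [IsProbabilityMeasure ν] : Measure E :=
  (poissonMarks r ν).map fun d => ∑ i ∈ Finset.range d.1, d.2 i

theorem measurable_sum_marks {S : Type} [MeasurableSpace S] {h : S → E} (hh : Measurable h) :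
    Measurable fun d : ℕ × (ℕ → S) => ∑ i ∈ Finset.range d.1, h (d.2 i) := by
  refine measurable_from_prod_countable_right fun m => ?_
  exact Finset.measurable_sum (Finset.range m) fun i _ => hh.comp (measurable_pi_apply i)

theorem measurable_sum_range (m : ℕ) :
    Measurable fun x : ℕ → E => ∑ i ∈ Finset.range m, x i :=
  Finset.measurable_sum _ fun i _ => measurable_pi_apply i

instance (ν : Measure E) [IsProbabilityMeasure ν] (m : ℕ) : IsProbabilityMeasure (sumLaw ν m) :=
  Measure.isProbabilityMeasure_map (measurable_sum_range m).aemeasurable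

instance (r : ℝ≥0) (ν : Measure E) [IsProbabilityMeasure ν] :
    IsProbabilityMeasure (compoundPoisson r ν) :=
  Measure.isProbabilityMeasure_map (measurable_sum_marks measurable_id).aemeasurable

/-- A coordinatewise map turns the i.i.d. sequence of marks into an i.i.d. sequence of the image
law, leaving the Poisson number untouched. This is the passage from marked disorder to compound
Poisson laws. -/
theorem poissonMarks_map {S : Type} [MeasurableSpace S] (r : ℝ≥0) (ν : Measure S)
    [IsProbabilityMeasure ν] {h : S → E} (hh : Measurable h)
    [IsProbabilityMeasure (ν.map h)] :
    (poissonMarks r ν).map (fun d => ∑ i ∈ Finset.range d.1, h (d.2 i)) =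
      compoundPoisson r (ν.map h) := by
  have h1 : poissonMarks r (ν.map h) =
      (poissonMarks r ν).map (Prod.map id fun x : ℕ → S => fun i => h (x i)) := by
    unfold poissonMarks
    rw [← Measure.infinitePi_map_pi (μ := fun _ : ℕ => ν) (f := fun _ => h) fun _ => hh,
      ← Measure.map_prod_map _ _ measurable_id (by fun_prop), Measure.map_id]
  have h2 : Measurable fun d : ℕ × (ℕ → E) => ∑ i ∈ Finset.range d.1, d.2 i :=
    measurable_sum_marks measurable_id
  rw [compoundPoisson, h1, Measure.map_map h2 (by fun_prop)]
  rfl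

theorem sumLaw_zero (ν : Measure E) [IsProbabilityMeasure ν] : sumLaw ν 0 = Measure.dirac 0 := by
  simp [sumLaw, Measure.map_const]

theorem sumLaw_succ (ν : Measure E) [IsProbabilityMeasure ν] (m : ℕ) :
    sumLaw ν (m + 1) = sumLaw ν m ∗ ν := by
  have hind : iIndepFun (fun (i : ℕ) (x : ℕ → E) => x i) (Measure.infinitePi fun _ : ℕ => ν) :=
    iIndepFun_infinitePi (X := fun _ x => x) fun _ => measurable_id
  have h1 : IndepFun (fun x : ℕ → E => ∑ i ∈ Finset.range m, x i) (fun x => x m)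
      (Measure.infinitePi fun _ : ℕ => ν) := by
    have := hind.indepFun_finsetSum_of_notMem (fun i => measurable_pi_apply i)
      (s := Finset.range m) (i := m) (by simp)
    convert! this using 1
    ext x; simp
  have h2 := h1.map_add_eq_map_conv_map (measurable_sum_range m) (measurable_pi_apply m)
  rw [Measure.infinitePi_map_eval] at h2
  rw [sumLaw, sumLaw, ← h2]
  congr 1
  ext x
  simp [Finset.sum_range_succ]

/-! ### First moments and Wald's identity. -/

theorem integrable_natCast_poisson (r : ℝ≥0) :
    Integrable (fun m : ℕ => (m : ℝ)) (poissonMeasure r) ∧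
      ∫ m : ℕ, (m : ℝ) ∂poissonMeasure r = r := by
  have key : HasSum (fun n : ℕ => Real.exp (-r) * (r : ℝ) ^ n / (n.factorial : ℝ) * (n : ℝ)) r := by
    have h := (hasSum_one_poissonMeasure r).mul_left (r : ℝ)
    -- The term of index `0` vanishes, and the term of index `n + 1` is `r` times the Poisson weight
    -- of `n`.
    rw [← hasSum_nat_add_iff' 1]
    simp only [Finset.range_one, Finset.sum_singleton, CharP.cast_eq_zero, mul_zero, sub_zero]
    convert! h using 1
    · ext n
      rw [Nat.factorial_succ]
      push_cast
      field_simp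
      ring
    · simp
  refine ⟨integrable_poissonMeasure_iff.2 ?_, ?_⟩
  · simpa using key.summable
  · rw [integral_poissonMeasure]
    simpa using key.tsum_eq

/-- Conditioning on the number of terms. The codomain is a general normed space because both complex
characteristic functions and real log-partition functions are integrated. -/
theorem integral_compoundPoisson {G : Type} [NormedAddCommGroup G] [NormedSpace ℝ G] (r : ℝ≥0)
    (ν : Measure E) [IsProbabilityMeasure ν] {f : E → G}
    (hfm : StronglyMeasurable f) (hf : Integrable f (compoundPoisson r ν)) :
    ∫ v, f v ∂compoundPoisson r ν = ∫ m, ∫ v, f v ∂sumLaw ν m ∂poissonMeasure r := by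
  have hm : Measurable fun d : ℕ × (ℕ → E) => ∑ i ∈ Finset.range d.1, d.2 i :=
    measurable_sum_marks measurable_id
  have hf' := hf
  rw [compoundPoisson, integrable_map_measure hf.1 hm.aemeasurable] at hf'
  rw [compoundPoisson, integral_map hm.aemeasurable hf.1]
  rw [poissonMarks] at hf' ⊢
  refine (integral_prod _ hf').trans ?_
  refine integral_congr_ae (Eventually.of_forall fun m => ?_)
  exact (integral_map (measurable_sum_range m).aemeasurable hfm.aestronglyMeasurable).symm

theorem integrable_norm_sumLaw (ν : Measure E) [IsProbabilityMeasure ν]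
    (hν : Integrable (fun x => x) ν) (m : ℕ) :
    Integrable (fun x => x) (sumLaw ν m) ∧ ∫ x, ‖x‖ ∂sumLaw ν m ≤ m * ∫ x, ‖x‖ ∂ν := by
  have hm := measurable_sum_range (E := E) m
  have hi : ∀ i, Integrable (fun x : ℕ → E => x i) (Measure.infinitePi fun _ : ℕ => ν) := by
    intro i
    exact (measurePreserving_eval_infinitePi (fun _ : ℕ => ν) i).integrable_comp_of_integrable hν
  constructor
  · rw [sumLaw, integrable_map_measure (by fun_prop) hm.aemeasurable]
    exact integrable_finsetSum _ fun i _ => hi i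
  · rw [sumLaw, integral_map hm.aemeasurable (by fun_prop)]
    calc ∫ x : ℕ → E, ‖∑ i ∈ Finset.range m, x i‖ ∂(Measure.infinitePi fun _ : ℕ => ν)
        ≤ ∫ x : ℕ → E, ∑ i ∈ Finset.range m, ‖x i‖ ∂(Measure.infinitePi fun _ : ℕ => ν) := by
          refine integral_mono (integrable_finsetSum _ fun i _ => hi i).norm
            (integrable_finsetSum _ fun i _ => (hi i).norm) fun x => norm_sum_le _ _
      _ = m * ∫ x, ‖x‖ ∂ν := by
          rw [integral_finsetSum _ fun i _ => (hi i).norm]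
          have : ∀ i, ∫ x : ℕ → E, ‖x i‖ ∂(Measure.infinitePi fun _ : ℕ => ν) = ∫ x, ‖x‖ ∂ν := by
            intro i
            have e := integral_map (μ := Measure.infinitePi fun _ : ℕ => ν) (f := fun x => ‖x‖)
              (measurable_pi_apply i).aemeasurable (by fun_prop)
            rw [Measure.infinitePi_map_eval] at e
            exact e.symm
          simp [this]

/-- Given `m` terms, the expected norm is at most `m` times that of one term, and the Poisson law
has a finite mean. -/
theorem integrable_compoundPoisson (r : ℝ≥0) (ν : Measure E) [IsProbabilityMeasure ν]
    (hν : Integrable (fun x => x) ν) : Integrable (fun x => x) (compoundPoisson r ν) := by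
  have hm : Measurable fun d : ℕ × (ℕ → E) => ∑ i ∈ Finset.range d.1, d.2 i :=
    measurable_sum_marks measurable_id
  rw [compoundPoisson, integrable_map_measure (by fun_prop) hm.aemeasurable, poissonMarks,
    Function.comp_def, integrable_prod_iff hm.aestronglyMeasurable]
  constructor
  · refine Eventually.of_forall fun m => ?_
    have := (integrable_norm_sumLaw ν hν m).1
    rw [sumLaw, integrable_map_measure (by fun_prop) (measurable_sum_range m).aemeasurable] at this
    exact this
  · refine ((integrable_natCast_poisson r).1.mul_const (∫ x, ‖x‖ ∂ν)).mono' ?_ ?_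
    · exact AEStronglyMeasurable.of_discrete
    · refine Eventually.of_forall fun m => ?_
      have := (integrable_norm_sumLaw ν hν m).2
      rw [sumLaw, integral_map (measurable_sum_range m).aemeasurable (by fun_prop)] at this
      rw [Real.norm_of_nonneg (integral_nonneg fun _ => norm_nonneg _)]
      exact this

theorem integral_sumLaw_real (ν : Measure ℝ) [IsProbabilityMeasure ν]
    (hν : Integrable (fun x => x) ν) (m : ℕ) : ∫ x, x ∂sumLaw ν m = m * ∫ x, x ∂ν := by
  have hi : ∀ i, Integrable (fun x : ℕ → ℝ => x i) (Measure.infinitePi fun _ : ℕ => ν) := by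
    intro i
    exact (measurePreserving_eval_infinitePi (fun _ : ℕ => ν) i).integrable_comp_of_integrable hν
  rw [sumLaw, integral_map (measurable_sum_range m).aemeasurable (by fun_prop),
    integral_finsetSum _ fun i _ => hi i]
  have : ∀ i, ∫ x : ℕ → ℝ, x i ∂(Measure.infinitePi fun _ : ℕ => ν) = ∫ x, x ∂ν := by
    intro i
    have e := integral_map (μ := Measure.infinitePi fun _ : ℕ => ν) (f := fun x : ℝ => x)
      (measurable_pi_apply i).aemeasurable (by fun_prop)
    rw [Measure.infinitePi_map_eval] at e
    exact e.symm
  simp [this]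

/-- Wald's identity. -/
theorem wald {S : Type} [MeasurableSpace S] (r : ℝ≥0) (ν : Measure S) [IsProbabilityMeasure ν]
    {h : S → ℝ} (hm : Measurable h) (hh : Integrable h ν) :
    Integrable (fun d => ∑ i ∈ Finset.range d.1, h (d.2 i)) (poissonMarks r ν) ∧
      ∫ d, ∑ i ∈ Finset.range d.1, h (d.2 i) ∂poissonMarks r ν = r * ∫ s, h s ∂ν := by
  have : IsProbabilityMeasure (ν.map h) := Measure.isProbabilityMeasure_map hm.aemeasurable
  have hs := measurable_sum_marks hm
  have hi : Integrable (fun x => x) (ν.map h) :=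
    (integrable_map_measure (by fun_prop) hm.aemeasurable).2 hh
  have h1 := integrable_compoundPoisson r _ hi
  have h2 := integral_compoundPoisson r _ (f := fun x : ℝ => x) stronglyMeasurable_id h1
  simp_rw [integral_sumLaw_real _ hi] at h2
  rw [integral_mul_const, (integrable_natCast_poisson r).2,
    integral_map hm.aemeasurable (by fun_prop)] at h2
  rw [← poissonMarks_map r ν hm] at h1 h2
  rw [integrable_map_measure (by fun_prop) hs.aemeasurable] at h1
  rw [integral_map hs.aemeasurable (by fun_prop)] at h2
  exact ⟨h1, h2⟩

/-! ### Characteristic functions, superposition and comparison. -/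

theorem charFunDual_sumLaw (ν : Measure E) [IsProbabilityMeasure ν] (m : ℕ)
    (L : StrongDual ℝ E) : charFunDual (sumLaw ν m) L = charFunDual ν L ^ m := by
  induction m with
  | zero => simp [sumLaw_zero]
  | succ m ih => rw [sumLaw_succ, charFunDual_conv, ih, pow_succ]

/-- Given `m` terms the characteristic function is an `m`-th power; summing against the Poisson
weights produces an exponential series. -/
theorem charFunDual_compoundPoisson (r : ℝ≥0) (ν : Measure E) [IsProbabilityMeasure ν]
    (L : StrongDual ℝ E) :
    charFunDual (compoundPoisson r ν) L = Complex.exp (r * (charFunDual ν L - 1)) := by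
  have hi : Integrable (fun v => Complex.exp (L v * Complex.I)) (compoundPoisson r ν) :=
    (integrable_const (1 : ℝ)).mono (by fun_prop) (by simp)
  rw [charFunDual_apply, integral_compoundPoisson r ν (Continuous.stronglyMeasurable (by fun_prop)) hi]
  simp_rw [← charFunDual_apply, charFunDual_sumLaw]
  rw [integral_poissonMeasure]
  have h1 := (NormedSpace.expSeries_div_hasSum_exp ((r : ℂ) * charFunDual ν L)).mul_left
    (Complex.exp (-r))
  rw [← Complex.exp_eq_exp_ℂ, ← Complex.exp_add] at h1
  convert! h1.tsum_eq using 1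
  · congr 1
    ext n
    rw [Complex.real_smul]
    push_cast
    rw [mul_pow]
    ring
  · congr 1; ring

/-- Superposition of independent compound Poisson variables. -/
theorem compoundPoisson_conv [CompleteSpace E] (r s t : ℝ≥0) (ν₁ ν₂ ν : Measure E)
    [IsProbabilityMeasure ν₁] [IsProbabilityMeasure ν₂] [IsProbabilityMeasure ν]
    (h : ∀ L : StrongDual ℝ E, (r : ℂ) * (charFunDual ν₁ L - 1) + s * (charFunDual ν₂ L - 1) =
      t * (charFunDual ν L - 1)) :
    compoundPoisson r ν₁ ∗ compoundPoisson s ν₂ = compoundPoisson t ν := by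
  refine Measure.ext_of_charFunDual ?_
  ext L
  rw [charFunDual_conv, charFunDual_compoundPoisson, charFunDual_compoundPoisson,
    charFunDual_compoundPoisson, ← Complex.exp_add, h]

/-- Only the exponent `r * (φ - 1)` matters, where `φ` is the characteristic function of a jump.
Zero jumps can thus be traded against the rate, which is the mechanism of thinning. -/
theorem compoundPoisson_congr [CompleteSpace E] (r t : ℝ≥0) (ν₁ ν : Measure E)
    [IsProbabilityMeasure ν₁] [IsProbabilityMeasure ν]
    (h : ∀ L : StrongDual ℝ E, (r : ℂ) * (charFunDual ν₁ L - 1) = t * (charFunDual ν L - 1)) :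
    compoundPoisson r ν₁ = compoundPoisson t ν := by
  refine Measure.ext_of_charFunDual ?_
  ext L
  rw [charFunDual_compoundPoisson, charFunDual_compoundPoisson, h]

/-- Growth at most linear makes a first moment sufficient. The shift `v₀` stands for the bonds
already present. -/
theorem integrable_of_abs_le_add_norm {ν : Measure E} [IsFiniteMeasure ν]
    (hν : Integrable (fun x => x) ν) {F : E → ℝ} (hF : Measurable F) {A : ℝ}
    (hA : ∀ v, |F v| ≤ A + ‖v‖) (v₀ : E) : Integrable (fun v => F (v₀ + v)) ν := by
  refine (((integrable_const (A + ‖v₀‖)).add hν.norm)).mono'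
    (hF.comp (measurable_const_add v₀)).aestronglyMeasurable (Eventually.of_forall fun v => ?_)
  have h1 := hA (v₀ + v)
  have h2 := norm_add_le v₀ v
  simp only [Real.norm_eq_abs, Pi.add_apply]
  linarith

/-- Comparison of two compound Poisson laws by replacing the terms one at a time. -/
theorem compoundPoisson_comparison (r : ℝ≥0) (ν₁ ν₂ : Measure E)
    [IsProbabilityMeasure ν₁] [IsProbabilityMeasure ν₂]
    (h₁ : Integrable (fun x => x) ν₁) (h₂ : Integrable (fun x => x) ν₂)
    {F : E → ℝ} (hF : Measurable F) {A : ℝ} (hA : ∀ v, |F v| ≤ A + ‖v‖)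
    (hle : ∀ v₀, ∫ v, F (v₀ + v) ∂ν₁ ≤ ∫ v, F (v₀ + v) ∂ν₂) :
    ∫ v, F v ∂compoundPoisson r ν₁ ≤ ∫ v, F v ∂compoundPoisson r ν₂ := by
  -- The shift is kept arbitrary in the induction: the remaining terms are absorbed into it.
  have hsum : ∀ m v₀, ∫ v, F (v₀ + v) ∂sumLaw ν₁ m ≤ ∫ v, F (v₀ + v) ∂sumLaw ν₂ m := by
    intro m
    induction m with
    | zero => intro v₀; simp [sumLaw_zero]
    | succ m ih =>
      intro v₀
      have i1 := (integrable_norm_sumLaw ν₁ h₁ m).1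
      have i2 := (integrable_norm_sumLaw ν₂ h₂ m).1
      have i12 : Integrable (fun v => F (v₀ + v)) (sumLaw ν₁ m ∗ ν₂) := by
        refine integrable_of_abs_le_add_norm ?_ hF hA v₀
        rw [Measure.conv, integrable_map_measure (by fun_prop) (by fun_prop)]
        exact (i1.comp_fst ν₂).add (h₂.comp_snd (sumLaw ν₁ m))
      have i11 : Integrable (fun v => F (v₀ + v)) (sumLaw ν₁ m ∗ ν₁) := by
        rw [← sumLaw_succ]
        exact integrable_of_abs_le_add_norm (integrable_norm_sumLaw ν₁ h₁ (m + 1)).1 hF hA v₀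
      have i22 : Integrable (fun v => F (v₀ + v)) (sumLaw ν₂ m ∗ ν₂) := by
        rw [← sumLaw_succ]
        exact integrable_of_abs_le_add_norm (integrable_norm_sumLaw ν₂ h₂ (m + 1)).1 hF hA v₀
      have e1 : ∀ (ρ ρ' : Measure E) [IsProbabilityMeasure ρ] [IsProbabilityMeasure ρ'],
          Integrable (fun v => F (v₀ + v)) (ρ ∗ ρ') →
          Integrable (fun v => ∫ u, F (v₀ + (v + u)) ∂ρ') ρ := by
        intro ρ ρ' _ _ hi
        rw [Measure.conv, integrable_map_measure hi.1 (by fun_prop)] at hi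
        exact hi.integral_prod_left
      -- The last term is exchanged by `hle`, with the first `m` terms added to the shift.
      have step1 : ∫ v, F (v₀ + v) ∂(sumLaw ν₁ m ∗ ν₁) ≤ ∫ v, F (v₀ + v) ∂(sumLaw ν₁ m ∗ ν₂) := by
        rw [integral_conv i11, integral_conv i12]
        refine integral_mono (e1 _ _ i11) (e1 _ _ i12) fun v => ?_
        simpa only [add_assoc] using hle (v₀ + v)
      -- The first `m` terms are exchanged by the induction hypothesis, with the last term, already
      -- of law `ν₂`, added to the shift.
      have step2 : ∫ v, F (v₀ + v) ∂(sumLaw ν₁ m ∗ ν₂) ≤ ∫ v, F (v₀ + v) ∂(sumLaw ν₂ m ∗ ν₂) := by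
        rw [Measure.conv_comm (sumLaw ν₁ m), Measure.conv_comm (sumLaw ν₂ m)] at *
        rw [integral_conv i12, integral_conv i22]
        refine integral_mono (e1 _ _ i12) (e1 _ _ i22) fun v => ?_
        simpa only [add_assoc] using ih (v₀ + v)
      rw [sumLaw_succ, sumLaw_succ]
      exact step1.trans step2
  have j : ∀ (ν : Measure E) [IsProbabilityMeasure ν], Integrable (fun x => x) ν →
      Integrable F (compoundPoisson r ν) ∧
      Integrable (fun m => ∫ v, F v ∂sumLaw ν m) (poissonMeasure r) := by
    intro ν _ hν
    have h0 := integrable_of_abs_le_add_norm (integrable_compoundPoisson r ν hν) hF hA 0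
    simp only [zero_add] at h0
    refine ⟨h0, ?_⟩
    have hm : Measurable fun d : ℕ × (ℕ → E) => ∑ i ∈ Finset.range d.1, d.2 i :=
      measurable_sum_marks measurable_id
    rw [compoundPoisson, integrable_map_measure hF.aestronglyMeasurable hm.aemeasurable,
      poissonMarks] at h0
    refine h0.integral_prod_left.congr (Eventually.of_forall fun m => ?_)
    exact (integral_map (measurable_sum_range m).aemeasurable hF.aestronglyMeasurable).symm
  rw [integral_compoundPoisson r ν₁ hF.stronglyMeasurable (j ν₁ h₁).1, 
    integral_compoundPoisson r ν₂ hF.stronglyMeasurable (j ν₂ h₂).1]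
  -- The two laws share the rate, so the comparison at each fixed number of terms is integrated
  -- against the same Poisson law.
  refine integral_mono (j ν₁ h₁).2 (j ν₂ h₂).2 fun m => ?_
  simpa using hsum m 0

end CompoundPoisson

/-! ### Logarithms of hyperbolic functions -/

/-- `log (cosh y + u sinh y)`. -/
def bondLog (y u : ℝ) : ℝ := Real.log (Real.cosh y + u * Real.sinh y)

/-- `-1/2 log (1 - t²)`, which is `log cosh y` for `t = tanh y`. -/
def halfLog (t : ℝ) : ℝ := -(1 / 2) * Real.log (1 - t ^ 2)

theorem measurable_bondLog : Measurable fun p : ℝ × ℝ => bondLog p.1 p.2 := by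
  unfold bondLog; fun_prop

theorem measurable_halfLog : Measurable halfLog := by
  unfold halfLog; fun_prop

theorem measurable_tanh : Measurable Real.tanh := by
  have : Real.tanh = fun x => Real.sinh x / Real.cosh x := by
    ext x; exact Real.tanh_eq_sinh_div_cosh x
  rw [this]; fun_prop

/-- The middle quantity is the average of `exp y` and `exp (-y)` with weights `(1 + u) / 2` and `(1
- u) / 2`. -/
theorem exp_neg_abs_le_cosh_add {y u : ℝ} (hu : |u| ≤ 1) :
    Real.exp (-|y|) ≤ Real.cosh y + u * Real.sinh y ∧
      Real.cosh y + u * Real.sinh y ≤ Real.exp |y| := by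
  have h := abs_le.1 hu
  rw [Real.cosh_eq, Real.sinh_eq]
  rcases abs_cases y with ⟨h1, h2⟩ | ⟨h1, h2⟩
  · rw [h1]
    have : Real.exp (-y) ≤ Real.exp y := Real.exp_le_exp.2 (by linarith)
    constructor <;> nlinarith
  · rw [h1, neg_neg]
    have : Real.exp y ≤ Real.exp (-y) := Real.exp_le_exp.2 (by linarith)
    constructor <;> nlinarith

theorem cosh_add_pos {y u : ℝ} (hu : |u| ≤ 1) : 0 < Real.cosh y + u * Real.sinh y :=
  (Real.exp_pos _).trans_le (exp_neg_abs_le_cosh_add hu).1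

theorem abs_bondLog_le {y u : ℝ} (hu : |u| ≤ 1) : |bondLog y u| ≤ |y| := by
  have h := exp_neg_abs_le_cosh_add (y := y) hu
  rw [abs_le, bondLog]
  constructor
  · rw [Real.le_log_iff_exp_le (cosh_add_pos hu)]; exact h.1
  · rw [Real.log_le_iff_le_exp (cosh_add_pos hu)]; exact h.2

theorem exp_bondLog {y u : ℝ} (hu : |u| ≤ 1) :
    Real.exp (bondLog y u) = Real.cosh y + u * Real.sinh y :=
  Real.exp_log (cosh_add_pos hu)

/-- At a sign the bond function is the ordinary Boltzmann exponent, so Viana-Bray bonds belong to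
the same family as the cavity and internal ones. -/
theorem bondLog_of_sq_eq_one {y u : ℝ} (hu : u = 1 ∨ u = -1) : bondLog y u = y * u := by
  rcases hu with rfl | rfl
  · rw [bondLog, one_mul, Real.cosh_add_sinh, Real.log_exp, mul_one]
  · rw [bondLog, neg_one_mul, ← sub_eq_add_neg, Real.cosh_sub_sinh, Real.log_exp]; ring

theorem halfLog_tanh (y : ℝ) : halfLog (Real.tanh y) = Real.log (Real.cosh y) := by
  have h : 1 - Real.tanh y ^ 2 = (Real.cosh y ^ 2)⁻¹ := by
    have h1 := Real.cosh_sq y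
    have h2 := (Real.cosh_pos y).ne'
    rw [Real.tanh_eq_sinh_div_cosh]
    field_simp
    linarith
  rw [halfLog, h, Real.log_inv, Real.log_pow]
  push_cast; ring

theorem halfLog_le_halfLog {s t : ℝ} (hst : |s| ≤ |t|) (ht : |t| < 1) : halfLog s ≤ halfLog t := by
  have h1 := sq_le_sq.2 hst
  have h2 : t ^ 2 < 1 := by rwa [sq_lt_one_iff_abs_lt_one]
  have := Real.log_le_log (by linarith : 0 < 1 - t ^ 2) (by linarith : 1 - t ^ 2 ≤ 1 - s ^ 2)
  unfold halfLog
  linarith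

theorem halfLog_zero : halfLog 0 = 0 := by simp [halfLog]

theorem halfLog_nonneg {t : ℝ} (ht : |t| < 1) : 0 ≤ halfLog t := by
  have := halfLog_le_halfLog (s := 0) (by simp) ht
  rwa [halfLog_zero] at this

theorem log_cosh_nonneg (y : ℝ) : 0 ≤ Real.log (Real.cosh y) :=
  Real.log_nonneg (Real.one_le_cosh y)

theorem log_cosh_le_abs (y : ℝ) : Real.log (Real.cosh y) ≤ |y| := by
  have := abs_bondLog_le (y := y) (u := 0) (by simp)
  simp only [bondLog, zero_mul, add_zero] at this
  exact (le_abs_self _).trans this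

theorem abs_tanh_mul_le {y c : ℝ} (hc : |c| ≤ 1) : |Real.tanh y * c| ≤ |Real.tanh y| := by
  rw [abs_mul]
  exact mul_le_of_le_one_right (abs_nonneg _) hc

theorem abs_tanh_mul_lt_one {y c : ℝ} (hc : |c| ≤ 1) : |Real.tanh y * c| < 1 :=
  (abs_tanh_mul_le hc).trans_lt (Real.abs_tanh_lt_one y)

theorem halfLog_tanh_mul_le {y c : ℝ} (hc : |c| ≤ 1) : halfLog (Real.tanh y * c) ≤ |y| := by
  refine (halfLog_le_halfLog (abs_tanh_mul_le hc) (Real.abs_tanh_lt_one y)).trans ?_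
  rw [halfLog_tanh]
  exact log_cosh_le_abs y

/-- The product of the two arguments of the logarithms is `cosh² y * (1 - tanh² y * u²)`.
Symmetrising in the coupling thus leaves an even function of `u`. -/
theorem bondLog_add_bondLog_neg {y u : ℝ} (hu : |u| ≤ 1) :
    bondLog y u + bondLog (-y) u = 2 * (Real.log (Real.cosh y) - halfLog (Real.tanh y * u)) := by
  have h1 : Real.cosh (-y) + u * Real.sinh (-y) = Real.cosh y - u * Real.sinh y := by
    rw [Real.cosh_neg, Real.sinh_neg]; ring
  have h2 := cosh_add_pos (y := y) hu
  have h3 := cosh_add_pos (y := -y) hu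
  have hc := Real.cosh_pos y
  have ht : 0 < 1 - (Real.tanh y * u) ^ 2 := by
    have := (sq_lt_one_iff_abs_lt_one _).2 (abs_tanh_mul_lt_one (y := y) hu)
    linarith
  have h4 : (Real.cosh y + u * Real.sinh y) * (Real.cosh (-y) + u * Real.sinh (-y)) =
      Real.cosh y ^ 2 * (1 - (Real.tanh y * u) ^ 2) := by
    rw [h1, Real.tanh_eq_sinh_div_cosh]; field_simp; ring
  rw [bondLog, bondLog, ← Real.log_mul h2.ne' h3.ne', h4, Real.log_mul (by positivity) ht.ne',
    Real.log_pow, halfLog]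
  push_cast; ring

theorem hasSum_halfLog {t : ℝ} (ht : |t| < 1) :
    HasSum (fun n : ℕ => 1 / (2 * ((n : ℝ) + 1)) * t ^ (2 * (n + 1))) (halfLog t) := by
  have h1 : |t ^ 2| < 1 := by
    rw [abs_of_nonneg (sq_nonneg t)]; rwa [sq_lt_one_iff_abs_lt_one]
  have h := (Real.hasSum_pow_div_log_of_abs_lt_one h1).mul_left (1 / 2)
  convert! h using 1
  · ext n; rw [← pow_mul]; field_simp
  · unfold halfLog; ring

/-- The cavity Boltzmann factor. -/
theorem log_cosh_div_cosh_add {β : ℝ} (hβ : 0 < β) (J : ℝ) {w s : ℝ} (hw : |w| ≤ 1)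
    (hs : s = 1 ∨ s = -1) :
    Real.log (Real.cosh (β * J) / Real.cosh (β * modulatedCoupling β J w)) +
      β * modulatedCoupling β J w * s = bondLog (β * J) (w * s) := by
  set K := modulatedCoupling β J w
  have h1 : Real.tanh (β * K) = Real.tanh (β * J) * w := tanh_modulatedCoupling hβ J hw
  have hws : |w * s| ≤ 1 := by
    rcases hs with rfl | rfl <;> simpa using hw
  have e : |s| ≤ 1 := by rcases hs with rfl | rfl <;> simp
  -- After exponentiation the claim is linear in `cosh (βK)` and `sinh (βK)`, and the defining
  -- relation of `K` expresses the latter through the former.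
  apply Real.exp_injective
  rw [exp_bondLog hws, Real.exp_add, Real.exp_log (div_pos (Real.cosh_pos _) (Real.cosh_pos _)),
    ← bondLog_of_sq_eq_one hs, exp_bondLog e]
  have hJ := (Real.cosh_pos (β * J)).ne'
  have hK := (Real.cosh_pos (β * K)).ne'
  rw [Real.tanh_eq_sinh_div_cosh, Real.tanh_eq_sinh_div_cosh, div_eq_iff hK] at h1
  rw [h1]
  field_simp

theorem log_cosh_modulatedCoupling {β : ℝ} (hβ : 0 < β) (J : ℝ) {w : ℝ} (hw : |w| ≤ 1) :
    Real.log (Real.cosh (β * modulatedCoupling β J w)) = halfLog (Real.tanh (β * J) * w) := by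
  rw [← tanh_modulatedCoupling hβ J hw, halfLog_tanh]

theorem measurable_modulatedCoupling (β : ℝ) :
    Measurable fun p : ℝ × ℝ => modulatedCoupling β p.1 p.2 := by
  have := measurable_tanh
  unfold modulatedCoupling Real.artanh
  fun_prop

/-! ### The energy series -/

/-- `E (-1/2) log (1 - tanh² (βJ) c²)`. -/
def energy (β : ℝ) (μ : Measure ℝ) (c : ℝ) : ℝ := ∫ J, halfLog (Real.tanh (β * J) * c) ∂μ

/-- `(1/2n) E tanh^{2n} (βJ)`, with `n + 1` in place of `n`. -/
def energyCoeff (β : ℝ) (μ : Measure ℝ) (n : ℕ) : ℝ :=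
  1 / (2 * ((n : ℝ) + 1)) * ∫ J, Real.tanh (β * J) ^ (2 * (n + 1)) ∂μ

section Energy

variable {β : ℝ} {μ : Measure ℝ}

theorem energyCoeff_nonneg (n : ℕ) : 0 ≤ energyCoeff β μ n := by
  refine mul_nonneg (by positivity) (integral_nonneg fun J => ?_)
  rw [pow_mul]; exact pow_nonneg (sq_nonneg _) _

theorem measurable_halfLog_tanh_mul (β : ℝ) :
    Measurable fun p : ℝ × ℝ => halfLog (Real.tanh (β * p.1) * p.2) := by
  have := measurable_tanh
  have := measurable_halfLog
  fun_prop

theorem integrable_halfLog_tanh_mul {Ω : Type} [MeasurableSpace Ω] {P : Measure Ω} {J c : Ω → ℝ}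
    (hJm : Measurable J) (hcm : Measurable c) (hJ : Integrable J P) (hc : ∀ᵐ x ∂P, |c x| ≤ 1) :
    Integrable (fun x => halfLog (Real.tanh (β * J x) * c x)) P := by
  refine (hJ.const_mul β).norm.mono'
    ((measurable_halfLog_tanh_mul β).comp (hJm.prodMk hcm)).aestronglyMeasurable ?_
  filter_upwards [hc] with x hx
  rw [Real.norm_of_nonneg (halfLog_nonneg (abs_tanh_mul_lt_one hx))]
  exact halfLog_tanh_mul_le hx

theorem hasSum_energy (hint : Integrable (fun J : ℝ => J) μ) {c : ℝ} (hc : |c| ≤ 1) :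
    HasSum (fun n => energyCoeff β μ n * c ^ (2 * (n + 1))) (energy β μ c) := by
  have hi := integrable_halfLog_tanh_mul (β := β) (c := fun _ => c) measurable_id measurable_const
    hint (Eventually.of_forall fun _ => hc)
  have h := hasSum_integral_of_dominated_convergence (μ := μ)
    (F := fun (n : ℕ) (J : ℝ) => 1 / (2 * ((n : ℝ) + 1)) * (Real.tanh (β * J) * c) ^ (2 * (n + 1)))
    (f := fun J => halfLog (Real.tanh (β * J) * c))
    -- The terms are nonnegative with an integrable sum, so the series serves as its own dominating
    -- family.
    (fun n J => 1 / (2 * ((n : ℝ) + 1)) * (Real.tanh (β * J) * c) ^ (2 * (n + 1)))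
    (fun n => by
      have := measurable_tanh
      exact Measurable.aestronglyMeasurable (by fun_prop))
    (fun n => Eventually.of_forall fun J => by
      rw [Real.norm_of_nonneg]
      refine mul_nonneg (by positivity) ?_
      rw [pow_mul]; exact pow_nonneg (sq_nonneg _) _)
    (Eventually.of_forall fun J => (hasSum_halfLog (abs_tanh_mul_lt_one hc)).summable)
    (by
      refine hi.congr (Eventually.of_forall fun J => ?_)
      exact (hasSum_halfLog (abs_tanh_mul_lt_one hc)).tsum_eq.symm)
    (Eventually.of_forall fun J => hasSum_halfLog (abs_tanh_mul_lt_one hc))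
  convert! h using 1
  ext n
  simp_rw [mul_pow]
  rw [integral_const_mul, integral_mul_const, energyCoeff]
  ring

theorem summable_energyCoeff (hint : Integrable (fun J : ℝ => J) μ) :
    Summable (energyCoeff β μ) := by
  simpa using (hasSum_energy (β := β) hint (c := 1) (by simp)).summable

theorem hasSum_energyCoeff (hint : Integrable (fun J : ℝ => J) μ) :
    HasSum (energyCoeff β μ) (energy β μ 1) := by
  simpa using hasSum_energy (β := β) hint (c := 1) (by simp)

theorem energy_one : energy β μ 1 = ∫ J, Real.log (Real.cosh (β * J)) ∂μ := by
  simp [energy, halfLog_tanh]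

theorem measurable_energy [SFinite μ] : Measurable (energy β μ) := by
  have : StronglyMeasurable fun c : ℝ => ∫ J, halfLog (Real.tanh (β * J) * c) ∂μ := by
    refine StronglyMeasurable.integral_prod_right (f := fun c J => halfLog (Real.tanh (β * J) * c)) ?_
    exact ((measurable_halfLog_tanh_mul β).comp measurable_swap).stronglyMeasurable
  exact this.measurable

theorem hasSum_integral_energy {Ω : Type} [MeasurableSpace Ω] {ρ : Measure Ω}
    [IsProbabilityMeasure ρ] {X : Ω → ℝ} (hX : Measurable X) (h1 : ∀ᵐ x ∂ρ, |X x| ≤ 1)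
    (hint : Integrable (fun J : ℝ => J) μ) :
    HasSum (fun n => energyCoeff β μ n * ∫ x, X x ^ (2 * (n + 1)) ∂ρ)
      (∫ x, energy β μ (X x) ∂ρ) := by
  have h := hasSum_integral_of_dominated_convergence (μ := ρ)
    (F := fun (n : ℕ) x => energyCoeff β μ n * X x ^ (2 * (n + 1)))
    (f := fun x => energy β μ (X x)) (fun n _ => energyCoeff β μ n)
    (fun n => Measurable.aestronglyMeasurable (by fun_prop))
    (fun n => by
      filter_upwards [h1] with x hx
      rw [norm_mul, Real.norm_of_nonneg (energyCoeff_nonneg n), norm_pow, Real.norm_eq_abs]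
      exact mul_le_of_le_one_right (energyCoeff_nonneg n) (pow_le_one₀ (abs_nonneg _) hx))
    (Eventually.of_forall fun x => summable_energyCoeff hint)
    (integrable_const _)
    (by filter_upwards [h1] with x hx using hasSum_energy hint hx)
  simpa only [integral_const_mul] using h

theorem abs_energy_le (hint : Integrable (fun J : ℝ => J) μ) {c : ℝ} (hc : |c| ≤ 1) :
    |energy β μ c| ≤ energy β μ 1 := by
  have h := hasSum_energy (β := β) hint hc
  have hn : ∀ n : ℕ, 0 ≤ c ^ (2 * (n + 1)) ∧ c ^ (2 * (n + 1)) ≤ 1 := by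
    intro n
    have h2 : c ^ 2 ≤ 1 := (sq_le_one_iff_abs_le_one c).2 hc
    rw [pow_mul]
    exact ⟨pow_nonneg (sq_nonneg _) _, pow_le_one₀ (sq_nonneg _) h2⟩
  rw [abs_of_nonneg (h.nonneg fun n => mul_nonneg (energyCoeff_nonneg n) (hn n).1)]
  exact hasSum_le (fun n => mul_le_of_le_one_right (energyCoeff_nonneg n) (hn n).2) h
    (hasSum_energyCoeff hint)

theorem integrable_energy [SFinite μ] {Ω : Type} [MeasurableSpace Ω] {ρ : Measure Ω}
    [IsProbabilityMeasure ρ] {X : Ω → ℝ} (hX : Measurable X) (h1 : ∀ᵐ x ∂ρ, |X x| ≤ 1)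
    (hint : Integrable (fun J : ℝ => J) μ) : Integrable (fun x => energy β μ (X x)) ρ := by
  refine (integrable_const (energy β μ 1)).mono' (measurable_energy.comp hX).aestronglyMeasurable ?_
  filter_upwards [h1] with x hx using abs_energy_le hint hx

/-- By symmetry of `J` the integral is half the sum of those at `βJ` and `-βJ`. The odd powers of
the hyperbolic tangent cancel, which is why only even numbers of replicas occur. -/
theorem integral_bondLog (hsymm : μ.map (fun J : ℝ => -J) = μ)
    (hint : Integrable (fun J : ℝ => J) μ) {c : ℝ} (hc : |c| ≤ 1) :
    Integrable (fun J => bondLog (β * J) c) μ ∧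
      ∫ J, bondLog (β * J) c ∂μ = energy β μ 1 - energy β μ c := by
  have hm : Measurable fun J : ℝ => bondLog (β * J) c :=
    measurable_bondLog.comp (by fun_prop : Measurable fun J : ℝ => (β * J, c))
  have hi : Integrable (fun J => bondLog (β * J) c) μ :=
    (hint.const_mul β).norm.mono' hm.aestronglyMeasurable
      (Eventually.of_forall fun J => abs_bondLog_le hc)
  refine ⟨hi, ?_⟩
  have hneg : ∫ J, bondLog (β * J) c ∂μ = ∫ J, bondLog (-(β * J)) c ∂μ := by
    conv_lhs => rw [← hsymm]
    rw [integral_map (by fun_prop) hm.aestronglyMeasurable]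
    simp only [mul_neg]
  have hi' : Integrable (fun J => bondLog (-(β * J)) c) μ := by
    have h2 := hi
    rw [← hsymm, integrable_map_measure hm.aestronglyMeasurable (by fun_prop)] at h2
    simpa [Function.comp_def] using h2
  have h1 := integrable_halfLog_tanh_mul (β := β) (c := fun _ => c) measurable_id measurable_const
    hint (Eventually.of_forall fun _ => hc)
  have h2 := integrable_halfLog_tanh_mul (β := β) (c := fun _ => 1) measurable_id measurable_const
    hint (Eventually.of_forall fun _ => by simp)
  simp only [mul_one, halfLog_tanh, id] at h1 h2
  have : ∫ J, bondLog (β * J) c ∂μ + ∫ J, bondLog (-(β * J)) c ∂μ =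
      2 * (energy β μ 1 - energy β μ c) := by
    rw [← integral_add hi hi', energy_one, energy, ← integral_sub h2 h1, ← integral_const_mul]
    exact integral_congr_ae (Eventually.of_forall fun J => bondLog_add_bondLog_neg hc)
  linarith

end Energy

/-! ### The logarithm of the partition function as a function of the log-weights -/

section LogPartition

variable {C : Type} [Fintype C] [Nonempty C]

/-- `log ∑ exp v`. -/
def logSumExp (v : C → ℝ) : ℝ := Real.log (∑ σ, Real.exp (v σ))

/-- The average of `f` with weights proportional to `exp v`. -/
def weightedMean (v f : C → ℝ) : ℝ := (∑ σ, Real.exp (v σ))⁻¹ * ∑ σ, Real.exp (v σ) * f σ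

theorem sum_exp_pos (v : C → ℝ) : 0 < ∑ σ, Real.exp (v σ) :=
  Finset.sum_pos (fun _ _ => Real.exp_pos _) Finset.univ_nonempty

theorem measurable_logSumExp : Measurable (logSumExp : (C → ℝ) → ℝ) := by
  unfold logSumExp; fun_prop

/-- This is the linear growth condition of `compoundPoisson_comparison`; because of it, a first
moment of `J` suffices throughout. -/
theorem abs_logSumExp_le (v : C → ℝ) : |logSumExp v| ≤ Real.log (Fintype.card C) + ‖v‖ := by
  have hcard : (1 : ℝ) ≤ Fintype.card C := by exact_mod_cast Fintype.card_pos
  have hv : ∀ σ, |v σ| ≤ ‖v‖ := fun σ => norm_le_pi_norm v σ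
  rw [abs_le]
  constructor
  · have h0 := Real.log_nonneg hcard
    have : -‖v‖ ≤ logSumExp v := by
      rw [logSumExp, Real.le_log_iff_exp_le (sum_exp_pos v)]
      obtain ⟨σ⟩ := ‹Nonempty C›
      calc Real.exp (-‖v‖) ≤ Real.exp (v σ) := Real.exp_le_exp.2 (by linarith [(abs_le.1 (hv σ)).1])
        _ ≤ _ := Finset.single_le_sum (f := fun σ => Real.exp (v σ))
          (fun _ _ => (Real.exp_pos _).le) (Finset.mem_univ σ)
    linarith
  · rw [logSumExp, Real.log_le_iff_le_exp (sum_exp_pos v), Real.exp_add,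
      Real.exp_log (by linarith)]
    calc ∑ σ, Real.exp (v σ) ≤ ∑ _σ : C, Real.exp ‖v‖ :=
          Finset.sum_le_sum fun σ _ => Real.exp_le_exp.2 ((le_abs_self _).trans (hv σ))
      _ = _ := by simp

theorem logSumExp_add_const (v : C → ℝ) (c : ℝ) : logSumExp (fun σ => v σ + c) = logSumExp v + c := by
  simp_rw [logSumExp, Real.exp_add, ← Finset.sum_mul]
  rw [Real.log_mul (sum_exp_pos v).ne' (Real.exp_pos _).ne', Real.log_exp]

theorem abs_weightedMean_le {v f : C → ℝ} (hf : ∀ σ, |f σ| ≤ 1) : |weightedMean v f| ≤ 1 := by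
  have hZ := sum_exp_pos v
  rw [weightedMean, abs_mul, abs_of_pos (inv_pos.2 hZ), inv_mul_le_iff₀ hZ, mul_one]
  refine (Finset.abs_sum_le_sum_abs _ _).trans (Finset.sum_le_sum fun σ _ => ?_)
  rw [abs_mul, abs_of_pos (Real.exp_pos _)]
  exact mul_le_of_le_one_right (Real.exp_pos _).le (hf σ)

theorem weightedMean_const_mul (v f : C → ℝ) (c : ℝ) :
    weightedMean v (fun σ => c * f σ) = c * weightedMean v f := by
  simp_rw [weightedMean, mul_left_comm _ c, ← Finset.mul_sum]
  ring

theorem weightedMean_const (v : C → ℝ) (c : ℝ) : weightedMean v (fun _ => c) = c := by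
  rw [weightedMean, ← Finset.sum_mul, inv_mul_cancel_left₀ (sum_exp_pos v).ne']

/-- The factor `exp (bondLog y (f σ))` is affine in `f σ`, so the sum over configurations sees `f`
only through its weighted mean. -/
theorem logSumExp_add_bondLog (v f : C → ℝ) (hf : ∀ σ, |f σ| ≤ 1) (y : ℝ) :
    logSumExp (fun σ => v σ + bondLog y (f σ)) = logSumExp v + bondLog y (weightedMean v f) := by
  have hZ := sum_exp_pos v
  have h1 : ∑ σ, Real.exp (v σ + bondLog y (f σ)) =
      (∑ σ, Real.exp (v σ)) * (Real.cosh y + weightedMean v f * Real.sinh y) := by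
    have : ∀ σ, Real.exp (v σ + bondLog y (f σ)) =
        Real.exp (v σ) * Real.cosh y + Real.exp (v σ) * f σ * Real.sinh y := by
      intro σ; rw [Real.exp_add, exp_bondLog (hf σ)]; ring
    simp_rw [this, Finset.sum_add_distrib, ← Finset.sum_mul, weightedMean]
    field_simp
  rw [logSumExp, h1, Real.log_mul hZ.ne' (cosh_add_pos (abs_weightedMean_le hf)).ne']
  rfl

/-- Positivity of the replica overlap form. -/
theorem sum_mul_sum_weightedMean_pow_nonneg {I : Type} [Fintype I] (v : C → ℝ) (s : I → C → ℝ)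
    (u : I → ℝ) (k : ℕ) :
    0 ≤ ∑ i, ∑ j, u i * u j * weightedMean v (fun σ => s i σ * s j σ) ^ k := by
  classical
  have hZ := sum_exp_pos v
  have hp : ∀ f : C → ℝ, weightedMean v f ^ k = ((∑ σ, Real.exp (v σ))⁻¹) ^ k *
      ∑ ρ : Fin k → C, (∏ a, Real.exp (v (ρ a))) * ∏ a, f (ρ a) := by
    intro f
    rw [weightedMean, mul_pow]
    congr 1
    rw [Fintype.sum_pow]
    simp_rw [Finset.prod_mul_distrib]
  -- The `k`-th power of a mean is a mean over `k` independent replicas, and products over replicas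
  -- separate `s i` from `s j`. The quadratic form becomes a replica average of squares.
  have key : ∑ i, ∑ j, u i * u j * weightedMean v (fun σ => s i σ * s j σ) ^ k =
      ((∑ σ, Real.exp (v σ))⁻¹) ^ k * ∑ ρ : Fin k → C, (∏ a, Real.exp (v (ρ a))) *
        (∑ i, u i * ∏ a, s i (ρ a)) ^ 2 := by
    simp_rw [hp, Finset.prod_mul_distrib, sq, Finset.sum_mul_sum, Finset.mul_sum]
    rw [Finset.sum_comm' (t' := Finset.univ) (s' := fun _ => Finset.univ) (by simp)]
    simp_rw [Finset.sum_comm (s := (Finset.univ : Finset I)) (t := (Finset.univ : Finset (Fin k → C)))]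
    refine Finset.sum_congr rfl fun ρ _ => ?_
    rw [Finset.sum_comm]
    refine Finset.sum_congr rfl fun i _ => Finset.sum_congr rfl fun j _ => ?_
    ring
  rw [key]
  refine mul_nonneg (pow_nonneg (inv_pos.2 hZ).le _) (Finset.sum_nonneg fun ρ _ => ?_)
  exact mul_nonneg (Finset.prod_nonneg fun a _ => (Real.exp_pos _).le) (sq_nonneg _)

end LogPartition

/-! ### Laws of random bonds -/

section BondLaw

variable {C : Type} [Fintype C] [Nonempty C] {β : ℝ} {μ : Measure ℝ} [IsProbabilityMeasure μ]

theorem measurable_bondVector {Ω : Type} [MeasurableSpace Ω] (β : ℝ) {u : Ω → C → ℝ}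
    (hu : Measurable u) :
    Measurable fun p : ℝ × Ω => fun σ => bondLog (β * p.1) (u p.2 σ) := by
  refine measurable_pi_lambda _ fun σ => ?_
  have : Measurable fun p : ℝ × Ω => (β * p.1, u p.2 σ) := by fun_prop
  exact measurable_bondLog.comp this

/-- The law of the vector of log-weights `log (cosh (βJ) + u(ω, σ) sinh (βJ))`, with `J` and `ω`
independent of laws `μ` and `ρ`. -/
def bondLaw {Ω : Type} [MeasurableSpace Ω] (β : ℝ) (μ : Measure ℝ) (ρ : Measure Ω)
    (u : Ω → C → ℝ) : Measure (C → ℝ) :=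
  (μ.prod ρ).map fun p σ => bondLog (β * p.1) (u p.2 σ)

theorem isProbabilityMeasure_bondLaw {Ω : Type} [MeasurableSpace Ω] {ρ : Measure Ω}
    [IsProbabilityMeasure ρ] {u : Ω → C → ℝ} (hu : Measurable u) :
    IsProbabilityMeasure (bondLaw β μ ρ u) :=
  Measure.isProbabilityMeasure_map (measurable_bondVector β hu).aemeasurable

theorem integrable_bondLaw {Ω : Type} [MeasurableSpace Ω] {ρ : Measure Ω}
    [IsProbabilityMeasure ρ] {u : Ω → C → ℝ} (hu : Measurable u)
    (hu1 : ∀ᵐ ω ∂ρ, ∀ σ, |u ω σ| ≤ 1) (hint : Integrable (fun J : ℝ => J) μ) :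
    Integrable (fun v => v) (bondLaw β μ ρ u) := by
  have hm := measurable_bondVector β hu
  rw [bondLaw, integrable_map_measure (by fun_prop) hm.aemeasurable]
  refine ((hint.const_mul β).comp_fst ρ).norm.mono' hm.aestronglyMeasurable ?_
  have h2 : ∀ᵐ p ∂μ.prod ρ, ∀ σ, |u p.2 σ| ≤ 1 :=
    Measure.quasiMeasurePreserving_snd.ae hu1
  filter_upwards [h2] with p hp
  refine (pi_norm_le_iff_of_nonneg (norm_nonneg _)).2 fun σ => abs_bondLog_le (hp σ)

/-- The mean increment of the log-partition function when a bond is added. -/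
theorem integral_logSumExp_bondLaw {Ω : Type} [MeasurableSpace Ω] {ρ : Measure Ω}
    [IsProbabilityMeasure ρ] {u : Ω → C → ℝ} (hu : Measurable u)
    (hu1 : ∀ᵐ ω ∂ρ, ∀ σ, |u ω σ| ≤ 1) (hsymm : μ.map (fun J : ℝ => -J) = μ)
    (hint : Integrable (fun J : ℝ => J) μ) (v₀ : C → ℝ) :
    ∫ v, logSumExp (v₀ + v) ∂bondLaw β μ ρ u =
      logSumExp v₀ + energy β μ 1 - ∫ ω, energy β μ (weightedMean v₀ (u ω)) ∂ρ := by
  have := isProbabilityMeasure_bondLaw (β := β) (μ := μ) (ρ := ρ) hu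
  have hm := measurable_bondVector β hu
  have hi := integrable_of_abs_le_add_norm (integrable_bondLaw (β := β) hu hu1 hint)
    measurable_logSumExp abs_logSumExp_le v₀
  have hF : Measurable fun v : C → ℝ => logSumExp (v₀ + v) :=
    measurable_logSumExp.comp (measurable_const_add v₀)
  have hw : Measurable fun ω => weightedMean v₀ (u ω) := by
    unfold weightedMean; fun_prop
  have hw1 : ∀ᵐ ω ∂ρ, |weightedMean v₀ (u ω)| ≤ 1 := by
    filter_upwards [hu1] with ω hω using abs_weightedMean_le hω
  rw [bondLaw] at hi ⊢
  rw [integrable_map_measure hF.aestronglyMeasurable hm.aemeasurable] at hi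
  rw [integral_map hm.aemeasurable hF.aestronglyMeasurable]
  refine (integral_prod_symm _ hi).trans ?_
  -- With `ω` fixed the weighted mean does not depend on `J`, so the coupling is integrated first.
  have h1 : ∀ᵐ ω ∂ρ, ∫ J, logSumExp (v₀ + fun σ => bondLog (β * J) (u ω σ)) ∂μ =
      logSumExp v₀ + energy β μ 1 - energy β μ (weightedMean v₀ (u ω)) := by
    filter_upwards [hu1] with ω hω
    have h2 := integral_bondLog (β := β) hsymm hint (abs_weightedMean_le (v := v₀) hω)
    have h3 : ∀ J, logSumExp (v₀ + fun σ => bondLog (β * J) (u ω σ)) =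
        logSumExp v₀ + bondLog (β * J) (weightedMean v₀ (u ω)) :=
      fun J => logSumExp_add_bondLog v₀ (u ω) hω (β * J)
    simp_rw [h3]
    rw [integral_add (integrable_const _) h2.1, h2.2]
    simp; ring
  change ∫ ω, ∫ J, logSumExp (v₀ + fun σ => bondLog (β * J) (u ω σ)) ∂μ ∂ρ = _
  rw [integral_congr_ae (g := fun ω => logSumExp v₀ + energy β μ 1 -
    energy β μ (weightedMean v₀ (u ω))) h1, integral_sub (integrable_const _)
    (integrable_energy hw hw1 hint)]
  simp

end BondLaw

/-! ### Mixtures -/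

section Mixture

variable {E : Type} [NormedAddCommGroup E] [NormedSpace ℝ E] [MeasurableSpace E] [BorelSpace E]
  [SecondCountableTopology E]

theorem isProbabilityMeasure_mixture {p q : ℝ≥0} (hpq : p + q = 1) (ν₁ ν₂ : Measure E)
    [IsProbabilityMeasure ν₁] [IsProbabilityMeasure ν₂] :
    IsProbabilityMeasure (p • ν₁ + q • ν₂) := by
  constructor
  have : (p : ℝ≥0∞) + q = 1 := by exact_mod_cast hpq
  rw [Measure.add_apply, Measure.smul_apply, Measure.smul_apply, measure_univ, measure_univ,
    ENNReal.smul_def, ENNReal.smul_def, smul_eq_mul, smul_eq_mul, mul_one, mul_one, this]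

theorem integral_mixture {G : Type} [NormedAddCommGroup G] [NormedSpace ℝ G] (p q : ℝ≥0)
    {ν₁ ν₂ : Measure E} {f : E → G} (h₁ : Integrable f ν₁) (h₂ : Integrable f ν₂) :
    Integrable f (p • ν₁ + q • ν₂) ∧
    ∫ v, f v ∂(p • ν₁ + q • ν₂) = (p : ℝ) • ∫ v, f v ∂ν₁ + (q : ℝ) • ∫ v, f v ∂ν₂ := by
  have i1 : Integrable f (p • ν₁) := h₁.smul_measure_nnreal
  have i2 : Integrable f (q • ν₂) := h₂.smul_measure_nnreal
  refine ⟨i1.add_measure i2, ?_⟩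
  rw [integral_add_measure i1 i2, integral_smul_nnreal_measure, integral_smul_nnreal_measure]
  rfl

/-- Colouring the terms of a Poisson sum independently with probabilities `p` and `q` splits it into
two independent Poisson sums. In characteristic functions: the exponent is affine in the jump law.
-/
theorem compoundPoisson_mixture [CompleteSpace E] (r : ℝ≥0) {p q : ℝ≥0} (hpq : p + q = 1)
    (ν₁ ν₂ : Measure E) [IsProbabilityMeasure ν₁] [IsProbabilityMeasure ν₂]
    [IsProbabilityMeasure (p • ν₁ + q • ν₂)] :
    compoundPoisson (r * p) ν₁ ∗ compoundPoisson (r * q) ν₂ =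
      compoundPoisson r (p • ν₁ + q • ν₂) := by
  refine compoundPoisson_conv _ _ _ _ _ _ fun L => ?_
  have hi : ∀ (ν : Measure E) [IsProbabilityMeasure ν],
      Integrable (fun v => Complex.exp (L v * Complex.I)) ν := by
    intro ν _
    exact (integrable_const (1 : ℝ)).mono (by fun_prop) (by simp)
  have h := (integral_mixture p q (hi ν₁) (hi ν₂)).2
  simp_rw [← charFunDual_apply] at h
  rw [h]
  have hc : (p : ℂ) + q = 1 := by exact_mod_cast hpq
  simp only [Complex.real_smul]
  push_cast
  linear_combination (-(r : ℂ)) * hc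

end Mixture

/-! ### Uniform sites and thinning -/

section Thinning

variable {N : ℕ} [NeZero N]

theorem integral_uniformSite {G : Type} [NormedAddCommGroup G] [NormedSpace ℝ G] [CompleteSpace G]
    (f : Fin N → G) : ∫ i, f i ∂uniformSite N = (1 / (N : ℝ)) • ∑ i, f i := by
  rw [uniformSite, PMF.integral_eq_sum, Finset.smul_sum]
  simp

theorem integral_prod_uniformSite {S : Type} [MeasurableSpace S] {ν : Measure S}
    [IsProbabilityMeasure ν] {G : Type} [NormedAddCommGroup G] [NormedSpace ℝ G] [CompleteSpace G]
    {f : S × Fin N → G} (hf : Integrable f (ν.prod (uniformSite N))) :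
    ∫ p, f p ∂ν.prod (uniformSite N) = (1 / (N : ℝ)) • ∑ i, ∫ s, f (s, i) ∂ν := by
  rw [integral_prod_symm _ hf, integral_uniformSite]

variable {E : Type} [NormedAddCommGroup E] [NormedSpace ℝ E] [MeasurableSpace E] [BorelSpace E]
  [SecondCountableTopology E]

theorem measurable_ite_site {S : Type} [MeasurableSpace S] {h : S → E} (hh : Measurable h)
    (k : Fin N) : Measurable fun p : S × Fin N => if p.2 = k then h p.1 else 0 :=
  Measurable.ite (measurable_snd (measurableSet_singleton k)) (hh.comp measurable_fst)
    measurable_const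

theorem integrable_cexp_dual {ν : Measure E} [IsFiniteMeasure ν] (L : StrongDual ℝ E) :
    Integrable (fun v => Complex.exp (L v * Complex.I)) ν :=
  (integrable_const (1 : ℝ)).mono (by fun_prop) (by simp)

theorem charFunDual_map_prod_uniformSite {S : Type} [MeasurableSpace S] {ν : Measure S}
    [IsProbabilityMeasure ν] {g : S × Fin N → E} (hg : Measurable g) (L : StrongDual ℝ E) :
    charFunDual ((ν.prod (uniformSite N)).map g) L =
      (1 / (N : ℂ)) * ∑ i, ∫ s, Complex.exp (L (g (s, i)) * Complex.I) ∂ν := by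
  have : IsProbabilityMeasure ((ν.prod (uniformSite N)).map g) :=
    Measure.isProbabilityMeasure_map hg.aemeasurable
  have hi := integrable_cexp_dual (ν := (ν.prod (uniformSite N)).map g) L
  rw [integrable_map_measure hi.1 hg.aemeasurable] at hi
  have h2 := integral_prod_uniformSite hi
  rw [charFunDual_apply, integral_map hg.aemeasurable (by fun_prop)]
  refine h2.trans ?_
  rw [Complex.real_smul]
  simp

/-- The marks attached to a given site form a compound Poisson variable. -/
theorem compoundPoisson_thinning [CompleteSpace E] {S : Type} [MeasurableSpace S] (r : ℝ≥0)
    {ν : Measure S} [IsProbabilityMeasure ν] {h : S → E} (hh : Measurable h)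
    [IsProbabilityMeasure (ν.map h)] (k : Fin N) :
    (poissonMarks (r * N) (ν.prod (uniformSite N))).map
      (fun d => ∑ i ∈ Finset.range d.1, if (d.2 i).2 = k then h (d.2 i).1 else 0) =
      compoundPoisson r (ν.map h) := by
  have hm := measurable_ite_site hh k
  have : IsProbabilityMeasure ((ν.prod (uniformSite N)).map
      fun p : S × Fin N => if p.2 = k then h p.1 else 0) :=
    Measure.isProbabilityMeasure_map hm.aemeasurable
  rw [poissonMarks_map (r * N) (ν.prod (uniformSite N)) hm]
  refine compoundPoisson_congr _ _ _ _ fun L => ?_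
  have hN : (N : ℂ) ≠ 0 := by exact_mod_cast NeZero.ne N
  rw [charFunDual_map_prod_uniformSite hm]
  -- A mark off the site `k` contributes `0`, hence a factor `1`. Only one site in `N` survives,
  -- which cancels the `N` in the rate.
  have h1 : ∀ i : Fin N, ∫ s, Complex.exp (L (if i = k then h s else 0) * Complex.I) ∂ν =
      1 + if i = k then charFunDual (ν.map h) L - 1 else 0 := by
    intro i
    split_ifs
    · rw [charFunDual_apply, integral_map hh.aemeasurable (by fun_prop)]; ring
    · simp
  simp only [h1, Finset.sum_add_distrib, Finset.sum_ite_eq', Finset.mem_univ, if_true,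
    Finset.sum_const, Finset.card_univ, Fintype.card_fin, nsmul_eq_mul, mul_one]
  push_cast
  field_simp
  ring

/-- The marks attached to two distinct sites are independent. -/
theorem compoundPoisson_thinning_pair [CompleteSpace E] {S : Type} [MeasurableSpace S] (r : ℝ≥0)
    {ν : Measure S} [IsProbabilityMeasure ν] {h : S → E} (hh : Measurable h)
    [IsProbabilityMeasure (ν.map h)] {k l : Fin N} (hkl : k ≠ l) :
    (poissonMarks (r * N) (ν.prod (uniformSite N))).map
      (fun d => (∑ i ∈ Finset.range d.1, if (d.2 i).2 = k then h (d.2 i).1 else 0,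
        ∑ i ∈ Finset.range d.1, if (d.2 i).2 = l then h (d.2 i).1 else 0)) =
      (compoundPoisson r (ν.map h)).prod (compoundPoisson r (ν.map h)) := by
  have hm := (measurable_ite_site hh k).prodMk (measurable_ite_site hh l)
  set g : S × Fin N → E × E := fun p => (if p.2 = k then h p.1 else 0, if p.2 = l then h p.1 else 0)
    with hg
  have : IsProbabilityMeasure ((ν.prod (uniformSite N)).map g) :=
    Measure.isProbabilityMeasure_map hm.aemeasurable
  have e1 : (fun d : ℕ × (ℕ → S × Fin N) =>
      (∑ i ∈ Finset.range d.1, if (d.2 i).2 = k then h (d.2 i).1 else 0,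
        ∑ i ∈ Finset.range d.1, if (d.2 i).2 = l then h (d.2 i).1 else 0)) =
      fun d => ∑ i ∈ Finset.range d.1, g (d.2 i) := by
    ext d
    · simp [hg, Prod.fst_sum]
    · simp [hg, Prod.snd_sum]
  rw [e1, poissonMarks_map (r * N) (ν.prod (uniformSite N)) hm]
  refine Measure.ext_of_charFunDual ?_
  ext L
  have hN : (N : ℂ) ≠ 0 := by exact_mod_cast NeZero.ne N
  rw [charFunDual_prod, charFunDual_compoundPoisson, charFunDual_compoundPoisson,
    charFunDual_compoundPoisson, ← Complex.exp_add, charFunDual_map_prod_uniformSite hm]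
  congr 1
  set L₁ := L.comp (ContinuousLinearMap.inl ℝ E E)
  set L₂ := L.comp (ContinuousLinearMap.inr ℝ E E)
  -- As `k ≠ l`, a jump has at most one nonzero coordinate. The exponent therefore has no cross
  -- term, and this is independence.
  have h1 : ∀ i : Fin N, ∫ s, Complex.exp (L (g (s, i)) * Complex.I) ∂ν =
      1 + ((if i = k then charFunDual (ν.map h) L₁ - 1 else 0) +
        if i = l then charFunDual (ν.map h) L₂ - 1 else 0) := by
    intro i
    by_cases hi : i = k
    · have hil : i ≠ l := hi ▸ hkl
      rw [if_pos hi, if_neg hil, charFunDual_apply, integral_map hh.aemeasurable (by fun_prop)]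
      simp [hg, hi, hkl, L₁]
    · by_cases hil : i = l
      · rw [if_neg hi, if_pos hil, charFunDual_apply, integral_map hh.aemeasurable (by fun_prop)]
        simp [hg, hil, hkl.symm, L₂]
      · have hL0 : L ((0 : E), (0 : E)) = 0 := map_zero L
        simp [hg, hi, hil, hL0]
  simp only [h1, Finset.sum_add_distrib, Finset.sum_ite_eq', Finset.mem_univ, if_true,
    Finset.sum_const, Finset.card_univ, Fintype.card_fin, nsmul_eq_mul, mul_one]
  push_cast
  field_simp
  ring

end Thinning

/-- A property that holds for almost every mark holds for all marks, almost surely. -/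
theorem ae_poissonMarks {S : Type} [MeasurableSpace S] (r : ℝ≥0) {ν : Measure S}
    [IsProbabilityMeasure ν] {P : S → Prop} (h : ∀ᵐ s ∂ν, P s) :
    ∀ᵐ d ∂poissonMarks r ν, ∀ i, P (d.2 i) := by
  rw [ae_all_iff]
  intro i
  have h1 : ∀ᵐ x ∂Measure.infinitePi fun _ : ℕ => ν, P (x i) :=
    (measurePreserving_eval_infinitePi (fun _ : ℕ => ν) i).quasiMeasurePreserving.ae h
  exact Measure.quasiMeasurePreserving_snd.ae h1

/-- Expected log-partition functions as integrals against compound Poisson laws. -/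
theorem integral_logSumExp_poissonMarks {C : Type} [Fintype C] [Nonempty C] {S : Type}
    [MeasurableSpace S] (r : ℝ≥0) {ν : Measure S} [IsProbabilityMeasure ν] {h : S → C → ℝ}
    (hh : Measurable h) [IsProbabilityMeasure (ν.map h)]
    (hi : Integrable (fun v => v) (ν.map h)) :
    Integrable (fun d => logSumExp (∑ i ∈ Finset.range d.1, h (d.2 i))) (poissonMarks r ν) ∧
      ∫ d, logSumExp (∑ i ∈ Finset.range d.1, h (d.2 i)) ∂poissonMarks r ν =
        ∫ v, logSumExp v ∂compoundPoisson r (ν.map h) := by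
  have hs := measurable_sum_marks hh
  have hF := measurable_logSumExp (C := C)
  have h1 := integrable_of_abs_le_add_norm (integrable_compoundPoisson r _ hi)
    hF abs_logSumExp_le 0
  simp only [zero_add] at h1
  rw [← poissonMarks_map r ν hh] at h1 ⊢
  rw [integrable_map_measure hF.aestronglyMeasurable hs.aemeasurable] at h1
  rw [integral_map hs.aemeasurable hF.aestronglyMeasurable]
  exact ⟨h1, rfl⟩

/-! ### Independent spins -/

section FreeSpins

variable {N : ℕ}

theorem spin_eq_one_or (σ : Config N) (i : Fin N) : spin σ i = 1 ∨ spin σ i = -1 := by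
  unfold spin
  rcases Int.units_eq_one_or (σ i) with h | h <;> simp [h]

theorem abs_spin (σ : Config N) (i : Fin N) : |spin σ i| = 1 := by
  rcases spin_eq_one_or σ i with h | h <;> simp [h]

theorem sum_config_prod (f : Fin N → ℤˣ → ℝ) :
    ∑ σ : Config N, ∏ i, f i (σ i) = ∏ i, (f i 1 + f i (-1)) := by
  have h := Finset.prod_univ_sum (fun _ : Fin N => (Finset.univ : Finset ℤˣ)) f
  rw [Fintype.piFinset_univ] at h
  rw [← h]
  refine Finset.prod_congr rfl fun i _ => ?_
  rw [UnitsInt.univ, Finset.sum_pair (by decide)]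

theorem sum_exp_field (θ : Fin N → ℝ) :
    ∑ σ : Config N, Real.exp (∑ i, θ i * spin σ i) = ∏ i, (2 * Real.cosh (θ i)) := by
  simp_rw [Real.exp_sum, spin]
  rw [sum_config_prod fun i s => Real.exp (θ i * ((s : ℤ) : ℝ))]
  refine Finset.prod_congr rfl fun i _ => ?_
  rw [Real.cosh_eq]
  simp
  ring

/-- Inserting the spin at `k` changes only the `k`-th factor, from `2 cosh` to `2 sinh`. -/
theorem sum_spin_mul_exp_field (θ : Fin N → ℝ) (k : Fin N) :
    ∑ σ : Config N, spin σ k * Real.exp (∑ i, θ i * spin σ i) =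
      Real.tanh (θ k) * ∏ i, (2 * Real.cosh (θ i)) := by
  have h1 : ∀ σ : Config N, spin σ k * Real.exp (∑ i, θ i * spin σ i) =
      ∏ i, ((if i = k then ((σ i : ℤ) : ℝ) else 1) * Real.exp (θ i * ((σ i : ℤ) : ℝ))) := by
    intro σ
    rw [Finset.prod_mul_distrib, Finset.prod_ite_eq' Finset.univ k, ← Real.exp_sum]
    simp [spin]
  simp_rw [h1]
  rw [sum_config_prod fun i s => (if i = k then ((s : ℤ) : ℝ) else 1) *
    Real.exp (θ i * ((s : ℤ) : ℝ))]
  have h2 : Real.tanh (θ k) = ∏ i, if i = k then Real.tanh (θ i) else 1 := by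
    rw [Finset.prod_ite_eq' Finset.univ k]; simp
  rw [h2, ← Finset.prod_mul_distrib]
  refine Finset.prod_congr rfl fun i _ => ?_
  split_ifs with h
  · have hs : Real.tanh (θ i) * (2 * Real.cosh (θ i)) = 2 * Real.sinh (θ i) := by
      have := (Real.cosh_pos (θ i)).ne'
      rw [Real.tanh_eq_sinh_div_cosh]
      field_simp
    rw [hs, Real.sinh_eq]
    simp
    ring
  · rw [Real.cosh_eq]
    simp
    ring

theorem sum_site_eq (m : ℕ) (x : ℕ → ℝ × Fin N) (σ : Config N) :
    ∑ ν ∈ Finset.range m, (x ν).1 * spin σ (x ν).2 =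
      ∑ k, (∑ ν ∈ Finset.range m, if (x ν).2 = k then (x ν).1 else 0) * spin σ k := by
  simp_rw [Finset.sum_mul]
  rw [Finset.sum_comm]
  refine Finset.sum_congr rfl fun ν _ => ?_
  simp [ite_mul]

/-- Collecting the terms by site (`sum_site_eq`) gives free spins in local fields, and the
normalisation cancels at all sites but `k`. -/
theorem auxSpin_eq (β : ℝ) (d : ℕ × (ℕ → ℝ × Fin N)) (k : Fin N) :
    auxSpin β d k = Real.tanh (β * ∑ ν ∈ Finset.range d.1,
      if (d.2 ν).2 = k then (d.2 ν).1 else 0) := by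
  set θ : Fin N → ℝ := fun k => β * ∑ ν ∈ Finset.range d.1, if (d.2 ν).2 = k then (d.2 ν).1 else 0
    with hθ
  have h1 : ∀ σ : Config N, -β * auxHam d.1 d.2 σ = ∑ i, θ i * spin σ i := by
    intro σ
    rw [auxHam, sum_site_eq, neg_mul_neg, Finset.mul_sum]
    simp only [hθ, mul_assoc]
  unfold auxSpin gibbs partitionFn
  simp_rw [h1]
  rw [sum_exp_field, sum_spin_mul_exp_field]
  change _ = Real.tanh (θ k)
  have : ∏ i, (2 * Real.cosh (θ i)) ≠ 0 :=
    Finset.prod_ne_zero_iff.2 fun i _ => by have := Real.cosh_pos (θ i); positivity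
  field_simp

/-- Replicas are independent given the disorder, so the average of a product of spins at one site is
a power of the Gibbs average. -/
theorem replicaGibbs_multiOverlap (n : ℕ) (β : ℝ) (H : Config N → ℝ) :
    replicaGibbs n β H (multiOverlap n) =
      (1 / (N : ℝ)) * ∑ k, gibbs β H (fun ρ => spin ρ k) ^ n := by
  have hk : ∀ k, gibbs β H (fun ρ => spin ρ k) ^ n = ((partitionFn β H)⁻¹) ^ n *
      ∑ ρ : Fin n → Config N, (∏ a, spin (ρ a) k) * ∏ a, Real.exp (-β * H (ρ a)) := by
    intro k
    rw [gibbs, mul_pow, Fintype.sum_pow]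
    simp_rw [Finset.prod_mul_distrib]
  simp_rw [hk, replicaGibbs, multiOverlap, ← Finset.mul_sum]
  rw [Finset.sum_comm]
  simp_rw [← Finset.sum_mul, mul_assoc, ← Finset.mul_sum]
  ring

theorem sum_exp_site_field (m : ℕ) (x : ℕ → ℝ × Fin N) :
    Real.log (∑ σ : Config N, Real.exp (∑ ν ∈ Finset.range m, (x ν).1 * spin σ (x ν).2)) =
      N * Real.log 2 + ∑ k, Real.log (Real.cosh (∑ ν ∈ Finset.range m,
        if (x ν).2 = k then (x ν).1 else 0)) := by
  simp_rw [sum_site_eq]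
  rw [sum_exp_field, Real.log_prod fun i _ => by
    have := Real.cosh_pos (∑ ν ∈ Finset.range m, if (x ν).2 = i then (x ν).1 else 0)
    positivity]
  simp_rw [fun y : ℝ => Real.log_mul two_ne_zero (Real.cosh_pos y).ne']
  rw [Finset.sum_add_distrib]
  simp

end FreeSpins

/-! ### The auxiliary system at finite connectivity -/

section AuxFinite

variable (β : ℝ) (μ : Measure ℝ) [IsProbabilityMeasure μ]

theorem measurable_tanh_mul (β : ℝ) : Measurable fun x : ℝ => Real.tanh (β * x) :=
  measurable_tanh.comp (measurable_const_mul β)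

/-- The law of `tanh (βS)`, where `S` is compound Poisson. -/
def spinLaw (a : ℝ≥0) : ProbabilityMeasure ℝ :=
  ProbabilityMeasure.map (⟨compoundPoisson (2 * a) μ, inferInstance⟩ : ProbabilityMeasure ℝ)
    (measurable_tanh_mul β).aemeasurable

theorem toMeasure_spinLaw (a : ℝ≥0) : (spinLaw β μ a : Measure ℝ) =
    (compoundPoisson (2 * a) μ).map fun x => Real.tanh (β * x) := rfl

theorem integral_spinLaw (a : ℝ≥0) {f : ℝ → ℝ} (hf : Measurable f) :
    ∫ w, f w ∂(spinLaw β μ a : Measure ℝ) =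
      ∫ x, f (Real.tanh (β * x)) ∂compoundPoisson (2 * a) μ := by
  rw [toMeasure_spinLaw]
  exact integral_map (measurable_tanh_mul β).aemeasurable hf.aestronglyMeasurable

theorem ae_spinLaw (a : ℝ≥0) : ∀ᵐ w ∂(spinLaw β μ a : Measure ℝ), |w| ≤ 1 := by
  rw [toMeasure_spinLaw]
  refine (ae_map_iff (measurable_tanh_mul β).aemeasurable
    (measurableSet_le (by fun_prop) measurable_const)).2 (Eventually.of_forall fun x => ?_)
  exact (Real.abs_tanh_lt_one _).le

/-- The volume disappears here: rate `2aM` spread over `M` sites is rate `2a` at each. -/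
theorem map_siteField (a : ℝ≥0) {M : ℕ} [NeZero M] (k : Fin M) :
    (auxDisorder μ a M).map (fun d => ∑ ν ∈ Finset.range d.1,
      if (d.2 ν).2 = k then (d.2 ν).1 else 0) = compoundPoisson (2 * a) μ := by
  have : IsProbabilityMeasure (μ.map fun x : ℝ => x) := by
    rw [Measure.map_id']; infer_instance
  have h := compoundPoisson_thinning (2 * a) (ν := μ) (h := fun x : ℝ => x) measurable_id k
  simp only [Measure.map_id'] at h
  exact h

theorem measurable_siteField {M : ℕ} [NeZero M] (k : Fin M) :
    Measurable fun d : ℕ × (ℕ → ℝ × Fin M) => ∑ ν ∈ Finset.range d.1,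
      if (d.2 ν).2 = k then (d.2 ν).1 else 0 :=
  measurable_sum_marks (measurable_ite_site measurable_id k)

theorem integral_auxSpin (a : ℝ≥0) {M : ℕ} [NeZero M] (k : Fin M) {f : ℝ → ℝ} (hf : Measurable f) :
    ∫ d, f (auxSpin β d k) ∂auxDisorder μ a M = ∫ w, f w ∂(spinLaw β μ a : Measure ℝ) := by
  simp_rw [auxSpin_eq]
  have h := integral_map (μ := auxDisorder μ a M) (f := fun x => f (Real.tanh (β * x)))
    (measurable_siteField k).aemeasurable (hf.comp (measurable_tanh_mul β)).aestronglyMeasurable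
  rw [map_siteField μ a k] at h
  rw [integral_spinLaw β μ a hf, h]

theorem map_siteField_pair (a : ℝ≥0) {M : ℕ} [NeZero M] {k l : Fin M} (hkl : k ≠ l) :
    (auxDisorder μ a M).map (fun d => (∑ ν ∈ Finset.range d.1,
      if (d.2 ν).2 = k then (d.2 ν).1 else 0, ∑ ν ∈ Finset.range d.1,
      if (d.2 ν).2 = l then (d.2 ν).1 else 0)) =
      (compoundPoisson (2 * a) μ).prod (compoundPoisson (2 * a) μ) := by
  have : IsProbabilityMeasure (μ.map fun x : ℝ => x) := by
    rw [Measure.map_id']; infer_instance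
  have h := compoundPoisson_thinning_pair (2 * a) (ν := μ) (h := fun x : ℝ => x) measurable_id hkl
  simp only [Measure.map_id'] at h
  exact h

theorem integral_auxSpin_pair (a : ℝ≥0) {M : ℕ} [NeZero M] {k l : Fin M} (hkl : k ≠ l)
    {f : ℝ × ℝ → ℝ} (hf : Measurable f) :
    ∫ d, f (auxSpin β d k, auxSpin β d l) ∂auxDisorder μ a M =
      ∫ p, f p ∂((spinLaw β μ a : Measure ℝ).prod (spinLaw β μ a : Measure ℝ)) := by
  have hT : Measurable (Prod.map (fun x : ℝ => Real.tanh (β * x)) fun x : ℝ => Real.tanh (β * x)) :=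
    (measurable_tanh_mul β).prodMap (measurable_tanh_mul β)
  have e : (spinLaw β μ a : Measure ℝ).prod (spinLaw β μ a : Measure ℝ) =
      ((auxDisorder μ a M).map (fun d => (∑ ν ∈ Finset.range d.1,
        if (d.2 ν).2 = k then (d.2 ν).1 else 0, ∑ ν ∈ Finset.range d.1,
        if (d.2 ν).2 = l then (d.2 ν).1 else 0))).map
        (Prod.map (fun x : ℝ => Real.tanh (β * x)) fun x : ℝ => Real.tanh (β * x)) := by
    rw [map_siteField_pair μ a hkl, toMeasure_spinLaw]
    exact Measure.map_prod_map _ _ (measurable_tanh_mul β) (measurable_tanh_mul β)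
  simp_rw [auxSpin_eq]
  rw [e, integral_map hT.aemeasurable hf.aestronglyMeasurable]
  exact (integral_map (μ := auxDisorder μ a M) (f := fun p => f (Prod.map
    (fun x : ℝ => Real.tanh (β * x)) (fun x : ℝ => Real.tanh (β * x)) p))
    ((measurable_siteField k).prodMk (measurable_siteField l)).aemeasurable
      (hf.comp hT).aestronglyMeasurable).symm

/-- All sites have the same field law, whatever the volume, so the sequence whose infinite volume
limit is taken is constant. -/
theorem auxLawFinite_eq (a : ℝ≥0) (M : ℕ) [NeZero M] : auxLawFinite β μ a M = spinLaw β μ a := by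
  apply Subtype.ext
  change (auxLawFinite β μ a M : Measure ℝ) = (spinLaw β μ a : Measure ℝ)
  refine ext_of_forall_integral_eq_of_IsFiniteMeasure fun f => ?_
  have hm := measurable_auxSpin (M := M) β
  have hf : Measurable f := f.continuous.measurable
  have hi : Integrable (fun p => f (auxSpin β p.1 p.2)) ((auxDisorder μ a M).prod (uniformSite M)) :=
    (integrable_const ‖f‖).mono' (hf.comp hm).aestronglyMeasurable
      (Eventually.of_forall fun p => f.norm_coe_le_norm _)
  have h1 : ∫ w, f w ∂(auxLawFinite β μ a M : Measure ℝ) =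
      ∫ p, f (auxSpin β p.1 p.2) ∂((auxDisorder μ a M).prod (uniformSite M)) := by
    exact integral_map hm.aemeasurable hf.aestronglyMeasurable
  refine h1.trans ?_
  rw [integral_prod_uniformSite hi]
  simp_rw [integral_auxSpin β μ a _ hf]
  have hM : (M : ℝ) ≠ 0 := by exact_mod_cast NeZero.ne M
  simp
  field_simp

theorem measurable_auxSpin_site {M : ℕ} [NeZero M] (k : Fin M) :
    Measurable fun d : ℕ × (ℕ → ℝ × Fin M) => auxSpin β d k := by
  simp_rw [auxSpin_eq]
  exact (measurable_tanh_mul β).comp (measurable_siteField k)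

theorem auxOverlapFinite_eq (n : ℕ) (a : ℝ≥0) (M : ℕ) [NeZero M] :
    auxOverlapFinite β μ n a M = ∫ w, w ^ n ∂(spinLaw β μ a : Measure ℝ) := by
  unfold auxOverlapFinite
  simp_rw [replicaGibbs_multiOverlap]
  change ∫ d, (1 / (M : ℝ)) * ∑ k, auxSpin β d k ^ n ∂auxDisorder μ a M = _
  rw [integral_const_mul, integral_finsetSum]
  · have h : ∀ k : Fin M, ∫ d, auxSpin β d k ^ n ∂auxDisorder μ a M =
        ∫ w, w ^ n ∂(spinLaw β μ a : Measure ℝ) :=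
      fun k => integral_auxSpin β μ a k (f := fun w => w ^ n) (by fun_prop)
    simp_rw [h]
    have hM : (M : ℝ) ≠ 0 := by exact_mod_cast NeZero.ne M
    simp
    field_simp
  · intro k _
    have hm := measurable_auxSpin_site β k
    refine (integrable_const (1 : ℝ)).mono' (hm.pow_const n).aestronglyMeasurable
      (Eventually.of_forall fun d => ?_)
    rw [norm_pow, auxSpin_eq]
    exact pow_le_one₀ (norm_nonneg _) (Real.abs_tanh_lt_one _).le

/-- Two uniform sites coincide with probability `1 / M`. Off the diagonal the two averages are
exactly independent, so the correction is of order `1 / M`. -/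
theorem integral_auxPairLawFinite (a : ℝ≥0) (M : ℕ) [NeZero M] (f : BoundedContinuousFunction (ℝ × ℝ) ℝ) :
    ∫ p, f p ∂(auxPairLawFinite β μ a M : Measure (ℝ × ℝ)) =
      ∫ p, f p ∂((spinLaw β μ a : Measure ℝ).prod (spinLaw β μ a : Measure ℝ)) +
      (1 / (M : ℝ)) * (∫ w, f (w, w) ∂(spinLaw β μ a : Measure ℝ) -
        ∫ p, f p ∂((spinLaw β μ a : Measure ℝ).prod (spinLaw β μ a : Measure ℝ))) := by
  have hm := measurable_auxSpin_pair (M := M) β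
  have hf : Measurable f := f.continuous.measurable
  have hi : Integrable (fun p : (ℕ × (ℕ → ℝ × Fin M)) × (Fin M × Fin M) =>
      f (auxSpin β p.1 p.2.1, auxSpin β p.1 p.2.2))
      ((auxDisorder μ a M).prod ((uniformSite M).prod (uniformSite M))) :=
    (integrable_const ‖f‖).mono' (hf.comp hm).aestronglyMeasurable
      (Eventually.of_forall fun p => f.norm_coe_le_norm _)
  have h1 : ∫ p, f p ∂(auxPairLawFinite β μ a M : Measure (ℝ × ℝ)) =
      ∫ p, f (auxSpin β p.1 p.2.1, auxSpin β p.1 p.2.2)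
        ∂((auxDisorder μ a M).prod ((uniformSite M).prod (uniformSite M))) := by
    exact integral_map hm.aemeasurable hf.aestronglyMeasurable
  rw [h1, integral_prod_symm _ hi, integral_prod_uniformSite Integrable.of_finite]
  simp_rw [integral_uniformSite]
  set P := ∫ p, f p ∂((spinLaw β μ a : Measure ℝ).prod (spinLaw β μ a : Measure ℝ))
  set D := ∫ w, f (w, w) ∂(spinLaw β μ a : Measure ℝ)
  have h2 : ∀ k l : Fin M, ∫ d, f (auxSpin β d k, auxSpin β d l) ∂auxDisorder μ a M =
      P + if k = l then D - P else 0 := by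
    intro k l
    split_ifs with hkl
    · subst hkl
      rw [integral_auxSpin β μ a k (f := fun w => f (w, w)) (hf.comp (by fun_prop))]
      ring
    · rw [integral_auxSpin_pair β μ a hkl hf, add_zero]
  simp only [h2, Finset.sum_add_distrib, Finset.sum_const, Finset.card_univ, Fintype.card_fin,
    Finset.sum_ite_eq', Finset.mem_univ, if_true, smul_eq_mul, nsmul_eq_mul]
  have hM : (M : ℝ) ≠ 0 := by exact_mod_cast NeZero.ne M
  field_simp

theorem auxLawAt_eq (a : ℝ≥0) : auxLawAt β μ a = spinLaw β μ a := by
  unfold auxLawAt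
  simp_rw [auxLawFinite_eq]
  exact tendsto_const_nhds.limUnder_eq

theorem auxOverlapAt_eq (n : ℕ) (a : ℝ≥0) :
    auxOverlapAt β μ n a = ∫ w, w ^ n ∂(spinLaw β μ a : Measure ℝ) := by
  unfold auxOverlapAt
  simp_rw [auxOverlapFinite_eq]
  exact tendsto_const_nhds.limUnder_eq

theorem auxLaw_coe (a : ℝ≥0) : auxLaw β μ a = spinLaw β μ a := by
  simp [auxLaw, auxLawAt_eq]

theorem auxOverlap_coe (n : ℕ) (a : ℝ≥0) :
    auxOverlap β μ n a = ∫ w, w ^ n ∂(spinLaw β μ a : Measure ℝ) := by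
  simp [auxOverlap, auxOverlapAt_eq]

theorem tendsto_auxPairLawFinite (a : ℝ≥0) :
    Tendsto (fun M : ℕ => auxPairLawFinite β μ a (M + 1)) atTop
      (𝓝 ((auxLaw β μ a).prod (auxLaw β μ a))) := by
  rw [ProbabilityMeasure.tendsto_iff_forall_integral_tendsto]
  intro f
  simp_rw [integral_auxPairLawFinite, auxLaw_coe, ProbabilityMeasure.toMeasure_prod]
  have h := (tendsto_one_div_add_atTop_nhds_zero_nat (𝕜 := ℝ)).mul_const
    (∫ w, f (w, w) ∂(spinLaw β μ a : Measure ℝ) -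
        ∫ p, f p ∂((spinLaw β μ a : Measure ℝ).prod (spinLaw β μ a : Measure ℝ)))
  simpa using h.const_add
    (∫ p, f p ∂((spinLaw β μ a : Measure ℝ).prod (spinLaw β μ a : Measure ℝ)))

end AuxFinite

/-! ### Infinite connectivity -/

section AuxInfinite

variable {μ : Measure ℝ} [IsProbabilityMeasure μ]

theorem countable_cos_mul_eq_one {J : ℝ} (hJ : J ≠ 0) : {z : ℝ | Real.cos (z * J) = 1}.Countable := by
  refine (Set.countable_range fun n : ℤ => (n : ℝ) * (2 * Real.pi) / J).mono fun z hz => ?_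
  obtain ⟨n, hn⟩ := (Real.cos_eq_one_iff _).1 hz
  exact ⟨n, by simp only; rw [hn]; field_simp⟩

/-- Equality at `z` would mean `cos (z * J) = 1` almost surely. For each `J ≠ 0` only countably many
`z` allow this, a Gaussian-null set; by Fubini, for almost every `z` it would force `J = 0` almost
surely. -/
theorem ae_re_charFun_lt_one (hμ : ¬ ∀ᵐ J ∂μ, J = 0) :
    ∀ᵐ z ∂gaussianReal 0 1, (charFun μ z).re < 1 := by
  have := nullSingletonClass_gaussianReal (μ := 0) (v := 1) one_ne_zero
  have hs : MeasurableSet {p : ℝ × ℝ | Real.cos (p.1 * p.2) = 1 → p.2 = 0} := by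
    have h1 : MeasurableSet {p : ℝ × ℝ | Real.cos (p.1 * p.2) = 1} :=
      measurableSet_eq_fun (by fun_prop) measurable_const
    have h2 : MeasurableSet {p : ℝ × ℝ | p.2 = 0} :=
      measurableSet_eq_fun (by fun_prop) measurable_const
    exact h1.imp h2
  have h1 : ∀ᵐ J ∂μ, ∀ᵐ z ∂gaussianReal 0 1, Real.cos (z * J) = 1 → J = 0 := by
    refine Eventually.of_forall fun J => ?_
    by_cases hJ : J = 0
    · simp [hJ]
    · filter_upwards [(countable_cos_mul_eq_one hJ).ae_notMem (gaussianReal 0 1)] with z hz h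
      exact absurd h hz
  have h2 : ∀ᵐ p ∂(gaussianReal 0 1).prod μ, Real.cos (p.1 * p.2) = 1 → p.2 = 0 := by
    rw [Measure.ae_prod_iff_ae_ae hs]
    exact (Measure.ae_ae_comm hs).2 h1
  filter_upwards [Measure.ae_ae_of_ae_prod h2] with z hz
  have hre : (charFun μ z).re = ∫ J, Real.cos (z * J) ∂μ := by
    rw [charFun_apply_real]
    have hi : Integrable (fun x : ℝ => Complex.exp (z * x * Complex.I)) μ :=
      (integrable_const (1 : ℝ)).mono (by fun_prop) (Eventually.of_forall fun x => by
        rw [← Complex.ofReal_mul, Complex.norm_exp_ofReal_mul_I]; simp)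
    have := integral_re hi
    simp only [RCLike.re_to_complex] at this
    rw [← this]
    refine integral_congr_ae (Eventually.of_forall fun J => ?_)
    simp only
    rw [← Complex.ofReal_mul, Complex.exp_ofReal_mul_I_re]
  have hc : Integrable (fun J => Real.cos (z * J)) μ :=
    (integrable_const (1 : ℝ)).mono' (by fun_prop) (Eventually.of_forall fun J =>
      Real.abs_cos_le_one _)
  have hle : 0 ≤ ∫ J, (1 - Real.cos (z * J)) ∂μ :=
    integral_nonneg fun J => sub_nonneg.2 (Real.cos_le_one _)
  have hsub : ∫ J, (1 - Real.cos (z * J)) ∂μ = 1 - ∫ J, Real.cos (z * J) ∂μ := by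
    rw [integral_sub (integrable_const _) hc]; simp
  rw [hre]
  refine lt_of_le_of_ne (by linarith) fun heq => hμ ?_
  rw [heq, sub_self, integral_eq_zero_iff_of_nonneg
    (fun J => sub_nonneg.2 (Real.cos_le_one _)) ((integrable_const _).sub hc)] at hsub
  filter_upwards [hsub, hz] with J hJ hJ'
  refine hJ' ?_
  simp only [Pi.zero_apply] at hJ
  linarith

theorem charFun_compoundPoisson (r : ℝ≥0) (z : ℝ) :
    charFun (compoundPoisson r μ) z = Complex.exp (r * (charFun μ z - 1)) := by
  rw [charFun_eq_charFunDual_toDualMap, charFunDual_compoundPoisson,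
    ← charFun_eq_charFunDual_toDualMap]

/-- A compound Poisson variable with nonzero jumps leaves every compact set as its rate grows. -/
theorem tendsto_integral_exp_neg_sq (hμ : ¬ ∀ᵐ J ∂μ, J = 0) :
    Tendsto (fun r : ℝ≥0 => ∫ x, Real.exp (-(x ^ 2) / 2) ∂compoundPoisson r μ) atTop (𝓝 0) := by
  have h1 : ∀ r : ℝ≥0, ‖∫ x, Real.exp (-(x ^ 2) / 2) ∂compoundPoisson r μ‖ ≤
      ∫ z, Real.exp (r * ((charFun μ z).re - 1)) ∂gaussianReal 0 1 := by
    intro r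
    -- The function `exp (-x² / 2)` is the characteristic function of a standard Gaussian, so by
    -- Fubini its integral is a Gaussian average of the compound Poisson characteristic function.
    have e1 : ((∫ x, Real.exp (-(x ^ 2) / 2) ∂compoundPoisson r μ : ℝ) : ℂ) =
        ∫ z, Complex.exp (r * (charFun μ z - 1)) ∂gaussianReal 0 1 := by
      simp_rw [← charFun_compoundPoisson, charFun_apply_real]
      rw [integral_integral_swap]
      · rw [← integral_complex_ofReal]
        refine integral_congr_ae (Eventually.of_forall fun x => ?_)
        have := charFun_gaussianReal (μ := 0) (v := 1) x
        rw [charFun_apply_real] at this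
        simp only
        rw [show (fun z : ℝ => Complex.exp ((z : ℂ) * x * Complex.I)) =
          fun z : ℝ => Complex.exp ((x : ℂ) * z * Complex.I) by ext z; rw [mul_comm (z : ℂ)], this]
        push_cast
        congr 1
        simp
        ring
      · refine (integrable_const (1 : ℝ)).mono (Continuous.aestronglyMeasurable ?_)
          (Eventually.of_forall fun p => ?_)
        · simp only [Function.uncurry_def]; fun_prop
        · simp only [Function.uncurry_def]
          rw [← Complex.ofReal_mul, Complex.norm_exp_ofReal_mul_I]; simp
    rw [← Complex.norm_real, e1]
    refine (norm_integral_le_integral_norm _).trans (le_of_eq ?_)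
    refine integral_congr_ae (Eventually.of_forall fun z => ?_)
    simp [Complex.norm_exp]
  refine squeeze_zero_norm h1 ?_
  have h2 := tendsto_integral_filter_of_dominated_convergence (μ := gaussianReal 0 1)
    (F := fun (r : ℝ≥0) z => Real.exp (r * ((charFun μ z).re - 1))) (f := fun _ => 0)
    (l := atTop) (fun _ => (1 : ℝ))
    (Eventually.of_forall fun r => by
      have := measurable_charFun (μ := μ)
      have h3 : Measurable fun z => (charFun μ z).re := Complex.measurable_re.comp this
      exact Measurable.aestronglyMeasurable (by fun_prop))
    (Eventually.of_forall fun r => by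
      filter_upwards [ae_re_charFun_lt_one hμ] with z hz
      rw [Real.norm_of_nonneg (Real.exp_pos _).le]
      exact Real.exp_le_one_iff.2 (mul_nonpos_of_nonneg_of_nonpos r.2 (by linarith)))
    (integrable_const _)
    (by
      filter_upwards [ae_re_charFun_lt_one hμ] with z hz
      refine Real.tendsto_exp_atBot.comp ?_
      exact Tendsto.atTop_mul_const_of_neg (sub_neg.2 hz) (NNReal.tendsto_coe_atTop.2 tendsto_id))
  simpa using h2

/-- Outside a compact set `G` is close to `l`; inside, the bounded error is dominated by a multiple
of a Gaussian bump, whose integral vanishes in the limit. -/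
theorem tendsto_integral_compoundPoisson (hμ : ¬ ∀ᵐ J ∂μ, J = 0) {G : ℝ → ℝ} (hG : Measurable G)
    {B l : ℝ} (hB : ∀ x, |G x| ≤ B) (hl : Tendsto G (cocompact ℝ) (𝓝 l)) :
    Tendsto (fun r : ℝ≥0 => ∫ x, G x ∂compoundPoisson r μ) atTop (𝓝 l) := by
  have hBl : ∀ x, |G x - l| ≤ B + |l| := fun x => (abs_sub _ _).trans (by linarith [hB x])
  have hB0 : 0 ≤ B + |l| := (abs_nonneg _).trans (hBl 0)
  rw [Metric.tendsto_atTop']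
  intro ε hε
  obtain ⟨K, hK⟩ : ∃ K : ℝ, ∀ x : ℝ, K < |x| → |G x - l| < ε / 2 := by
    have h1 := hl.eventually (Metric.ball_mem_nhds l (half_pos hε))
    rw [← Metric.cobounded_eq_cocompact, ← comap_norm_atTop, eventually_comap] at h1
    obtain ⟨K, hK⟩ := eventually_atTop.1 h1
    refine ⟨K, fun x hx => ?_⟩
    have := hK |x| hx.le x rfl
    rwa [Real.dist_eq] at this
  -- Chosen so that `c * exp (-x² / 2)` is at least `B + |l|` whenever `|x| ≤ K`.
  set c := (B + |l|) * Real.exp (K ^ 2 / 2) with hc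
  have hpt : ∀ x, |G x - l| ≤ ε / 2 + c * Real.exp (-(x ^ 2) / 2) := by
    intro x
    by_cases hx : K < |x|
    · have := hK x hx
      have h2 : 0 ≤ c * Real.exp (-(x ^ 2) / 2) := by positivity
      linarith
    · have h3 : x ^ 2 ≤ K ^ 2 := by
        rw [← sq_abs]
        exact pow_le_pow_left₀ (abs_nonneg _) (not_lt.1 hx) 2
      have h4 : 1 ≤ Real.exp (K ^ 2 / 2) * Real.exp (-(x ^ 2) / 2) := by
        rw [← Real.exp_add]; exact Real.one_le_exp (by linarith)
      have h5 : (B + |l|) * 1 ≤ c * Real.exp (-(x ^ 2) / 2) := by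
        rw [hc, mul_assoc]; exact mul_le_mul_of_nonneg_left h4 hB0
      linarith [hBl x]
  have h6 := (tendsto_integral_exp_neg_sq hμ).const_mul c
  rw [mul_zero] at h6
  obtain ⟨r₀, hr₀⟩ := eventually_atTop.1 (h6.eventually (gt_mem_nhds (half_pos hε)))
  refine ⟨r₀, fun r hr => ?_⟩
  have hiG : Integrable G (compoundPoisson r μ) :=
    (integrable_const B).mono' hG.aestronglyMeasurable (Eventually.of_forall hB)
  have hie : Integrable (fun x : ℝ => Real.exp (-(x ^ 2) / 2)) (compoundPoisson r μ) :=
    (integrable_const (1 : ℝ)).mono' (by fun_prop) (Eventually.of_forall fun x => by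
      rw [Real.norm_of_nonneg (Real.exp_pos _).le]
      exact Real.exp_le_one_iff.2 (by nlinarith [sq_nonneg x]))
  have h7 : ∫ x, G x ∂compoundPoisson r μ - l = ∫ x, (G x - l) ∂compoundPoisson r μ := by
    rw [integral_sub hiG (integrable_const _)]; simp
  rw [Real.dist_eq, h7]
  calc |∫ x, (G x - l) ∂compoundPoisson r μ| ≤ ∫ x, |G x - l| ∂compoundPoisson r μ :=
        abs_integral_le_integral_abs
    _ ≤ ∫ x, (ε / 2 + c * Real.exp (-(x ^ 2) / 2)) ∂compoundPoisson r μ :=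
        integral_mono (hiG.sub (integrable_const _)).abs
          ((integrable_const _).add (hie.const_mul _)) hpt
    _ = ε / 2 + c * ∫ x, Real.exp (-(x ^ 2) / 2) ∂compoundPoisson r μ := by
        rw [integral_add (integrable_const _) (hie.const_mul _), integral_const_mul]; simp
    _ < ε := by linarith [hr₀ r hr.le]

theorem tendsto_tanh_atTop : Tendsto Real.tanh atTop (𝓝 1) := by
  have h1 : Real.tanh = fun x => (1 - Real.exp (-(2 * x))) / (1 + Real.exp (-(2 * x))) := by
    ext x
    have h : Real.exp (-(2 * x)) = Real.exp (-x) / Real.exp x := by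
      rw [← Real.exp_sub]; congr 1; ring
    rw [Real.tanh_eq_sinh_div_cosh, Real.sinh_eq, Real.cosh_eq, h]
    field_simp
  have h2 : Tendsto (fun x : ℝ => Real.exp (-(2 * x))) atTop (𝓝 0) :=
    Real.tendsto_exp_neg_atTop_nhds_zero.comp (tendsto_id.const_mul_atTop two_pos)
  rw [h1]
  have h3 := (h2.const_sub 1).div (h2.const_add 1) (by norm_num)
  rw [sub_zero, add_zero, div_one] at h3
  exact h3

/-- The hyperbolic tangent has different limits at the two ends of the line; evenness of `g` makes
them agree. -/
theorem tendsto_even_tanh {β : ℝ} (hβ : 0 < β) {g : ℝ → ℝ} (hg : Continuous g)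
    (heven : ∀ w, g (-w) = g w) :
    Tendsto (fun x : ℝ => g (Real.tanh (β * x))) (cocompact ℝ) (𝓝 (g 1)) := by
  have h1 : (fun x : ℝ => g (Real.tanh (β * x))) = fun x => g (Real.tanh (β * ‖x‖)) := by
    ext x
    rcases abs_choice x with h | h <;> rw [Real.norm_eq_abs, h]
    rw [mul_neg, Real.tanh_neg, heven]
  rw [h1]
  exact (hg.tendsto 1).comp (tendsto_tanh_atTop.comp
    ((tendsto_norm_cocompact_atTop (E := ℝ)).const_mul_atTop hβ))

theorem compoundPoisson_map_neg (hsymm : μ.map (fun J : ℝ => -J) = μ) (r : ℝ≥0) :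
    (compoundPoisson r μ).map (fun x : ℝ => -x) = compoundPoisson r μ := by
  have : IsProbabilityMeasure (μ.map fun J : ℝ => -J) := by rw [hsymm]; infer_instance
  have h := poissonMarks_map r μ (h := fun J : ℝ => -J) measurable_neg
  simp only [hsymm] at h
  have hm : Measurable fun d : ℕ × (ℕ → ℝ) => ∑ i ∈ Finset.range d.1, d.2 i :=
    measurable_sum_marks measurable_id
  refine Eq.trans ?_ h
  change Measure.map _ ((poissonMarks r μ).map _) = _
  rw [Measure.map_map measurable_neg hm]
  simp [Function.comp_def]

theorem compoundPoisson_of_ae_zero (hμ : ∀ᵐ J ∂μ, J = 0) (r : ℝ≥0) :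
    compoundPoisson r μ = compoundPoisson 0 μ := by
  have h0 : ∀ L : StrongDual ℝ ℝ, charFunDual μ L = 1 := by
    intro L
    rw [charFunDual_apply, integral_congr_ae (g := fun _ => (1 : ℂ))]
    · simp
    · filter_upwards [hμ] with J hJ
      simp [hJ]
  exact compoundPoisson_congr _ _ _ _ fun L => by simp [h0]

/-- The limit of the law of a Gibbs average at infinite connectivity. -/
theorem exists_tendsto_spinLaw {β : ℝ} (hβ : 0 < β) (hsymm : μ.map (fun J : ℝ => -J) = μ) :
    ∃ ρ : ProbabilityMeasure ℝ, (∀ᵐ w ∂(ρ : Measure ℝ), |w| ≤ 1) ∧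
      Tendsto (spinLaw β μ) atTop (𝓝 ρ) ∧
      ∀ n : ℕ, Tendsto (fun a => ∫ w, w ^ (2 * n) ∂(spinLaw β μ a : Measure ℝ)) atTop
        (𝓝 (∫ w, w ^ (2 * n) ∂(ρ : Measure ℝ))) := by
  -- If `J` vanishes almost surely, nothing depends on the connectivity, and the limit is the law at
  -- connectivity `0`.
  by_cases hμ : ∀ᵐ J ∂μ, J = 0
  · have h : spinLaw β μ = fun _ => spinLaw β μ 0 := by
      ext1 a
      apply Subtype.ext
      change (spinLaw β μ a : Measure ℝ) = (spinLaw β μ 0 : Measure ℝ)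
      rw [toMeasure_spinLaw, toMeasure_spinLaw, compoundPoisson_of_ae_zero hμ,
        compoundPoisson_of_ae_zero hμ (2 * 0)]
    refine ⟨spinLaw β μ 0, ae_spinLaw β μ 0, ?_, fun n => ?_⟩
    · rw [h]; exact tendsto_const_nhds
    · rw [h]; exact tendsto_const_nhds
  · have h2 : Tendsto (fun a : ℝ≥0 => 2 * a) atTop atTop := tendsto_id.const_mul_atTop two_pos
    have hpq : (1 / 2 : ℝ≥0) + 1 / 2 = 1 := by rw [← NNReal.coe_inj]; push_cast; norm_num
    have hp := isProbabilityMeasure_mixture hpq (Measure.dirac (1 : ℝ)) (Measure.dirac (-1 : ℝ))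
    -- The field diverges in absolute value and is symmetric, so the limit is the fair law on `{1,
    -- -1}`.
    set ρ : ProbabilityMeasure ℝ :=
      ⟨(1 / 2 : ℝ≥0) • Measure.dirac (1 : ℝ) + (1 / 2 : ℝ≥0) • Measure.dirac (-1 : ℝ), hp⟩
    have hρ : ∀ f : ℝ → ℝ, ∫ w, f w ∂(ρ : Measure ℝ) = (f 1 + f (-1)) / 2 := by
      intro f
      have := (integral_mixture (1 / 2) (1 / 2) (f := f) (integrable_dirac (a := (1 : ℝ)) (by simp))
        (integrable_dirac (a := (-1 : ℝ)) (by simp))).2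
      refine this.trans ?_
      simp
      ring
    refine ⟨ρ, ?_, ?_, fun n => ?_⟩
    · change ∀ᵐ w ∂((1 / 2 : ℝ≥0) • Measure.dirac (1 : ℝ) + (1 / 2 : ℝ≥0) • Measure.dirac (-1 : ℝ)),
        |w| ≤ 1
      rw [ae_add_measure_iff]
      exact ⟨Measure.ae_smul_measure (by simp [ae_dirac_eq]) _,
        Measure.ae_smul_measure (by simp [ae_dirac_eq]) _⟩
    · rw [ProbabilityMeasure.tendsto_iff_forall_integral_tendsto]
      intro f
      have hf : Measurable f := f.continuous.measurable
      -- The symmetric field law sees only the even part of a test function, and even functions have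
      -- a limit at infinity along `tanh`.
      set g : ℝ → ℝ := fun w => (f w + f (-w)) / 2 with hg
      have hgc : Continuous g := by have := f.continuous; fun_prop
      have hsym : ∀ a : ℝ≥0, ∫ w, f w ∂(spinLaw β μ a : Measure ℝ) =
          ∫ x, g (Real.tanh (β * x)) ∂compoundPoisson (2 * a) μ := by
        intro a
        have hm : Measurable fun x => f (Real.tanh (β * x)) := hf.comp (measurable_tanh_mul β)
        have hm' : Measurable fun x => f (-Real.tanh (β * x)) :=
          hf.comp (measurable_tanh_mul β).neg
        have e1 : ∫ x, f (Real.tanh (β * x)) ∂compoundPoisson (2 * a) μ =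
            ∫ x, f (-Real.tanh (β * x)) ∂compoundPoisson (2 * a) μ := by
          conv_lhs => rw [← compoundPoisson_map_neg hsymm]
          rw [integral_map (by fun_prop) hm.aestronglyMeasurable]
          simp only [mul_neg, Real.tanh_neg]
        have i1 : Integrable (fun x => f (Real.tanh (β * x))) (compoundPoisson (2 * a) μ) :=
          (integrable_const ‖f‖).mono' hm.aestronglyMeasurable
            (Eventually.of_forall fun p => f.norm_coe_le_norm _)
        have i2 : Integrable (fun x => f (-Real.tanh (β * x))) (compoundPoisson (2 * a) μ) :=
          (integrable_const ‖f‖).mono' hm'.aestronglyMeasurable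
            (Eventually.of_forall fun p => f.norm_coe_le_norm _)
        rw [integral_spinLaw β μ a hf, hg]
        simp only
        rw [integral_div, integral_add i1 i2, ← e1]
        ring
      simp_rw [hsym]
      rw [hρ f]
      refine (tendsto_integral_compoundPoisson hμ (hgc.measurable.comp (measurable_tanh_mul β))
        (B := ‖f‖) (fun x => ?_) (tendsto_even_tanh hβ hgc fun w => ?_)).comp h2
      · have h3 := f.norm_coe_le_norm (Real.tanh (β * x))
        have h4 := f.norm_coe_le_norm (-Real.tanh (β * x))
        rw [Real.norm_eq_abs, abs_le] at h3 h4
        simp only [hg, Function.comp_apply]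
        rw [abs_le]
        constructor <;> linarith [h3.1, h3.2, h4.1, h4.2]
      · simp only [hg, neg_neg]; ring
    · have hm : Measurable fun w : ℝ => w ^ (2 * n) := by fun_prop
      simp_rw [fun a => integral_spinLaw β μ a hm]
      rw [hρ]
      have h5 := (tendsto_integral_compoundPoisson hμ (hm.comp (measurable_tanh_mul β))
        (B := 1) (fun x => ?_) (tendsto_even_tanh hβ (g := fun w => w ^ (2 * n)) (by fun_prop)
          fun w => ?_)).comp h2
      · convert! h5 using 2
        simp [pow_mul]
      · simp only [Function.comp_apply]
        rw [abs_pow]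
        exact pow_le_one₀ (abs_nonneg _) (Real.abs_tanh_lt_one _).le
      · simp [pow_mul]

end AuxInfinite

/-! ### The infinite volume limit of the auxiliary system -/

section AuxLimits

variable {β : ℝ} {μ : Measure ℝ} [IsProbabilityMeasure μ]

theorem tendsto_auxLaw_top (hβ : 0 < β) (hsymm : μ.map (fun J : ℝ => -J) = μ) :
    (∀ᵐ w ∂(auxLaw β μ ⊤ : Measure ℝ), |w| ≤ 1) ∧
      Tendsto (spinLaw β μ) atTop (𝓝 (auxLaw β μ ⊤)) ∧
      ∀ n : ℕ, auxOverlap β μ (2 * n) ⊤ = ∫ w, w ^ (2 * n) ∂(auxLaw β μ ⊤ : Measure ℝ) ∧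
        Tendsto (fun a => ∫ w, w ^ (2 * n) ∂(spinLaw β μ a : Measure ℝ)) atTop
          (𝓝 (auxOverlap β μ (2 * n) ⊤)) := by
  obtain ⟨ρ, h1, h2, h3⟩ := exists_tendsto_spinLaw hβ hsymm
  have e1 : auxLaw β μ ⊤ = ρ := by
    have : auxLawAt β μ = spinLaw β μ := by ext1 a; exact auxLawAt_eq β μ a
    rw [auxLaw, if_pos rfl, this]
    exact h2.limUnder_eq
  have e2 : ∀ n, auxOverlap β μ (2 * n) ⊤ = ∫ w, w ^ (2 * n) ∂(ρ : Measure ℝ) := by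
    intro n
    have : auxOverlapAt β μ (2 * n) = fun a => ∫ w, w ^ (2 * n) ∂(spinLaw β μ a : Measure ℝ) := by
      ext1 a; exact auxOverlapAt_eq β μ (2 * n) a
    rw [auxOverlap, if_pos rfl, this]
    exact (h3 n).limUnder_eq
  rw [e1]
  exact ⟨h1, h2, fun n => ⟨e2 n, by rw [e2 n]; exact h3 n⟩⟩

theorem hasAuxLimits (hβ : 0 < β) (hsymm : μ.map (fun J : ℝ => -J) = μ) : HasAuxLimits β μ := by
  obtain ⟨_, h2, h3⟩ := tendsto_auxLaw_top hβ hsymm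
  refine ⟨fun a => ⟨?_, tendsto_auxPairLawFinite β μ a, fun n => ?_⟩, ?_, fun n => ?_⟩
  · simp_rw [auxLawFinite_eq, auxLaw_coe]; exact tendsto_const_nhds
  · simp_rw [auxOverlapFinite_eq, auxOverlap_coe]; exact tendsto_const_nhds
  · simp_rw [auxLaw_coe]; exact h2
  · simp_rw [auxOverlap_coe]; exact (h3 n).2

theorem ae_auxLaw_abs_le_one (hβ : 0 < β) (hsymm : μ.map (fun J : ℝ => -J) = μ) (α' : ℝ≥0∞) :
    ∀ᵐ w ∂(auxLaw β μ α' : Measure ℝ), |w| ≤ 1 := by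
  induction α' using ENNReal.recTopCoe with
  | top => exact (tendsto_auxLaw_top hβ hsymm).1
  | coe a => rw [auxLaw_coe]; exact ae_spinLaw β μ a

theorem auxOverlap_eq_integral (hβ : 0 < β) (hsymm : μ.map (fun J : ℝ => -J) = μ) (α' : ℝ≥0∞)
    (n : ℕ) : auxOverlap β μ (2 * n) α' = ∫ w, w ^ (2 * n) ∂(auxLaw β μ α' : Measure ℝ) := by
  induction α' using ENNReal.recTopCoe with
  | top => exact ((tendsto_auxLaw_top hβ hsymm).2.2 n).1
  | coe a => rw [auxLaw_coe, auxOverlap_coe]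

end AuxLimits

/-! ### Log-partition functions of the three Hamiltonians -/

section Hamiltonians

variable {N : ℕ} [NeZero N] {β : ℝ} {μ : Measure ℝ} [IsProbabilityMeasure μ]

/-- The product of the spins at two sites. -/
def pairSpin (p : Fin N × Fin N) (σ : Config N) : ℝ := spin σ p.1 * spin σ p.2

/-- The product of an effective magnetization and the spin at a site. -/
def fieldSpin (p : ℝ × Fin N) (σ : Config N) : ℝ := p.1 * spin σ p.2

/-- The product of two effective magnetizations. -/
def internalSpin (p : ℝ × ℝ) (_σ : Config N) : ℝ := p.1 * p.2

theorem measurable_pairSpin : Measurable (pairSpin (N := N)) := measurable_of_finite _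

theorem measurable_fieldSpin : Measurable (fieldSpin (N := N)) := by
  refine measurable_pi_lambda _ fun σ => ?_
  have : Measurable fun i : Fin N => spin σ i := measurable_of_finite _
  unfold fieldSpin
  fun_prop

theorem measurable_internalSpin : Measurable (internalSpin (N := N)) := by
  unfold internalSpin
  fun_prop

theorem pairSpin_eq_one_or (p : Fin N × Fin N) (σ : Config N) :
    pairSpin p σ = 1 ∨ pairSpin p σ = -1 := by
  unfold pairSpin
  rcases spin_eq_one_or σ p.1 with h | h <;> rcases spin_eq_one_or σ p.2 with h' | h' <;>
    simp [h, h']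

theorem abs_pairSpin_le (p : Fin N × Fin N) (σ : Config N) : |pairSpin p σ| ≤ 1 := by
  rcases pairSpin_eq_one_or p σ with h | h <;> simp [h]

theorem abs_fieldSpin_le {p : ℝ × Fin N} (hp : |p.1| ≤ 1) (σ : Config N) :
    |fieldSpin p σ| ≤ 1 := by
  rw [fieldSpin, abs_mul, abs_spin, mul_one]; exact hp

theorem abs_internalSpin_le {p : ℝ × ℝ} (hp : |p.1| ≤ 1 ∧ |p.2| ≤ 1) (σ : Config N) :
    |internalSpin p σ| ≤ 1 := by
  rw [internalSpin, abs_mul]; exact mul_le_one₀ hp.1 (abs_nonneg _) hp.2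

/-- The law of the log-weights of a two-body bond. -/
def pairBondLaw (β : ℝ) (μ : Measure ℝ) (N : ℕ) [NeZero N] : Measure (Config N → ℝ) :=
  bondLaw β μ ((uniformSite N).prod (uniformSite N)) pairSpin

instance : IsProbabilityMeasure (pairBondLaw β μ N) :=
  isProbabilityMeasure_bondLaw measurable_pairSpin

theorem log_partitionFn_vianaBray (m : ℕ) (x : ℕ → ℝ × Fin N × Fin N) :
    Real.log (partitionFn β (vianaBrayHam m x)) =
      logSumExp (∑ ν ∈ Finset.range m, fun σ => bondLog (β * (x ν).1) (pairSpin (x ν).2 σ)) := by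
  unfold partitionFn logSumExp
  congr 1
  refine Finset.sum_congr rfl fun σ _ => ?_
  rw [vianaBrayHam, neg_mul_neg, Finset.mul_sum, Finset.sum_apply]
  congr 1
  refine Finset.sum_congr rfl fun ν _ => ?_
  rw [bondLog_of_sq_eq_one (pairSpin_eq_one_or _ _), pairSpin]
  ring

theorem integrable_pairBondLaw (hint : Integrable (fun J : ℝ => J) μ) :
    Integrable (fun v => v) (pairBondLaw β μ N) :=
  integrable_bondLaw measurable_pairSpin
    (Eventually.of_forall fun p σ => abs_pairSpin_le p σ) hint

theorem integral_log_partitionFn_vianaBray (α : ℝ≥0) (hint : Integrable (fun J : ℝ => J) μ) :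
    Integrable (fun d => Real.log (partitionFn β (vianaBrayHam d.1 d.2)))
      (vianaBrayDisorder α μ N) ∧
    ∫ d, Real.log (partitionFn β (vianaBrayHam d.1 d.2)) ∂vianaBrayDisorder α μ N =
      ∫ v, logSumExp v ∂compoundPoisson (α * N) (pairBondLaw β μ N) := by
  have hm : Measurable fun p : ℝ × (Fin N × Fin N) => fun σ : Config N =>
      bondLog (β * p.1) (pairSpin p.2 σ) := measurable_bondVector β measurable_pairSpin
  have : IsProbabilityMeasure ((μ.prod ((uniformSite N).prod (uniformSite N))).map
      fun p : ℝ × (Fin N × Fin N) => fun σ : Config N => bondLog (β * p.1) (pairSpin p.2 σ)) :=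
    Measure.isProbabilityMeasure_map hm.aemeasurable
  have h := integral_logSumExp_poissonMarks (α * N) hm (integrable_pairBondLaw (β := β) hint)
  simp_rw [log_partitionFn_vianaBray]
  exact h

variable {κ : Measure ℝ} [IsProbabilityMeasure κ]

theorem ae_prod_abs_le_one (hκ : ∀ᵐ w ∂κ, |w| ≤ 1) : ∀ᵐ p ∂κ.prod κ, |p.1| ≤ 1 ∧ |p.2| ≤ 1 := by
  have h1 : ∀ᵐ p ∂κ.prod κ, |p.1| ≤ 1 := Measure.quasiMeasurePreserving_fst.ae hκ
  have h2 : ∀ᵐ p ∂κ.prod κ, |p.2| ≤ 1 := Measure.quasiMeasurePreserving_snd.ae hκ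
  filter_upwards [h1, h2] with p h h' using ⟨h, h'⟩

/-- The law of the log-weights of a cavity bond. -/
def fieldBondLaw (β : ℝ) (μ κ : Measure ℝ) (N : ℕ) [NeZero N] : Measure (Config N → ℝ) :=
  bondLaw β μ (κ.prod (uniformSite N)) fieldSpin

/-- The law of the log-weights of an internal bond. -/
def internalBondLaw (β : ℝ) (μ κ : Measure ℝ) (N : ℕ) [NeZero N] : Measure (Config N → ℝ) :=
  bondLaw β μ (κ.prod κ) internalSpin

instance : IsProbabilityMeasure (fieldBondLaw β μ κ N) :=
  isProbabilityMeasure_bondLaw measurable_fieldSpin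

instance : IsProbabilityMeasure (internalBondLaw β μ κ N) :=
  isProbabilityMeasure_bondLaw measurable_internalSpin

theorem ae_fieldSpin (hκ : ∀ᵐ w ∂κ, |w| ≤ 1) :
    ∀ᵐ p ∂κ.prod (uniformSite N), ∀ σ, |fieldSpin p σ| ≤ 1 := by
  have h1 : ∀ᵐ p ∂κ.prod (uniformSite N), |p.1| ≤ 1 := Measure.quasiMeasurePreserving_fst.ae hκ
  filter_upwards [h1] with p hp using abs_fieldSpin_le hp

theorem ae_internalSpin (hκ : ∀ᵐ w ∂κ, |w| ≤ 1) :
    ∀ᵐ p ∂κ.prod κ, ∀ σ : Config N, |internalSpin p σ| ≤ 1 := by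
  filter_upwards [ae_prod_abs_le_one hκ] with p hp using abs_internalSpin_le hp

/-- The mean increment of the log-partition function is larger for cavity bonds than for an even
mixture of two-body and internal bonds. -/
theorem bond_increment_le (hκ : ∀ᵐ w ∂κ, |w| ≤ 1) (hint : Integrable (fun J : ℝ => J) μ)
    (v : Config N → ℝ) :
    2 * ∫ p, energy β μ (weightedMean v (fieldSpin p)) ∂κ.prod (uniformSite N) ≤
      ∫ p, energy β μ (weightedMean v (pairSpin p)) ∂(uniformSite N).prod (uniformSite N) +
      ∫ p, energy β μ (weightedMean v (internalSpin p)) ∂κ.prod κ := by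
  have m1 : ∀ {Ω : Type} [MeasurableSpace Ω] {u : Ω → Config N → ℝ}, Measurable u →
      Measurable fun ω => weightedMean v (u ω) := by
    intro Ω _ u hu; unfold weightedMean; fun_prop
  have s1 := hasSum_integral_energy (β := β) (ρ := (uniformSite N).prod (uniformSite N))
    (m1 measurable_pairSpin)
    (Eventually.of_forall fun p => abs_weightedMean_le fun σ => abs_pairSpin_le p σ) hint
  have s2 := hasSum_integral_energy (β := β) (ρ := κ.prod κ)
    (m1 measurable_internalSpin)
    ((ae_internalSpin hκ).mono fun p hp => abs_weightedMean_le hp) hint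
  have s3 := hasSum_integral_energy (β := β) (ρ := κ.prod (uniformSite N))
    (m1 measurable_fieldSpin)
    ((ae_fieldSpin hκ).mono fun p hp => abs_weightedMean_le hp) hint
  -- All coefficients of the energy series are nonnegative, so it suffices to compare the moments of
  -- each even order.
  refine hasSum_le (fun n => ?_) (s3.mul_left 2) (s1.add s2)
  set k := 2 * (n + 1)
  set q := ∫ w, w ^ k ∂κ
  have e1 : ∫ p, weightedMean v (pairSpin p) ^ k ∂(uniformSite N).prod (uniformSite N) =
      ∑ i, ∑ j, (1 / (N : ℝ)) * (1 / (N : ℝ)) *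
        weightedMean v (fun σ => spin σ i * spin σ j) ^ k := by
    rw [integral_prod_uniformSite Integrable.of_finite]
    simp_rw [integral_uniformSite, smul_eq_mul, Finset.mul_sum]
    rw [Finset.sum_comm]
    simp_rw [← mul_assoc]
    rfl
  have e2 : ∫ p, weightedMean v (internalSpin p) ^ k ∂κ.prod κ = q * q := by
    have : ∀ p : ℝ × ℝ, weightedMean v (internalSpin (N := N) p) ^ k = p.1 ^ k * p.2 ^ k := by
      intro p
      rw [← mul_pow]
      congr 1
      exact weightedMean_const v _
    simp_rw [this]
    exact integral_prod_mul (fun w : ℝ => w ^ k) fun w => w ^ k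
  have e3 : ∫ p, weightedMean v (fieldSpin p) ^ k ∂κ.prod (uniformSite N) =
      q * ∑ i, (1 / (N : ℝ)) * weightedMean v (fun σ => spin σ i) ^ k := by
    have : ∀ p : ℝ × Fin N, weightedMean v (fieldSpin p) ^ k =
        p.1 ^ k * weightedMean v (fun σ => spin σ p.2) ^ k := by
      intro p
      rw [← mul_pow]
      congr 1
      exact weightedMean_const_mul v (fun σ => spin σ p.2) p.1
    simp_rw [this]
    rw [integral_prod_mul (fun w : ℝ => w ^ k) fun i => weightedMean v (fun σ => spin σ i) ^ k,
      integral_uniformSite, smul_eq_mul, Finset.mul_sum]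
  rw [e1, e2, e3]
  -- The extra index `none` carries the constant spin `1` with weight `-q`, next to the sites with
  -- weight `1 / N`. The form is the replica average of `(Q - q) ^ 2`.
  have hpos := sum_mul_sum_weightedMean_pow_nonneg v
    (fun (o : Option (Fin N)) σ => o.elim 1 fun i => spin σ i)
    (fun o => o.elim (-q) fun _ => 1 / (N : ℝ)) k
  simp only [Fintype.sum_option, Option.elim_none, Option.elim_some, one_mul, mul_one,
    weightedMean_const, one_pow] at hpos
  rw [Finset.sum_add_distrib] at hpos
  have e4 : ∑ i : Fin N, -q * (1 / (N : ℝ)) * weightedMean v (fun σ => spin σ i) ^ k =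
      -q * ∑ i, (1 / (N : ℝ)) * weightedMean v (fun σ => spin σ i) ^ k := by
    simp_rw [Finset.mul_sum, mul_assoc]
  have e5 : ∑ i : Fin N, 1 / (N : ℝ) * -q * weightedMean v (fun σ => spin σ i) ^ k =
      -q * ∑ i, (1 / (N : ℝ)) * weightedMean v (fun σ => spin σ i) ^ k := by
    rw [← e4]
    exact Finset.sum_congr rfl fun i _ => by ring
  rw [e4, e5] at hpos
  have hc := energyCoeff_nonneg (β := β) (μ := μ) n
  rw [← mul_add, mul_left_comm]
  refine mul_le_mul_of_nonneg_left ?_ hc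
  linarith

theorem integral_bondLog_prod {Ω : Type} [MeasurableSpace Ω] {ρ : Measure Ω}
    [IsProbabilityMeasure ρ] {u : Ω → ℝ} (hu : Measurable u) (hu1 : ∀ᵐ x ∂ρ, |u x| ≤ 1)
    (hsymm : μ.map (fun J : ℝ => -J) = μ) (hint : Integrable (fun J : ℝ => J) μ) :
    Integrable (fun p : ℝ × Ω => bondLog (β * p.1) (u p.2)) (μ.prod ρ) ∧
      ∫ p : ℝ × Ω, bondLog (β * p.1) (u p.2) ∂μ.prod ρ =
        energy β μ 1 - ∫ x, energy β μ (u x) ∂ρ := by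
  have hm : Measurable fun p : ℝ × Ω => bondLog (β * p.1) (u p.2) :=
    measurable_bondLog.comp (by fun_prop : Measurable fun p : ℝ × Ω => (β * p.1, u p.2))
  have h2 : ∀ᵐ p ∂μ.prod ρ, |u p.2| ≤ 1 := Measure.quasiMeasurePreserving_snd.ae hu1
  have hi : Integrable (fun p : ℝ × Ω => bondLog (β * p.1) (u p.2)) (μ.prod ρ) := by
    refine ((hint.const_mul β).comp_fst ρ).norm.mono' hm.aestronglyMeasurable ?_
    filter_upwards [h2] with p hp using abs_bondLog_le hp
  refine ⟨hi, ?_⟩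
  rw [integral_prod_symm _ hi, integral_congr_ae (g := fun x => energy β μ 1 - energy β μ (u x)),
    integral_sub (integrable_const _) (integrable_energy hu hu1 hint)]
  · simp
  · filter_upwards [hu1] with x hx using (integral_bondLog hsymm hint hx).2

theorem integral_halfLog_prod {Ω : Type} [MeasurableSpace Ω] {ρ : Measure Ω}
    [IsProbabilityMeasure ρ] {u : Ω → ℝ} (hu : Measurable u) (hu1 : ∀ᵐ x ∂ρ, |u x| ≤ 1)
    (hint : Integrable (fun J : ℝ => J) μ) :
    Integrable (fun p : ℝ × Ω => halfLog (Real.tanh (β * p.1) * u p.2)) (μ.prod ρ) ∧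
      ∫ p : ℝ × Ω, halfLog (Real.tanh (β * p.1) * u p.2) ∂μ.prod ρ =
        ∫ x, energy β μ (u x) ∂ρ := by
  have hi := integrable_halfLog_tanh_mul (β := β) (P := μ.prod ρ) (J := Prod.fst)
    (c := fun p => u p.2) measurable_fst (hu.comp measurable_snd) (hint.comp_fst ρ)
    (Measure.quasiMeasurePreserving_snd.ae hu1)
  exact ⟨hi, integral_prod_symm _ hi⟩

end Hamiltonians

/-! ### Cavity and internal fields -/

section Fields

variable {N : ℕ} [NeZero N] {β : ℝ} {μ : Measure ℝ} [IsProbabilityMeasure μ] {α' : ℝ≥0∞}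

theorem ae_cavityMark (hκ : ∀ᵐ w ∂(auxLaw β μ α' : Measure ℝ), |w| ≤ 1) :
    ∀ᵐ p ∂cavityMark β μ α', |p.2| ≤ 1 :=
  Measure.quasiMeasurePreserving_snd.ae hκ

theorem ae_internalMark (hκ : ∀ᵐ w ∂(auxLaw β μ α' : Measure ℝ), |w| ≤ 1) :
    ∀ᵐ p ∂internalMark β μ α', |p.2.1 * p.2.2| ≤ 1 := by
  have h : ∀ᵐ p ∂internalMark β μ α', |p.2.1| ≤ 1 ∧ |p.2.2| ≤ 1 :=
    Measure.quasiMeasurePreserving_snd.ae (ae_prod_abs_le_one hκ)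
  filter_upwards [h] with p hp
  rw [abs_mul]; exact mul_le_one₀ hp.1 (abs_nonneg _) hp.2

theorem neg_mul_cavityHam (hβ : 0 < β) (m : ℕ) {x : ℕ → (ℝ × ℝ) × Fin N}
    (hx : ∀ ν, |(x ν).1.2| ≤ 1) (σ : Config N) :
    -β * cavityHam β m x σ = ∑ ν ∈ Finset.range m,
      bondLog (β * (x ν).1.1) (fieldSpin ((x ν).1.2, (x ν).2) σ) := by
  rw [cavityHam, neg_mul_neg, Finset.mul_sum]
  refine Finset.sum_congr rfl fun ν _ => ?_
  rw [fieldSpin, ← log_cosh_div_cosh_add hβ _ (hx ν) (spin_eq_one_or σ (x ν).2), cavityCoupling]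
  field_simp

theorem neg_mul_internalHam (hβ : 0 < β) (m : ℕ) {y : ℕ → ℝ × ℝ × ℝ}
    (hy : ∀ ν, |(y ν).2.1 * (y ν).2.2| ≤ 1) :
    -β * internalHam β m y = ∑ ν ∈ Finset.range m,
      bondLog (β * (y ν).1) ((y ν).2.1 * (y ν).2.2) := by
  rw [internalHam, neg_mul_neg, Finset.mul_sum]
  refine Finset.sum_congr rfl fun ν _ => ?_
  have h := log_cosh_div_cosh_add hβ (y ν).1 (hy ν) (s := 1) (Or.inl rfl)
  rw [mul_one, mul_one] at h
  rw [← h, internalCoupling]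
  field_simp

theorem measurePreserving_fieldMarks :
    MeasurePreserving (MeasurableEquiv.prodAssoc : (ℝ × ℝ) × Fin N ≃ᵐ ℝ × (ℝ × Fin N))
      ((cavityMark β μ α').prod (uniformSite N))
      (μ.prod ((auxLaw β μ α' : Measure ℝ).prod (uniformSite N))) :=
  measurePreserving_prodAssoc _ _ _

theorem integral_fieldBond (hκ : ∀ᵐ w ∂(auxLaw β μ α' : Measure ℝ), |w| ≤ 1)
    (hsymm : μ.map (fun J : ℝ => -J) = μ) (hint : Integrable (fun J : ℝ => J) μ) (σ : Config N) :
    Integrable (fun p : (ℝ × ℝ) × Fin N => bondLog (β * p.1.1) (fieldSpin (p.1.2, p.2) σ))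
      ((cavityMark β μ α').prod (uniformSite N)) ∧
    ∫ p : (ℝ × ℝ) × Fin N, bondLog (β * p.1.1) (fieldSpin (p.1.2, p.2) σ)
      ∂(cavityMark β μ α').prod (uniformSite N) =
        energy β μ 1 - ∫ w, energy β μ w ∂(auxLaw β μ α' : Measure ℝ) := by
  have hu : Measurable fun p : ℝ × Fin N => fieldSpin p σ :=
    (measurable_pi_apply σ).comp measurable_fieldSpin
  have h := integral_bondLog_prod (β := β) (ρ := (auxLaw β μ α' : Measure ℝ).prod (uniformSite N))
    hu ((ae_fieldSpin hκ).mono fun p hp => hp σ) hsymm hint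
  have hp := measurePreserving_fieldMarks (N := N) (β := β) (μ := μ) (α' := α')
  refine ⟨(hp.integrable_comp_emb (MeasurableEquiv.measurableEmbedding _)).2 h.1, ?_⟩
  refine (hp.integral_comp' (fun p : ℝ × ℝ × Fin N => bondLog (β * p.1) (fieldSpin p.2 σ))).trans ?_
  rw [h.2]
  congr 1
  -- The energy is even, so the sign of the spin drops out; the derivative is therefore the same for
  -- every configuration.
  have heven : ∀ p : ℝ × Fin N, energy β μ (fieldSpin p σ) = energy β μ p.1 := by
    intro p
    rw [fieldSpin]
    rcases spin_eq_one_or σ p.2 with h | h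
    · rw [h, mul_one]
    · simp only [h, energy, halfLog, mul_pow]
      norm_num
  simp_rw [heven]
  rw [integral_fun_fst (energy β μ)]
  simp

theorem integral_internalBond (hκ : ∀ᵐ w ∂(auxLaw β μ α' : Measure ℝ), |w| ≤ 1)
    (hsymm : μ.map (fun J : ℝ => -J) = μ) (hint : Integrable (fun J : ℝ => J) μ) :
    Integrable (fun p : ℝ × ℝ × ℝ => bondLog (β * p.1) (p.2.1 * p.2.2)) (internalMark β μ α') ∧
    ∫ p : ℝ × ℝ × ℝ, bondLog (β * p.1) (p.2.1 * p.2.2) ∂internalMark β μ α' =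
      energy β μ 1 - ∫ p, energy β μ (p.1 * p.2)
        ∂(auxLaw β μ α' : Measure ℝ).prod (auxLaw β μ α' : Measure ℝ) :=
  integral_bondLog_prod (u := fun p : ℝ × ℝ => p.1 * p.2) (by fun_prop)
    ((ae_prod_abs_le_one hκ).mono fun p hp => by
      rw [abs_mul]; exact mul_le_one₀ hp.1 (abs_nonneg _) hp.2) hsymm hint

theorem measurable_fieldBond (σ : Config N) : Measurable fun p : (ℝ × ℝ) × Fin N =>
    bondLog (β * p.1.1) (fieldSpin (p.1.2, p.2) σ) := by
  have hs : Measurable fun i : Fin N => spin σ i := measurable_of_finite _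
  have : Measurable fun p : (ℝ × ℝ) × Fin N => (β * p.1.1, fieldSpin (p.1.2, p.2) σ) := by
    unfold fieldSpin; fun_prop
  exact measurable_bondLog.comp this

theorem measurable_internalBond : Measurable fun p : ℝ × ℝ × ℝ =>
    bondLog (β * p.1) (p.2.1 * p.2.2) := by
  have : Measurable fun p : ℝ × ℝ × ℝ => (β * p.1, p.2.1 * p.2.2) := by fun_prop
  exact measurable_bondLog.comp this

/-- For a fixed configuration the exponent is itself a Poisson sum of real terms, so Wald's identity
makes its mean linear in the connectivity. -/
theorem integral_log_exp_cavityHam (hβ : 0 < β)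
    (hκ : ∀ᵐ w ∂(auxLaw β μ α' : Measure ℝ), |w| ≤ 1)
    (hsymm : μ.map (fun J : ℝ => -J) = μ) (hint : Integrable (fun J : ℝ => J) μ) (σ : Config N)
    (α : ℝ≥0) :
    Integrable (fun d => Real.log (Real.exp (-β * cavityHam β d.1 d.2 σ)))
      (cavityDisorder β μ α' α N) ∧
    ∫ d, Real.log (Real.exp (-β * cavityHam β d.1 d.2 σ)) ∂cavityDisorder β μ α' α N =
      2 * α * N * (energy β μ 1 - ∫ w, energy β μ w ∂(auxLaw β μ α' : Measure ℝ)) := by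
  have h := integral_fieldBond hκ hsymm hint σ
  have hw := wald (2 * α * N) _ (measurable_fieldBond (β := β) σ) h.1
  have hm : ∀ᵐ s ∂(cavityMark β μ α').prod (uniformSite N), |s.1.2| ≤ 1 :=
    Measure.quasiMeasurePreserving_fst.ae (ae_cavityMark hκ)
  have hae := ae_poissonMarks (2 * α * N) hm
  have e : (fun d : ℕ × (ℕ → (ℝ × ℝ) × Fin N) => ∑ ν ∈ Finset.range d.1,
      bondLog (β * (d.2 ν).1.1) (fieldSpin ((d.2 ν).1.2, (d.2 ν).2) σ)) =ᵐ[cavityDisorder β μ α' α N]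
      fun d => Real.log (Real.exp (-β * cavityHam β d.1 d.2 σ)) := by
    filter_upwards [hae] with d hd
    rw [Real.log_exp, neg_mul_cavityHam hβ d.1 hd σ]
  refine ⟨hw.1.congr e, (integral_congr_ae e).symm.trans (hw.2.trans ?_)⟩
  rw [h.2]
  push_cast
  ring

theorem integral_log_exp_internalHam (hβ : 0 < β)
    (hκ : ∀ᵐ w ∂(auxLaw β μ α' : Measure ℝ), |w| ≤ 1)
    (hsymm : μ.map (fun J : ℝ => -J) = μ) (hint : Integrable (fun J : ℝ => J) μ) (N : ℕ) [NeZero N]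
    (α : ℝ≥0) :
    Integrable (fun d => Real.log (Real.exp (-β * internalHam β d.1 d.2)))
      (internalDisorder β μ α' α N) ∧
    ∫ d, Real.log (Real.exp (-β * internalHam β d.1 d.2)) ∂internalDisorder β μ α' α N =
      α * N * (energy β μ 1 - ∫ p, energy β μ (p.1 * p.2)
        ∂(auxLaw β μ α' : Measure ℝ).prod (auxLaw β μ α' : Measure ℝ)) := by
  have h := integral_internalBond hκ hsymm hint
  have hw := wald (α * N) _ (measurable_internalBond (β := β)) h.1
  have hae := ae_poissonMarks (α * N) (ae_internalMark hκ)
  have e : (fun d : ℕ × (ℕ → ℝ × ℝ × ℝ) => ∑ ν ∈ Finset.range d.1,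
      bondLog (β * (d.2 ν).1) ((d.2 ν).2.1 * (d.2 ν).2.2)) =ᵐ[internalDisorder β μ α' α N]
      fun d => Real.log (Real.exp (-β * internalHam β d.1 d.2)) := by
    filter_upwards [hae] with d hd
    rw [Real.log_exp, neg_mul_internalHam hβ d.1 hd]
  refine ⟨hw.1.congr e, (integral_congr_ae e).symm.trans (hw.2.trans ?_)⟩
  rw [h.2]
  push_cast
  ring

/-! ### Energy series of the auxiliary spins -/

theorem hasSum_energy_auxLaw (hκ : ∀ᵐ w ∂(auxLaw β μ α' : Measure ℝ), |w| ≤ 1)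
    (hq : ∀ n : ℕ, auxOverlap β μ (2 * n) α' = ∫ w, w ^ (2 * n) ∂(auxLaw β μ α' : Measure ℝ))
    (hint : Integrable (fun J : ℝ => J) μ) :
    HasSum (fun n => energyCoeff β μ n * auxOverlap β μ (2 * (n + 1)) α')
      (∫ w, energy β μ w ∂(auxLaw β μ α' : Measure ℝ)) := by
  simp_rw [hq]
  exact hasSum_integral_energy measurable_id hκ hint

theorem hasSum_energy_auxLaw_prod (hκ : ∀ᵐ w ∂(auxLaw β μ α' : Measure ℝ), |w| ≤ 1)
    (hq : ∀ n : ℕ, auxOverlap β μ (2 * n) α' = ∫ w, w ^ (2 * n) ∂(auxLaw β μ α' : Measure ℝ))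
    (hint : Integrable (fun J : ℝ => J) μ) :
    HasSum (fun n => energyCoeff β μ n * auxOverlap β μ (2 * (n + 1)) α' ^ 2)
      (∫ p, energy β μ (p.1 * p.2)
        ∂(auxLaw β μ α' : Measure ℝ).prod (auxLaw β μ α' : Measure ℝ)) := by
  have h := hasSum_integral_energy (β := β) (X := fun p : ℝ × ℝ => p.1 * p.2)
    (ρ := (auxLaw β μ α' : Measure ℝ).prod (auxLaw β μ α' : Measure ℝ)) (by fun_prop)
    ((ae_prod_abs_le_one hκ).mono fun p hp => by
      rw [abs_mul]; exact mul_le_one₀ hp.1 (abs_nonneg _) hp.2) hint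
  convert! h using 1
  ext n
  simp_rw [hq, mul_pow]
  rw [integral_prod_mul (fun w : ℝ => w ^ (2 * (n + 1))) fun w => w ^ (2 * (n + 1)), sq]

theorem cavityConstraint (hβ : 0 < β) (hκ : ∀ᵐ w ∂(auxLaw β μ α' : Measure ℝ), |w| ≤ 1)
    (hq : ∀ n : ℕ, auxOverlap β μ (2 * n) α' = ∫ w, w ^ (2 * n) ∂(auxLaw β μ α' : Measure ℝ))
    (hsymm : μ.map (fun J : ℝ => -J) = μ) (hint : Integrable (fun J : ℝ => J) μ) (N : ℕ)
    [NeZero N] : CavityConstraint β μ α' N := by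
  intro σ α
  have hs : HasSum (fun n : ℕ => 1 / (2 * ((n : ℝ) + 1)) *
      (∫ J, Real.tanh (β * J) ^ (2 * (n + 1)) ∂μ) * (1 - auxOverlap β μ (2 * (n + 1)) α'))
      (energy β μ 1 - ∫ w, energy β μ w ∂(auxLaw β μ α' : Measure ℝ)) := by
    convert! (hasSum_energyCoeff hint).sub (hasSum_energy_auxLaw hκ hq hint) using 1
    ext n
    simp only [energyCoeff]
    ring
  refine ⟨(integral_log_exp_cavityHam hβ hκ hsymm hint σ α).1, hs.summable, ?_⟩
  rw [hs.tsum_eq]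
  set D := energy β μ 1 - ∫ w, energy β μ w ∂(auxLaw β μ α' : Measure ℝ)
  have hN : (N : ℝ) ≠ 0 := by exact_mod_cast NeZero.ne N
  have h1 : HasDerivWithinAt (fun a : ℝ => a * (2 * D)) (2 * D) (Set.Ici 0) α := by
    simpa using (hasDerivWithinAt_id (α : ℝ) (Set.Ici 0)).mul_const (2 * D)
  -- Linearity holds only for `a ≥ 0`, where `toNNReal` loses nothing; this is why the derivative is
  -- taken within the half-line.
  have h2 : ∀ a ∈ Set.Ici (0 : ℝ), (1 / (N : ℝ)) *
      ∫ d, Real.log (Real.exp (-β * cavityHam β d.1 d.2 σ)) ∂cavityDisorder β μ α' a.toNNReal N =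
      a * (2 * D) := by
    intro a ha
    rw [(integral_log_exp_cavityHam hβ hκ hsymm hint σ a.toNNReal).2, Real.coe_toNNReal a ha]
    field_simp
    rfl
  exact h1.congr h2 (h2 α α.2)

theorem internalConstraint (hβ : 0 < β) (hκ : ∀ᵐ w ∂(auxLaw β μ α' : Measure ℝ), |w| ≤ 1)
    (hq : ∀ n : ℕ, auxOverlap β μ (2 * n) α' = ∫ w, w ^ (2 * n) ∂(auxLaw β μ α' : Measure ℝ))
    (hsymm : μ.map (fun J : ℝ => -J) = μ) (hint : Integrable (fun J : ℝ => J) μ) (N : ℕ)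
    [NeZero N] : InternalConstraint β μ α' N := by
  intro α
  set I := ∫ p, energy β μ (p.1 * p.2)
    ∂(auxLaw β μ α' : Measure ℝ).prod (auxLaw β μ α' : Measure ℝ) with hI
  have hs : HasSum (fun n : ℕ => 1 / (2 * ((n : ℝ) + 1)) *
      (∫ J, Real.tanh (β * J) ^ (2 * (n + 1)) ∂μ) * (1 - auxOverlap β μ (2 * (n + 1)) α' ^ 2))
      (energy β μ 1 - I) := by
    convert! (hasSum_energyCoeff hint).sub (hasSum_energy_auxLaw_prod hκ hq hint) using 1
    ext n
    simp only [energyCoeff]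
    ring
  refine ⟨(integral_log_exp_internalHam hβ hκ hsymm hint N α).1, hs.summable, ?_⟩
  rw [hs.tsum_eq]
  have hN : (N : ℝ) ≠ 0 := by exact_mod_cast NeZero.ne N
  have h1 : HasDerivWithinAt (fun a : ℝ => a * (energy β μ 1 - I)) (energy β μ 1 - I)
      (Set.Ici 0) α := by
    simpa using (hasDerivWithinAt_id (α : ℝ) (Set.Ici 0)).mul_const (energy β μ 1 - I)
  have h2 : ∀ a ∈ Set.Ici (0 : ℝ), (1 / (N : ℝ)) *
      ∫ d, Real.log (Real.exp (-β * internalHam β d.1 d.2)) ∂internalDisorder β μ α' a.toNNReal N =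
      a * (energy β μ 1 - I) := by
    intro a ha
    rw [(integral_log_exp_internalHam hβ hκ hsymm hint N a.toNNReal).2, Real.coe_toNNReal a ha,
      ← hI]
    field_simp
  exact h1.congr h2 (h2 α α.2)

/-! ### The trial function -/

/-- Subtracting the Boltzmann identities for the two spin values isolates twice `βK`, with `K` the
modulated coupling; each bond logarithm is at most `|β * J|` in absolute value. -/
theorem abs_mul_modulatedCoupling_le (hβ : 0 < β) (J : ℝ) {w : ℝ} (hw : |w| ≤ 1) :
    |β * modulatedCoupling β J w| ≤ |β * J| := by
  have h1 := log_cosh_div_cosh_add hβ J hw (s := 1) (Or.inl rfl)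
  have h2 := log_cosh_div_cosh_add hβ J hw (s := -1) (Or.inr rfl)
  have b1 := abs_bondLog_le (y := β * J) (u := w * 1) (by simpa using hw)
  have b2 := abs_bondLog_le (y := β * J) (u := w * -1) (by simpa using hw)
  rw [abs_le] at b1 b2 ⊢
  constructor <;> linarith [b1.1, b1.2, b2.1, b2.2]

theorem measurable_cavityCoupling : Measurable (cavityCoupling β) :=
  measurable_modulatedCoupling β

theorem integrable_cavityCoupling (hβ : 0 < β)
    (hκ : ∀ᵐ w ∂(auxLaw β μ α' : Measure ℝ), |w| ≤ 1) (hint : Integrable (fun J : ℝ => J) μ) :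
    Integrable (fun p => β * cavityCoupling β p) (cavityMark β μ α') := by
  refine ((hint.const_mul β).comp_fst _).norm.mono'
    (measurable_cavityCoupling.const_mul β).aestronglyMeasurable ?_
  filter_upwards [ae_cavityMark hκ] with p hp using abs_mul_modulatedCoupling_le hβ p.1 hp

theorem log_cosh_cavityCoupling (hβ : 0 < β)
    (hκ : ∀ᵐ w ∂(auxLaw β μ α' : Measure ℝ), |w| ≤ 1) (hint : Integrable (fun J : ℝ => J) μ) :
    Integrable (fun p => Real.log (Real.cosh (β * cavityCoupling β p))) (cavityMark β μ α') ∧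
      ∫ p, Real.log (Real.cosh (β * cavityCoupling β p)) ∂cavityMark β μ α' =
        ∫ w, energy β μ w ∂(auxLaw β μ α' : Measure ℝ) := by
  have h := integral_halfLog_prod (β := β) (u := fun w : ℝ => w) measurable_id hκ hint
  have e : (fun p : ℝ × ℝ => halfLog (Real.tanh (β * p.1) * p.2)) =ᵐ[cavityMark β μ α']
      fun p => Real.log (Real.cosh (β * cavityCoupling β p)) := by
    filter_upwards [ae_cavityMark hκ] with p hp using (log_cosh_modulatedCoupling hβ p.1 hp).symm
  exact ⟨h.1.congr e, (integral_congr_ae e).symm.trans h.2⟩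

theorem log_cosh_internalCoupling (hβ : 0 < β)
    (hκ : ∀ᵐ w ∂(auxLaw β μ α' : Measure ℝ), |w| ≤ 1) (hint : Integrable (fun J : ℝ => J) μ) :
    Integrable (fun p => Real.log (Real.cosh (β * internalCoupling β p))) (internalMark β μ α') ∧
      ∫ p, Real.log (Real.cosh (β * internalCoupling β p)) ∂internalMark β μ α' =
        ∫ p, energy β μ (p.1 * p.2)
          ∂(auxLaw β μ α' : Measure ℝ).prod (auxLaw β μ α' : Measure ℝ) := by
  have h := integral_halfLog_prod (β := β) (μ := μ) (u := fun p : ℝ × ℝ => p.1 * p.2)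
    (ρ := (auxLaw β μ α' : Measure ℝ).prod (auxLaw β μ α' : Measure ℝ)) (by fun_prop)
    ((ae_prod_abs_le_one hκ).mono fun p hp => by
      rw [abs_mul]; exact mul_le_one₀ hp.1 (abs_nonneg _) hp.2) hint
  have e : (fun p : ℝ × ℝ × ℝ => halfLog (Real.tanh (β * p.1) * (p.2.1 * p.2.2)))
      =ᵐ[internalMark β μ α'] fun p => Real.log (Real.cosh (β * internalCoupling β p)) := by
    filter_upwards [ae_internalMark hκ] with p hp using (log_cosh_modulatedCoupling hβ p.1 hp).symm
  exact ⟨h.1.congr e, (integral_congr_ae e).symm.trans h.2⟩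

theorem log_cosh_coupling (hint : Integrable (fun J : ℝ => J) μ) :
    Integrable (fun J => Real.log (Real.cosh (β * J))) μ := by
  refine (hint.const_mul β).norm.mono' (Measurable.aestronglyMeasurable (by fun_prop))
    (Eventually.of_forall fun J => ?_)
  rw [Real.norm_of_nonneg (log_cosh_nonneg _)]
  exact log_cosh_le_abs _

theorem integrable_log_cosh_of_integrable {ν : Measure ℝ} (hν : Integrable (fun x : ℝ => x) ν) :
    Integrable (fun x => Real.log (Real.cosh x)) ν := by
  refine hν.norm.mono' (Measurable.aestronglyMeasurable (by fun_prop))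
    (Eventually.of_forall fun J => ?_)
  rw [Real.norm_of_nonneg (log_cosh_nonneg _)]
  exact log_cosh_le_abs _

/-- The law of `βJ̃`. -/
def cavityFieldLaw (β : ℝ) (μ : Measure ℝ) [IsProbabilityMeasure μ] (α' : ℝ≥0∞) : Measure ℝ :=
  (cavityMark β μ α').map fun p => β * cavityCoupling β p

instance : IsProbabilityMeasure (cavityFieldLaw β μ α') :=
  Measure.isProbabilityMeasure_map (measurable_cavityCoupling.const_mul β).aemeasurable

theorem integral_cavityLogCosh (hβ : 0 < β)
    (hκ : ∀ᵐ w ∂(auxLaw β μ α' : Measure ℝ), |w| ≤ 1) (hint : Integrable (fun J : ℝ => J) μ)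
    (r : ℝ≥0) :
    Integrable (cavityLogCosh β) (poissonMarks r (cavityMark β μ α')) ∧
    Integrable (fun x => Real.log (Real.cosh x)) (compoundPoisson r (cavityFieldLaw β μ α')) ∧
    ∫ d, cavityLogCosh β d ∂poissonMarks r (cavityMark β μ α') =
      ∫ x, Real.log (Real.cosh x) ∂compoundPoisson r (cavityFieldLaw β μ α') := by
  have hm : Measurable fun p => β * cavityCoupling β p := measurable_cavityCoupling.const_mul β
  have hi : Integrable (fun x : ℝ => x) (cavityFieldLaw β μ α') :=
    (integrable_map_measure (by fun_prop) hm.aemeasurable).2 (integrable_cavityCoupling hβ hκ hint)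
  have h1 := integrable_log_cosh_of_integrable (integrable_compoundPoisson r _ hi)
  have h2 := h1
  have hlc : Measurable fun x : ℝ => Real.log (Real.cosh x) := by fun_prop
  have hp : IsProbabilityMeasure ((cavityMark β μ α').map fun p => β * cavityCoupling β p) :=
    Measure.isProbabilityMeasure_map hm.aemeasurable
  have e : (poissonMarks r (cavityMark β μ α')).map
      (fun d => ∑ i ∈ Finset.range d.1, β * cavityCoupling β (d.2 i)) =
      compoundPoisson r (cavityFieldLaw β μ α') := poissonMarks_map r (cavityMark β μ α') hm
  have hs := measurable_sum_marks hm
  have hc : cavityLogCosh β = fun d : ℕ × (ℕ → ℝ × ℝ) =>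
      Real.log (Real.cosh (∑ i ∈ Finset.range d.1, β * cavityCoupling β (d.2 i))) := by
    ext d; rw [cavityLogCosh, Finset.mul_sum]
  rw [← e, integrable_map_measure hlc.aestronglyMeasurable hs.aemeasurable] at h2
  refine ⟨by rw [hc]; exact h2, h1, ?_⟩
  rw [← e, integral_map hs.aemeasurable hlc.aestronglyMeasurable, hc]

/-- The ratios of hyperbolic cosines do not depend on the spins and factor out; what is left is a
system of free spins in local fields. -/
theorem log_partitionFn_cavityHam (hβ : 0 < β) (m : ℕ) (x : ℕ → (ℝ × ℝ) × Fin N) :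
    Real.log (partitionFn β (cavityHam β m x)) =
      ∑ ν ∈ Finset.range m, (Real.log (Real.cosh (β * (x ν).1.1)) -
        Real.log (Real.cosh (β * cavityCoupling β (x ν).1))) +
      (N * Real.log 2 + ∑ k, Real.log (Real.cosh (∑ ν ∈ Finset.range m,
        if (x ν).2 = k then β * cavityCoupling β (x ν).1 else 0))) := by
  rw [← sum_exp_site_field m fun ν => (β * cavityCoupling β (x ν).1, (x ν).2)]
  have h1 : partitionFn β (cavityHam β m x) =
      Real.exp (∑ ν ∈ Finset.range m, (Real.log (Real.cosh (β * (x ν).1.1)) -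
        Real.log (Real.cosh (β * cavityCoupling β (x ν).1)))) *
      ∑ σ : Config N, Real.exp (∑ ν ∈ Finset.range m,
        β * cavityCoupling β (x ν).1 * spin σ (x ν).2) := by
    rw [Finset.mul_sum, partitionFn]
    refine Finset.sum_congr rfl fun σ _ => ?_
    rw [← Real.exp_add, ← Finset.sum_add_distrib, cavityHam, neg_mul_neg, Finset.mul_sum]
    congr 1
    refine Finset.sum_congr rfl fun ν _ => ?_
    rw [Real.log_div (Real.cosh_pos _).ne' (Real.cosh_pos _).ne']
    field_simp
  rw [h1, Real.log_mul (Real.exp_pos _).ne' (sum_exp_pos _).ne', Real.log_exp]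

/-- Wald's identity handles the prefactors, and thinning gives every site a field made of a Poisson
number of mean `2α` of cavity couplings. Both parts are proportional to `N`. -/
theorem integral_log_partitionFn_cavityHam (hβ : 0 < β)
    (hκ : ∀ᵐ w ∂(auxLaw β μ α' : Measure ℝ), |w| ≤ 1) (hint : Integrable (fun J : ℝ => J) μ)
    (α : ℝ≥0) :
    Integrable (fun d => Real.log (partitionFn β (cavityHam β d.1 d.2)))
      (cavityDisorder β μ α' α N) ∧
    ∫ d, Real.log (partitionFn β (cavityHam β d.1 d.2)) ∂cavityDisorder β μ α' α N =
      2 * α * N * (energy β μ 1 - ∫ w, energy β μ w ∂(auxLaw β μ α' : Measure ℝ)) +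
        (N * Real.log 2 + N * ∫ d, cavityLogCosh β d ∂poissonMarks (2 * α) (cavityMark β μ α')) := by
  have hcm := measurable_cavityCoupling (β := β)
  have i1 : Integrable (fun p : ℝ × ℝ => Real.log (Real.cosh (β * p.1))) (cavityMark β μ α') :=
    (log_cosh_coupling (β := β) hint).comp_fst (auxLaw β μ α' : Measure ℝ)
  have v1 : ∫ p : ℝ × ℝ, Real.log (Real.cosh (β * p.1)) ∂cavityMark β μ α' = energy β μ 1 := by
    rw [energy_one, cavityMark, integral_fun_fst (fun J : ℝ => Real.log (Real.cosh (β * J)))]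
    simp
  have h2 := log_cosh_cavityCoupling hβ hκ hint
  have hw := wald (2 * α * N) ((cavityMark β μ α').prod (uniformSite N))
    (h := fun p => Real.log (Real.cosh (β * p.1.1)) - Real.log (Real.cosh (β * cavityCoupling β p.1)))
    (by fun_prop) ((i1.sub h2.1).comp_fst _)
  have v2 : ∫ p, (Real.log (Real.cosh (β * p.1.1)) - Real.log (Real.cosh (β * cavityCoupling β p.1)))
      ∂(cavityMark β μ α').prod (uniformSite N) =
      energy β μ 1 - ∫ w, energy β μ w ∂(auxLaw β μ α' : Measure ℝ) := by
    rw [integral_fun_fst (fun p : ℝ × ℝ => Real.log (Real.cosh (β * p.1)) -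
      Real.log (Real.cosh (β * cavityCoupling β p))), integral_sub i1 h2.1, v1, h2.2]
    simp
  rw [v2] at hw
  have h3 := integral_cavityLogCosh hβ hκ hint (2 * α)
  have hm : Measurable fun p => β * cavityCoupling β p := hcm.const_mul β
  have hp : IsProbabilityMeasure ((cavityMark β μ α').map fun p => β * cavityCoupling β p) :=
    Measure.isProbabilityMeasure_map hm.aemeasurable
  have hlc : Measurable fun x : ℝ => Real.log (Real.cosh x) := by fun_prop
  have hk : ∀ k : Fin N, Integrable (fun d : ℕ × (ℕ → (ℝ × ℝ) × Fin N) =>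
      Real.log (Real.cosh (∑ ν ∈ Finset.range d.1,
        if (d.2 ν).2 = k then β * cavityCoupling β (d.2 ν).1 else 0))) (cavityDisorder β μ α' α N) ∧
      ∫ d, Real.log (Real.cosh (∑ ν ∈ Finset.range d.1,
        if (d.2 ν).2 = k then β * cavityCoupling β (d.2 ν).1 else 0)) ∂cavityDisorder β μ α' α N =
      ∫ d, cavityLogCosh β d ∂poissonMarks (2 * α) (cavityMark β μ α') := by
    intro k
    have hs := measurable_sum_marks (measurable_ite_site hm k)
    have e : (cavityDisorder β μ α' α N).map (fun d => ∑ ν ∈ Finset.range d.1,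
        if (d.2 ν).2 = k then β * cavityCoupling β (d.2 ν).1 else 0) =
        compoundPoisson (2 * α) (cavityFieldLaw β μ α') :=
      compoundPoisson_thinning (2 * α) hm k
    have h4 := h3.2.1
    rw [← e, integrable_map_measure hlc.aestronglyMeasurable hs.aemeasurable] at h4
    refine ⟨h4, ?_⟩
    rw [h3.2.2, ← e]
    exact (integral_map hs.aemeasurable hlc.aestronglyMeasurable).symm
  have i3 : Integrable (fun d : ℕ × (ℕ → (ℝ × ℝ) × Fin N) => ∑ k : Fin N,
      Real.log (Real.cosh (∑ ν ∈ Finset.range d.1,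
        if (d.2 ν).2 = k then β * cavityCoupling β (d.2 ν).1 else 0))) (cavityDisorder β μ α' α N) :=
    integrable_finsetSum _ fun k _ => (hk k).1
  have hpd : IsProbabilityMeasure (cavityDisorder β μ α' α N) := by
    unfold cavityDisorder; infer_instance
  have i4 : Integrable (fun d : ℕ × (ℕ → (ℝ × ℝ) × Fin N) => (N : ℝ) * Real.log 2 + ∑ k : Fin N,
      Real.log (Real.cosh (∑ ν ∈ Finset.range d.1,
        if (d.2 ν).2 = k then β * cavityCoupling β (d.2 ν).1 else 0))) (cavityDisorder β μ α' α N) :=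
    (integrable_const _).add i3
  have hw1 : Integrable (fun d : ℕ × (ℕ → (ℝ × ℝ) × Fin N) => ∑ i ∈ Finset.range d.1,
      (Real.log (Real.cosh (β * (d.2 i).1.1)) -
        Real.log (Real.cosh (β * cavityCoupling β (d.2 i).1)))) (cavityDisorder β μ α' α N) := hw.1
  simp_rw [log_partitionFn_cavityHam hβ]
  refine ⟨hw1.add i4, ?_⟩
  rw [integral_add hw1 i4, integral_add (integrable_const _) i3,
    integral_finsetSum _ fun k _ => (hk k).1]
  simp_rw [fun k => (hk k).2]
  have hw2 := hw.2
  change ∫ d, _ ∂cavityDisorder β μ α' α N = _ at hw2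
  rw [hw2]
  simp

/-- The logarithm of the ratio splits, so the two disorders enter only through their separate means,
both proportional to `N`. The difference form in the middle is the one needed for the bound. -/
theorem trialG_eq_GRS (hβ : 0 < β) (hκ : ∀ᵐ w ∂(auxLaw β μ α' : Measure ℝ), |w| ≤ 1)
    (hsymm : μ.map (fun J : ℝ => -J) = μ) (hint : Integrable (fun J : ℝ => J) μ) (N : ℕ)
    [NeZero N] (α : ℝ≥0) :
    Integrable (fun d => trialLog β d)
      ((cavityDisorder β μ α' α N).prod (internalDisorder β μ α' α N)) ∧
    (1 / (N : ℝ)) * (∫ d, Real.log (partitionFn β (cavityHam β d.1 d.2)) ∂cavityDisorder β μ α' α N -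
      ∫ d, Real.log (Real.exp (-β * internalHam β d.1 d.2)) ∂internalDisorder β μ α' α N) =
      GRS β α μ α' ∧
    trialG β α μ α' N = GRS β α μ α' := by
  have h1 := integral_log_partitionFn_cavityHam (N := N) hβ hκ hint α
  have h2 := integral_log_exp_internalHam hβ hκ hsymm hint N α
  have hp1 : IsProbabilityMeasure (cavityDisorder β μ α' α N) := by
    unfold cavityDisorder; infer_instance
  have hp2 : IsProbabilityMeasure (internalDisorder β μ α' α N) := by
    unfold internalDisorder; infer_instance
  have e : (fun d : (ℕ × (ℕ → (ℝ × ℝ) × Fin N)) × (ℕ × (ℕ → ℝ × ℝ × ℝ)) => trialLog β d) =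
      fun d => Real.log (partitionFn β (cavityHam β d.1.1 d.1.2)) -
        Real.log (Real.exp (-β * internalHam β d.2.1 d.2.2)) := by
    ext d
    have hZ : partitionFn β (cavityHam β d.1.1 d.1.2) ≠ 0 := (sum_exp_pos _).ne'
    rw [trialLog, Real.log_div hZ (Real.exp_pos _).ne']
  have i1 := h1.1.comp_fst (internalDisorder β μ α' α N)
  have i2 := h2.1.comp_snd (cavityDisorder β μ α' α N)
  have hG : (1 / (N : ℝ)) * (∫ d, Real.log (partitionFn β (cavityHam β d.1 d.2))
        ∂cavityDisorder β μ α' α N -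
      ∫ d, Real.log (Real.exp (-β * internalHam β d.1 d.2)) ∂internalDisorder β μ α' α N) =
      GRS β α μ α' := by
    have hN : (N : ℝ) ≠ 0 := by exact_mod_cast NeZero.ne N
    rw [h1.2, h2.2, GRS, (log_cosh_cavityCoupling hβ hκ hint).2,
      (log_cosh_internalCoupling hβ hκ hint).2, ← energy_one]
    field_simp
    ring
  refine ⟨by rw [e]; exact i1.sub i2, hG, ?_⟩
  rw [← hG, trialG, e, integral_sub i1 i2,
    integral_fun_fst (fun d : ℕ × (ℕ → (ℝ × ℝ) × Fin N) =>
      Real.log (partitionFn β (cavityHam β d.1 d.2))),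
    integral_fun_snd (fun d : ℕ × (ℕ → ℝ × ℝ × ℝ) =>
      Real.log (Real.exp (-β * internalHam β d.1 d.2)))]
  simp

/-- The three `log cosh` expectations are energy series with moments `1`, `q` and `q ^ 2`; their
combination has coefficient `1 - 2q + q ^ 2`. -/
theorem GRS_eq_FRS (hβ : 0 < β) (hκ : ∀ᵐ w ∂(auxLaw β μ α' : Measure ℝ), |w| ≤ 1)
    (hq : ∀ n : ℕ, auxOverlap β μ (2 * n) α' = ∫ w, w ^ (2 * n) ∂(auxLaw β μ α' : Measure ℝ))
    (hint : Integrable (fun J : ℝ => J) μ) (α : ℝ≥0) :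
    Summable (rsTerm β μ α') ∧ GRS β α μ α' = FRS β α μ α' := by
  have hs := ((hasSum_energyCoeff (β := β) hint).sub
    ((hasSum_energy_auxLaw hκ hq hint).mul_left 2)).add (hasSum_energy_auxLaw_prod hκ hq hint)
  have e : (fun n => energyCoeff β μ n -
      2 * (energyCoeff β μ n * auxOverlap β μ (2 * (n + 1)) α') +
      energyCoeff β μ n * auxOverlap β μ (2 * (n + 1)) α' ^ 2) = rsTerm β μ α' := by
    ext n
    simp only [rsTerm, energyCoeff]
    ring
  rw [e] at hs
  refine ⟨hs.summable, ?_⟩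
  rw [GRS, FRS, hs.tsum_eq, (log_cosh_cavityCoupling hβ hκ hint).2,
    (log_cosh_internalCoupling hβ hκ hint).2, ← energy_one]
  ring

end Fields

/-! ### The replica symmetric bound -/

section Bound

variable {N : ℕ} [NeZero N] {β : ℝ} {μ : Measure ℝ} [IsProbabilityMeasure μ] {α' : ℝ≥0∞}

/-- Besides the explicit value, the comparison needs the same mean as an integral over the space of
log-weights, where cavity bonds compete with the other bonds. -/
theorem integral_log_partitionFn_cavityHam_eq (hβ : 0 < β)
    (hκ : ∀ᵐ w ∂(auxLaw β μ α' : Measure ℝ), |w| ≤ 1) (hint : Integrable (fun J : ℝ => J) μ)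
    (α : ℝ≥0) :
    ∫ d, Real.log (partitionFn β (cavityHam β d.1 d.2)) ∂cavityDisorder β μ α' α N =
      ∫ v, logSumExp v ∂compoundPoisson (2 * α * N)
        (fieldBondLaw β μ (auxLaw β μ α' : Measure ℝ) N) := by
  have hm : Measurable fun p : (ℝ × ℝ) × Fin N => fun σ : Config N =>
      bondLog (β * p.1.1) (fieldSpin (p.1.2, p.2) σ) :=
    measurable_pi_lambda _ fun σ => measurable_fieldBond σ
  have hlaw : ((cavityMark β μ α').prod (uniformSite N)).map (fun p => fun σ : Config N =>
      bondLog (β * p.1.1) (fieldSpin (p.1.2, p.2) σ)) =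
      fieldBondLaw β μ (auxLaw β μ α' : Measure ℝ) N := by
    have hp := measurePreserving_fieldMarks (N := N) (β := β) (μ := μ) (α' := α')
    rw [fieldBondLaw, bondLaw, ← hp.map_eq,
      Measure.map_map (measurable_bondVector β measurable_fieldSpin) hp.measurable]
    rfl
  have hP : IsProbabilityMeasure (((cavityMark β μ α').prod (uniformSite N)).map
      (fun p => fun σ : Config N => bondLog (β * p.1.1) (fieldSpin (p.1.2, p.2) σ))) :=
    Measure.isProbabilityMeasure_map hm.aemeasurable
  have hi : Integrable (fun v => v) (((cavityMark β μ α').prod (uniformSite N)).map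
      (fun p => fun σ : Config N => bondLog (β * p.1.1) (fieldSpin (p.1.2, p.2) σ))) := by
    rw [hlaw]
    exact integrable_bondLaw measurable_fieldSpin (ae_fieldSpin hκ) hint
  have h := (integral_logSumExp_poissonMarks (2 * α * N) hm hi).2
  simp only [hlaw] at h
  rw [← h]
  have hm : ∀ᵐ s ∂(cavityMark β μ α').prod (uniformSite N), |s.1.2| ≤ 1 :=
    Measure.quasiMeasurePreserving_fst.ae (ae_cavityMark hκ)
  refine integral_congr_ae ?_
  filter_upwards [ae_poissonMarks (2 * α * N) hm] with d hd
  unfold partitionFn logSumExp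
  simp_rw [neg_mul_cavityHam hβ d.1 hd, Finset.sum_apply]

/-- An internal bond vector is constant in the configuration, so it merely translates `logSumExp`.
-/
theorem integral_logSumExp_conv_internalBondLaw (hβ : 0 < β)
    (hκ : ∀ᵐ w ∂(auxLaw β μ α' : Measure ℝ), |w| ≤ 1)
    (hsymm : μ.map (fun J : ℝ => -J) = μ) (hint : Integrable (fun J : ℝ => J) μ) (α : ℝ≥0)
    (ν : Measure (Config N → ℝ)) [IsProbabilityMeasure ν] (hν : Integrable (fun v => v) ν) :
    ∫ v, logSumExp v ∂(ν ∗ compoundPoisson (α * N)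
        (internalBondLaw β μ (auxLaw β μ α' : Measure ℝ) N)) =
      ∫ v, logSumExp v ∂ν +
        ∫ d, Real.log (Real.exp (-β * internalHam β d.1 d.2)) ∂internalDisorder β μ α' α N := by
  set κ : Measure ℝ := (auxLaw β μ α' : Measure ℝ)
  have hF := measurable_logSumExp (C := Config N)
  have hm : Measurable fun p : ℝ × ℝ × ℝ => fun σ : Config N =>
      bondLog (β * p.1) (internalSpin p.2 σ) := measurable_bondVector β measurable_internalSpin
  have hP : IsProbabilityMeasure ((internalMark β μ α').map
      fun p : ℝ × ℝ × ℝ => fun σ : Config N => bondLog (β * p.1) (internalSpin p.2 σ)) :=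
    Measure.isProbabilityMeasure_map hm.aemeasurable
  have hcp : (poissonMarks (α * N) (internalMark β μ α')).map (fun d => ∑ i ∈ Finset.range d.1,
      fun σ : Config N => bondLog (β * (d.2 i).1) (internalSpin (d.2 i).2 σ)) =
      compoundPoisson (α * N) (internalBondLaw β μ κ N) :=
    poissonMarks_map (α * N) (internalMark β μ α') hm
  have hs := measurable_sum_marks hm
  have hint2 : Integrable (fun v => v) (internalBondLaw β μ κ N) :=
    integrable_bondLaw measurable_internalSpin (ae_internalSpin hκ) hint
  have hicp := integrable_compoundPoisson (α * N) _ hint2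
  have hic : Integrable (fun v => v) (ν ∗ compoundPoisson (α * N) (internalBondLaw β μ κ N)) := by
    rw [Measure.conv, integrable_map_measure (by fun_prop) (by fun_prop)]
    exact (hν.comp_fst _).add (hicp.comp_snd ν)
  have hi : Integrable logSumExp (ν ∗ compoundPoisson (α * N) (internalBondLaw β μ κ N)) := by
    simpa using integrable_of_abs_le_add_norm hic hF abs_logSumExp_le 0
  have hiν : Integrable logSumExp ν := by
    simpa using integrable_of_abs_le_add_norm hν hF abs_logSumExp_le 0
  rw [integral_conv hi]
  have hw := wald (α * N) _ (measurable_internalBond (β := β)) (integral_internalBond hκ hsymm hint).1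
  have hae := ae_poissonMarks (α * N) (ae_internalMark hκ)
  have e : ∫ d, Real.log (Real.exp (-β * internalHam β d.1 d.2)) ∂internalDisorder β μ α' α N =
      ∫ d, ∑ ν ∈ Finset.range d.1, bondLog (β * (d.2 ν).1) ((d.2 ν).2.1 * (d.2 ν).2.2)
        ∂poissonMarks (α * N) (internalMark β μ α') := by
    refine integral_congr_ae ?_
    filter_upwards [hae] with d hd
    rw [Real.log_exp, neg_mul_internalHam hβ d.1 hd]
  have hin : ∀ v, ∫ u, logSumExp (v + u) ∂compoundPoisson (α * N) (internalBondLaw β μ κ N) =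
      logSumExp v +
        ∫ d, Real.log (Real.exp (-β * internalHam β d.1 d.2)) ∂internalDisorder β μ α' α N := by
    intro v
    have hmap := integral_map (μ := poissonMarks (α * N) (internalMark β μ α'))
      (f := fun u => logSumExp (v + u)) hs.aemeasurable
      (hF.comp (measurable_const_add v)).aestronglyMeasurable
    rw [← hcp, hmap, e]
    have hpt : ∀ d : ℕ × (ℕ → ℝ × ℝ × ℝ), logSumExp (v + ∑ i ∈ Finset.range d.1,
        fun σ : Config N => bondLog (β * (d.2 i).1) (internalSpin (d.2 i).2 σ)) =
        logSumExp v + ∑ ν ∈ Finset.range d.1, bondLog (β * (d.2 ν).1) ((d.2 ν).2.1 * (d.2 ν).2.2) := by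
      intro d
      rw [← logSumExp_add_const]
      congr 1
      ext σ
      simp [internalSpin]
    simp_rw [hpt]
    rw [integral_add (integrable_const _) hw.1]
    simp
  simp_rw [hin]
  rw [integral_add hiν (integrable_const _)]
  simp

/-- Both sides are compound Poisson of rate `2αN`: an even mixture of two-body and internal bonds on
the left, cavity bonds on the right. Each exchange of a bond is favourable by `bond_increment_le`.
-/
theorem vianaBray_add_internal_le_cavity (hβ : 0 < β)
    (hκ : ∀ᵐ w ∂(auxLaw β μ α' : Measure ℝ), |w| ≤ 1)
    (hsymm : μ.map (fun J : ℝ => -J) = μ) (hint : Integrable (fun J : ℝ => J) μ) (α : ℝ≥0) :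
    ∫ d, Real.log (partitionFn β (vianaBrayHam d.1 d.2)) ∂vianaBrayDisorder α μ N +
      ∫ d, Real.log (Real.exp (-β * internalHam β d.1 d.2)) ∂internalDisorder β μ α' α N ≤
    ∫ d, Real.log (partitionFn β (cavityHam β d.1 d.2)) ∂cavityDisorder β μ α' α N := by
  set κ : Measure ℝ := (auxLaw β μ α' : Measure ℝ)
  have hpq : (1 / 2 : ℝ≥0) + 1 / 2 = 1 := by rw [← NNReal.coe_inj]; push_cast; norm_num
  have hr : (2 * α * N) * (1 / 2 : ℝ≥0) = α * N := by
    rw [← NNReal.coe_inj]; push_cast; ring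
  have hmix := isProbabilityMeasure_mixture hpq (pairBondLaw β μ N) (internalBondLaw β μ κ N)
  have i1 : Integrable (fun v => v) (pairBondLaw β μ N) := integrable_pairBondLaw hint
  have i2 : Integrable (fun v => v) (internalBondLaw β μ κ N) :=
    integrable_bondLaw measurable_internalSpin (ae_internalSpin hκ) hint
  have i3 : Integrable (fun v => v) (fieldBondLaw β μ κ N) :=
    integrable_bondLaw measurable_fieldSpin (ae_fieldSpin hκ) hint
  have hF := measurable_logSumExp (C := Config N)
  rw [(integral_log_partitionFn_vianaBray α hint).2,
    integral_log_partitionFn_cavityHam_eq hβ hκ hint α,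
    ← integral_logSumExp_conv_internalBondLaw hβ hκ hsymm hint α _
      (integrable_compoundPoisson _ _ i1)]
  have hc := compoundPoisson_mixture (2 * α * N) hpq (pairBondLaw β μ N) (internalBondLaw β μ κ N)
  rw [hr] at hc
  rw [hc]
  refine compoundPoisson_comparison _ _ _ (integral_mixture _ _ i1 i2).1 i3 hF abs_logSumExp_le
    fun v => ?_
  rw [(integral_mixture (1 / 2) (1 / 2) (integrable_of_abs_le_add_norm i1 hF abs_logSumExp_le v)
    (integrable_of_abs_le_add_norm i2 hF abs_logSumExp_le v)).2, pairBondLaw, internalBondLaw,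
    fieldBondLaw, integral_logSumExp_bondLaw measurable_pairSpin
      (Eventually.of_forall fun p σ => abs_pairSpin_le p σ) hsymm hint,
    integral_logSumExp_bondLaw measurable_internalSpin (ae_internalSpin hκ) hsymm hint,
    integral_logSumExp_bondLaw measurable_fieldSpin (ae_fieldSpin hκ) hsymm hint]
  have h := bond_increment_le (β := β) hκ hint v
  simp only [smul_eq_mul]
  push_cast
  linarith

/-- The finite volume replica symmetric bound. -/
theorem vianaBray_le_GRS (hβ : 0 < β) (hκ : ∀ᵐ w ∂(auxLaw β μ α' : Measure ℝ), |w| ≤ 1)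
    (hsymm : μ.map (fun J : ℝ => -J) = μ) (hint : Integrable (fun J : ℝ => J) μ) (N : ℕ) [NeZero N]
    (α : ℝ≥0) :
    (1 / (N : ℝ)) * ∫ d, Real.log (partitionFn β (vianaBrayHam d.1 d.2)) ∂vianaBrayDisorder α μ N ≤
      GRS β α μ α' := by
  have h := vianaBray_add_internal_le_cavity (N := N) hβ hκ hsymm hint α
  rw [← (trialG_eq_GRS hβ hκ hsymm hint N α).2.1]
  exact mul_le_mul_of_nonneg_left (by linarith) (by positivity)

end Bound

/-! ### Superadditivity -/

section Superadditivity

theorem compoundPoisson_map {E F : Type} [NormedAddCommGroup E] [NormedSpace ℝ E]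
    [MeasurableSpace E] [BorelSpace E] [SecondCountableTopology E] [NormedAddCommGroup F]
    [NormedSpace ℝ F] [MeasurableSpace F] [BorelSpace F] [SecondCountableTopology F] (r : ℝ≥0)
    (ν : Measure E) [IsProbabilityMeasure ν] (φ : E →+ F) (hφ : Measurable φ)
    [IsProbabilityMeasure (ν.map φ)] :
    compoundPoisson r (ν.map φ) = (compoundPoisson r ν).map φ := by
  have hs : Measurable fun d : ℕ × (ℕ → E) => ∑ i ∈ Finset.range d.1, d.2 i :=
    measurable_sum_marks measurable_id
  have e : (compoundPoisson r ν).map φ = (poissonMarks r ν).map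
      (φ ∘ fun d : ℕ × (ℕ → E) => ∑ i ∈ Finset.range d.1, d.2 i) := Measure.map_map hφ hs
  rw [e, ← poissonMarks_map r ν hφ]
  congr 1
  ext d
  simp

variable {A B : ℕ} [NeZero A] [NeZero B] {β : ℝ} {μ : Measure ℝ} [IsProbabilityMeasure μ]

/-- Restriction of a configuration along a map of sites. -/
def restrictConfig {A N : ℕ} (e : Fin A → Fin N) (σ : Config N) : Config A := fun i => σ (e i)

/-- Pull-back of log-weights along the restriction of configurations. -/
def pullback {A N : ℕ} (e : Fin A → Fin N) : (Config A → ℝ) →+ (Config N → ℝ) where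
  toFun v σ := v (restrictConfig e σ)
  map_zero' := rfl
  map_add' _ _ := rfl

theorem measurable_pullback {A N : ℕ} (e : Fin A → Fin N) : Measurable (pullback e) :=
  measurable_pi_lambda _ fun σ => measurable_pi_apply (restrictConfig e σ)

/-- Two-body bonds inside the image of a block of sites. -/
def blockBondLaw {A N : ℕ} [NeZero A] (β : ℝ) (μ : Measure ℝ) (e : Fin A → Fin N) :
    Measure (Config N → ℝ) :=
  bondLaw β μ ((uniformSite A).prod (uniformSite A)) fun p σ => pairSpin p (restrictConfig e σ)

instance {N : ℕ} (e : Fin A → Fin N) : IsProbabilityMeasure (blockBondLaw β μ e) :=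
  isProbabilityMeasure_bondLaw (measurable_of_finite _)

theorem map_pullback_pairBondLaw {N : ℕ} (e : Fin A → Fin N) :
    (pairBondLaw β μ A).map (pullback e) = blockBondLaw β μ e := by
  rw [pairBondLaw, blockBondLaw, bondLaw, bondLaw,
    Measure.map_map (measurable_pullback e) (measurable_bondVector β measurable_pairSpin)]
  rfl

/-- A configuration on the union is a pair of configurations on the blocks, and weights that split
along the blocks give a product of partition functions. -/
theorem logSumExp_blocks (v : Config A → ℝ) (w : Config B → ℝ) :
    logSumExp (pullback (Fin.castAdd B) v + pullback (Fin.natAdd A) w) =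
      logSumExp v + logSumExp w := by
  rw [logSumExp, logSumExp, logSumExp, ← Real.log_mul (sum_exp_pos v).ne' (sum_exp_pos w).ne',
    Finset.sum_mul_sum, ← Fintype.sum_prod_type', ← (Fin.appendEquiv A B).sum_comp]
  congr 1
  refine Finset.sum_congr rfl fun p _ => ?_
  rw [← Real.exp_add]
  have h1 : restrictConfig (Fin.castAdd B) (Fin.appendEquiv A B p) = p.1 := by
    ext i; simp [restrictConfig, Fin.appendEquiv]
  have h2 : restrictConfig (Fin.natAdd A) (Fin.appendEquiv A B p) = p.2 := by
    ext i; simp [restrictConfig, Fin.appendEquiv]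
  simp [pullback, h1, h2]

/-- The overlap of the whole system is the convex combination of the block overlaps with weights
proportional to the sizes, so this is convexity of the square under the replica average. -/
theorem block_increment_le [NeZero (A + B)] (hint : Integrable (fun J : ℝ => J) μ)
    (v : Config (A + B) → ℝ) :
    ∫ p, energy β μ (weightedMean v (pairSpin p)) ∂(uniformSite (A + B)).prod (uniformSite (A + B)) ≤
      (A / (A + B) : ℝ) * ∫ p, energy β μ (weightedMean v fun σ =>
        pairSpin p (restrictConfig (Fin.castAdd B) σ)) ∂(uniformSite A).prod (uniformSite A) +
      (B / (A + B) : ℝ) * ∫ p, energy β μ (weightedMean v fun σ =>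
        pairSpin p (restrictConfig (Fin.natAdd A) σ)) ∂(uniformSite B).prod (uniformSite B) := by
  have hA : (0 : ℝ) < A := by exact_mod_cast Nat.pos_of_ne_zero (NeZero.ne A)
  have hB : (0 : ℝ) < B := by exact_mod_cast Nat.pos_of_ne_zero (NeZero.ne B)
  have hps : ∀ {M : ℕ} (p : Fin M × Fin M), pairSpin p = fun σ => spin σ p.1 * spin σ p.2 :=
    fun _ => rfl
  have s0 := hasSum_integral_energy (β := β)
    (ρ := (uniformSite (A + B)).prod (uniformSite (A + B)))
    (X := fun p => weightedMean v (pairSpin p)) (measurable_of_finite _)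
    (Eventually.of_forall fun p => abs_weightedMean_le fun σ => abs_pairSpin_le p σ) hint
  have s1 := hasSum_integral_energy (β := β) (ρ := (uniformSite A).prod (uniformSite A))
    (X := fun p => weightedMean v fun σ => pairSpin p (restrictConfig (Fin.castAdd B) σ))
    (measurable_of_finite _)
    (Eventually.of_forall fun p => abs_weightedMean_le fun σ => abs_pairSpin_le p _) hint
  have s2 := hasSum_integral_energy (β := β) (ρ := (uniformSite B).prod (uniformSite B))
    (X := fun p => weightedMean v fun σ => pairSpin p (restrictConfig (Fin.natAdd A) σ))
    (measurable_of_finite _)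
    (Eventually.of_forall fun p => abs_weightedMean_le fun σ => abs_pairSpin_le p _) hint
  refine hasSum_le (fun n => ?_) s0 ((s1.mul_left _).add (s2.mul_left _))
  set k := 2 * (n + 1)
  have e : ∀ (M : ℕ) [NeZero M] (f : Fin M × Fin M → ℝ),
      ∫ p, f p ∂(uniformSite M).prod (uniformSite M) =
        (1 / (M : ℝ)) * (1 / (M : ℝ)) * ∑ i, ∑ j, f (i, j) := by
    intro M _ f
    rw [integral_prod_uniformSite Integrable.of_finite]
    simp_rw [integral_uniformSite, smul_eq_mul, ← Finset.mul_sum]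
    rw [Finset.sum_comm, mul_assoc]
  rw [e, e, e]
  -- Weights `1 / A` and `-1 / B` on the two blocks give the replica average of the squared
  -- difference of the block overlaps.
  have hpos := sum_mul_sum_weightedMean_pow_nonneg v
    (fun (i : Fin (A + B)) σ => spin σ i)
    (fun i => Fin.append (fun _ : Fin A => 1 / (A : ℝ)) (fun _ : Fin B => -(1 / (B : ℝ))) i) k
  simp only [Fin.sum_univ_add, Fin.append_left, Fin.append_right, Finset.sum_add_distrib,
    ← Finset.mul_sum] at hpos
  simp only [Fin.sum_univ_add, Finset.sum_add_distrib]
  simp only [hps]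
  change _ ≤ (A / (A + B) : ℝ) * (energyCoeff β μ n * (_ * ∑ i : Fin A, ∑ j : Fin A,
    weightedMean v (fun σ => spin σ (Fin.castAdd B i) * spin σ (Fin.castAdd B j)) ^ k)) +
    (B / (A + B) : ℝ) * (energyCoeff β μ n * (_ * ∑ i : Fin B, ∑ j : Fin B,
    weightedMean v (fun σ => spin σ (Fin.natAdd A i) * spin σ (Fin.natAdd A j)) ^ k))
  set X := ∑ i : Fin A, ∑ j : Fin A,
    weightedMean v (fun σ => spin σ (Fin.castAdd B i) * spin σ (Fin.castAdd B j)) ^ k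
  set Y := ∑ i : Fin B, ∑ j : Fin B,
    weightedMean v (fun σ => spin σ (Fin.natAdd A i) * spin σ (Fin.natAdd A j)) ^ k
  set Z := ∑ i : Fin A, ∑ j : Fin B,
    weightedMean v (fun σ => spin σ (Fin.castAdd B i) * spin σ (Fin.natAdd A j)) ^ k
  set W := ∑ i : Fin B, ∑ j : Fin A,
    weightedMean v (fun σ => spin σ (Fin.natAdd A i) * spin σ (Fin.castAdd B j)) ^ k
  have hc := energyCoeff_nonneg (β := β) (μ := μ) n
  -- This is the defect of convexity: the weighted mean of `x ^ 2` and `y ^ 2` exceeds the square of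
  -- the weighted mean of `x` and `y` by `A * B / (A + B) ^ 2 * (x - y) ^ 2`.
  have hab : (0 : ℝ) ≤ A * B / (A + B) ^ 2 := by positivity
  have key := mul_nonneg hc (mul_nonneg hab hpos)
  rw [← sub_nonneg]
  refine key.trans (le_of_eq ?_)
  push_cast
  field_simp
  ring

/-- The mean log-partition function of the Viana-Bray model is superadditive. -/
theorem integral_log_partitionFn_superadditive [NeZero (A + B)]
    (hsymm : μ.map (fun J : ℝ => -J) = μ) (hint : Integrable (fun J : ℝ => J) μ) (α : ℝ≥0) :
    ∫ d, Real.log (partitionFn β (vianaBrayHam d.1 d.2)) ∂vianaBrayDisorder α μ A +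
      ∫ d, Real.log (partitionFn β (vianaBrayHam d.1 d.2)) ∂vianaBrayDisorder α μ B ≤
    ∫ d, Real.log (partitionFn β (vianaBrayHam d.1 d.2)) ∂vianaBrayDisorder α μ (A + B) := by
  have hAB : (A : ℝ≥0) + B ≠ 0 := by
    have h : ((A + B : ℕ) : ℝ≥0) ≠ 0 := by exact_mod_cast NeZero.ne (A + B)
    rwa [Nat.cast_add] at h
  have hpq : (A / (A + B) : ℝ≥0) + B / (A + B) = 1 := by rw [← add_div, div_self hAB]
  set ν₁ := blockBondLaw β μ (Fin.castAdd B : Fin A → Fin (A + B)) with hν₁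
  set ν₂ := blockBondLaw β μ (Fin.natAdd A : Fin B → Fin (A + B)) with hν₂
  have hmix := isProbabilityMeasure_mixture hpq ν₁ ν₂
  have i0 : Integrable (fun v => v) (pairBondLaw β μ (A + B)) := integrable_pairBondLaw hint
  have iA : Integrable (fun v => v) (pairBondLaw β μ A) := integrable_pairBondLaw hint
  have iB : Integrable (fun v => v) (pairBondLaw β μ B) := integrable_pairBondLaw hint
  have i1 : Integrable (fun v => v) ν₁ := integrable_bondLaw (measurable_of_finite _)
    (Eventually.of_forall fun p σ => abs_pairSpin_le p _) hint
  have i2 : Integrable (fun v => v) ν₂ := integrable_bondLaw (measurable_of_finite _)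
    (Eventually.of_forall fun p σ => abs_pairSpin_le p _) hint
  have hF := measurable_logSumExp (C := Config (A + B))
  rw [(integral_log_partitionFn_vianaBray α hint).2, (integral_log_partitionFn_vianaBray α hint).2,
    (integral_log_partitionFn_vianaBray α hint).2]
  -- The block bonds, of rates `αA` and `αB`, merge into a single sum of rate `α(A + B)`, the rate
  -- of the full system.
  have hc := compoundPoisson_mixture (α * (A + B : ℕ)) hpq ν₁ ν₂
  have hr1 : α * (A + B : ℕ) * (A / (A + B) : ℝ≥0) = α * A := by
    push_cast; rw [mul_assoc, mul_div_cancel₀ _ hAB]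
  have hr2 : α * (A + B : ℕ) * (B / (A + B) : ℝ≥0) = α * B := by
    push_cast; rw [mul_assoc, mul_div_cancel₀ _ hAB]
  rw [hr1, hr2] at hc
  have hle : ∫ v, logSumExp v ∂compoundPoisson (α * (A + B : ℕ))
      ((A / (A + B) : ℝ≥0) • ν₁ + (B / (A + B) : ℝ≥0) • ν₂) ≤
      ∫ v, logSumExp v ∂compoundPoisson (α * (A + B : ℕ)) (pairBondLaw β μ (A + B)) := by
    refine compoundPoisson_comparison _ _ _ (integral_mixture _ _ i1 i2).1 i0 hF abs_logSumExp_le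
      fun v => ?_
    rw [(integral_mixture _ _ (integrable_of_abs_le_add_norm i1 hF abs_logSumExp_le v)
      (integrable_of_abs_le_add_norm i2 hF abs_logSumExp_le v)).2, hν₁, hν₂, blockBondLaw,
      blockBondLaw, pairBondLaw, integral_logSumExp_bondLaw (measurable_of_finite _)
        (Eventually.of_forall fun p σ => abs_pairSpin_le p _) hsymm hint,
      integral_logSumExp_bondLaw (measurable_of_finite _)
        (Eventually.of_forall fun p σ => abs_pairSpin_le p _) hsymm hint,
      integral_logSumExp_bondLaw measurable_pairSpin
        (Eventually.of_forall fun p σ => abs_pairSpin_le p σ) hsymm hint]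
    have h := block_increment_le (β := β) hint v
    have hpq' : (A / (A + B) : ℝ) + B / (A + B) = 1 := by
      have hAB' : (A : ℝ) + B ≠ 0 := by exact_mod_cast NeZero.ne (A + B)
      rw [← add_div, div_self hAB']
    simp only [smul_eq_mul]
    push_cast
    have h3 : logSumExp v + energy β μ 1 = ((A / (A + B) : ℝ) + B / (A + B)) *
      (logSumExp v + energy β μ 1) := by rw [hpq', one_mul]
    linarith
  refine le_trans (le_of_eq ?_) hle
  rw [← hc]
  have hL : IsProbabilityMeasure ((pairBondLaw β μ A).map (pullback (Fin.castAdd B))) :=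
    Measure.isProbabilityMeasure_map (measurable_pullback _).aemeasurable
  have hR : IsProbabilityMeasure ((pairBondLaw β μ B).map (pullback (Fin.natAdd A))) :=
    Measure.isProbabilityMeasure_map (measurable_pullback _).aemeasurable
  have e1 : compoundPoisson (α * A) ν₁ =
      (compoundPoisson (α * A) (pairBondLaw β μ A)).map (pullback (Fin.castAdd B)) := by
    rw [← compoundPoisson_map _ _ _ (measurable_pullback _)]
    simp only [map_pullback_pairBondLaw, hν₁]
  have e2 : compoundPoisson (α * B) ν₂ =
      (compoundPoisson (α * B) (pairBondLaw β μ B)).map (pullback (Fin.natAdd A)) := by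
    rw [← compoundPoisson_map _ _ _ (measurable_pullback _)]
    simp only [map_pullback_pairBondLaw, hν₂]
  have mF : ∀ {M : ℕ} {ν : Measure (Config M → ℝ)} [IsProbabilityMeasure ν],
      Integrable (fun v => v) ν → Integrable logSumExp ν := by
    intro M ν _ hν
    simpa using integrable_of_abs_le_add_norm hν measurable_logSumExp abs_logSumExp_le 0
  have jA := mF (integrable_compoundPoisson (α * A) _ iA)
  have jB := mF (integrable_compoundPoisson (α * B) _ iB)
  have hmap := integral_map (μ := (compoundPoisson (α * A) (pairBondLaw β μ A)).prod
      (compoundPoisson (α * B) (pairBondLaw β μ B)))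
    (f := fun x : (Config (A + B) → ℝ) × (Config (A + B) → ℝ) => logSumExp (x.1 + x.2))
    ((measurable_pullback (Fin.castAdd B)).prodMap
      (measurable_pullback (Fin.natAdd A))).aemeasurable
    (hF.comp (by fun_prop)).aestronglyMeasurable
  rw [Measure.conv, integral_map (by fun_prop) hF.aestronglyMeasurable, e1, e2,
    Measure.map_prod_map _ _ (measurable_pullback _) (measurable_pullback _), hmap]
  simp only [Prod.map_fst, Prod.map_snd, logSumExp_blocks]
  rw [integral_add (jA.comp_fst _) (jB.comp_snd _), integral_fun_fst, integral_fun_snd]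
  simp

end Superadditivity

/-! ### The thermodynamic limit -/

section Limit

variable {β : ℝ} {μ : Measure ℝ} [IsProbabilityMeasure μ]

/-- The mean log-partition function of the Viana-Bray model, set to `0` for zero sites. -/
def meanLogPartition (β : ℝ) (α : ℝ≥0) (μ : Measure ℝ) [IsProbabilityMeasure μ] (N : ℕ) : ℝ :=
  if h : N = 0 then 0 else
    haveI : NeZero N := ⟨h⟩
    ∫ d, Real.log (partitionFn β (vianaBrayHam d.1 d.2)) ∂vianaBrayDisorder α μ N

theorem meanLogPartition_eq (α : ℝ≥0) (N : ℕ) [NeZero N] : meanLogPartition β α μ N =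
    ∫ d, Real.log (partitionFn β (vianaBrayHam d.1 d.2)) ∂vianaBrayDisorder α μ N := by
  rw [meanLogPartition, dif_neg (NeZero.ne N)]

theorem meanLogPartition_superadditive (hsymm : μ.map (fun J : ℝ => -J) = μ)
    (hint : Integrable (fun J : ℝ => J) μ) (α : ℝ≥0) (A B : ℕ) :
    meanLogPartition β α μ A + meanLogPartition β α μ B ≤ meanLogPartition β α μ (A + B) := by
  have h0 : meanLogPartition β α μ 0 = 0 := by simp [meanLogPartition]
  rcases Nat.eq_zero_or_pos A with rfl | hA
  · rw [h0, zero_add, zero_add]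
  rcases Nat.eq_zero_or_pos B with rfl | hB
  · rw [h0, add_zero, add_zero]
  have : NeZero A := ⟨hA.ne'⟩
  have : NeZero B := ⟨hB.ne'⟩
  have : NeZero (A + B) := ⟨by omega⟩
  rw [meanLogPartition_eq, meanLogPartition_eq, meanLogPartition_eq]
  exact integral_log_partitionFn_superadditive hsymm hint α

/-- Fekete's lemma for the negated mean log-partition function. The required lower bound comes from
the replica symmetric bound at auxiliary connectivity `0`. -/
theorem tendsto_finiteFreeEnergy (hβ : 0 < β) (hsymm : μ.map (fun J : ℝ => -J) = μ)
    (hint : Integrable (fun J : ℝ => J) μ) (α : ℝ≥0) :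
    Tendsto (fun N : ℕ => finiteFreeEnergy β α μ (N + 1)) atTop (𝓝 (freeEnergy β α μ)) := by
  have hsub : Subadditive fun N => -meanLogPartition β α μ N := by
    intro m n
    have := meanLogPartition_superadditive (β := β) hsymm hint α m n
    linarith
  have hbdd : BddBelow (Set.range fun n : ℕ => -meanLogPartition β α μ n / n) := by
    -- The `0` accounts for the term `n = 0`, where the quotient is `0` by convention.
    refine ⟨min 0 (-GRS β α μ 0), ?_⟩
    rintro _ ⟨n, rfl⟩
    rcases Nat.eq_zero_or_pos n with rfl | hn
    · simp
    · have : NeZero n := ⟨hn.ne'⟩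
      have h := vianaBray_le_GRS hβ (ae_auxLaw_abs_le_one hβ hsymm 0) hsymm hint n α
      rw [← meanLogPartition_eq] at h
      refine (min_le_right _ _).trans ?_
      change -GRS β α μ 0 ≤ -meanLogPartition β α μ n / n
      rw [neg_div, neg_le_neg_iff, div_eq_inv_mul, ← one_div]
      exact h
  have h := ((hsub.tendsto_lim hbdd).comp (tendsto_add_atTop_nat 1)).const_mul (1 / β)
  have e : ((fun x => 1 / β * x) ∘ (fun n : ℕ => -meanLogPartition β α μ n / n) ∘ fun a => a + 1) =
      fun N : ℕ => finiteFreeEnergy β α μ (N + 1) := by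
    ext N
    simp only [Function.comp_apply, finiteFreeEnergy, meanLogPartition_eq]
    ring
  -- The free energy is defined as a `limUnder`, so exhibiting some limit is enough.
  refine tendsto_nhds_limUnder ⟨1 / β * hsub.lim, ?_⟩
  rw [← e]
  exact h

theorem neg_mul_freeEnergy_le_GRS (hβ : 0 < β) (hsymm : μ.map (fun J : ℝ => -J) = μ)
    (hint : Integrable (fun J : ℝ => J) μ) (α : ℝ≥0) (α' : ℝ≥0∞) :
    -β * freeEnergy β α μ ≤ GRS β α μ α' := by
  refine le_of_tendsto ((tendsto_finiteFreeEnergy hβ hsymm hint α).const_mul (-β))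
    (Eventually.of_forall fun N => ?_)
  have h := vianaBray_le_GRS hβ (ae_auxLaw_abs_le_one hβ hsymm α') hsymm hint (N + 1) α
  refine le_trans (le_of_eq ?_) h
  rw [finiteFreeEnergy]
  field_simp

end Limit

end

end DilutedSpinGlass

open DilutedSpinGlass in
theorem mainTheorem1 (β : ℝ) (hβ : 0 < β) (μ : Measure ℝ) [IsProbabilityMeasure μ]
    (hsymm : μ.map (fun J : ℝ => -J) = μ) (hint : Integrable (fun J : ℝ => J) μ) :
    HasAuxLimits β μ ∧
    (∀ α' : ℝ≥0∞,
      (∀ᵐ p ∂cavityMark β μ α',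
        Real.tanh (β * cavityCoupling β p) = Real.tanh (β * p.1) * p.2) ∧
      (∀ᵐ p ∂internalMark β μ α',
        Real.tanh (β * internalCoupling β p) = Real.tanh (β * p.1) * (p.2.1 * p.2.2)) ∧
      (∀ n : ℕ, auxOverlap β μ (2 * n) α' = ∫ w, w ^ (2 * n) ∂(auxLaw β μ α' : Measure ℝ)) ∧
      ∀ (N : ℕ) [NeZero N], CavityConstraint β μ α' N ∧ InternalConstraint β μ α' N) ∧
    ∀ α : ℝ≥0,
      (∀ (N : ℕ) [NeZero N],
        Integrable (fun d => Real.log (partitionFn β (vianaBrayHam d.1 d.2)))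
          (vianaBrayDisorder α μ N)) ∧
      Tendsto (fun N : ℕ => finiteFreeEnergy β α μ (N + 1)) atTop (𝓝 (freeEnergy β α μ)) ∧
      ∀ α' : ℝ≥0∞,
        (∀ (N : ℕ) [NeZero N],
          Integrable (fun d => trialLog β d)
            ((cavityDisorder β μ α' α N).prod (internalDisorder β μ α' α N)) ∧
          trialG β α μ α' N = GRS β α μ α') ∧
        Integrable (cavityLogCosh β) (poissonMarks (2 * α) (cavityMark β μ α')) ∧
        Integrable (fun J => Real.log (Real.cosh (β * J))) μ ∧
        Integrable (fun p => Real.log (Real.cosh (β * cavityCoupling β p)))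
          (cavityMark β μ α') ∧
        Integrable (fun p => Real.log (Real.cosh (β * internalCoupling β p)))
          (internalMark β μ α') ∧
        Summable (rsTerm β μ α') ∧
        -β * freeEnergy β α μ ≤ GRS β α μ α' ∧
        GRS β α μ α' = FRS β α μ α' := by
  have hκ := ae_auxLaw_abs_le_one hβ hsymm
  have hq := auxOverlap_eq_integral hβ hsymm
  refine ⟨hasAuxLimits hβ hsymm, fun α' => ⟨?_, ?_, hq α', fun N _ =>
    ⟨cavityConstraint hβ (hκ α') (hq α') hsymm hint N,
      internalConstraint hβ (hκ α') (hq α') hsymm hint N⟩⟩, fun α => ⟨fun N _ =>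
    (integral_log_partitionFn_vianaBray α hint).1, tendsto_finiteFreeEnergy hβ hsymm hint α,
    fun α' => ⟨fun N _ => ?_, (integral_cavityLogCosh hβ (hκ α') hint (2 * α)).1,
      log_cosh_coupling hint, (log_cosh_cavityCoupling hβ (hκ α') hint).1,
      (log_cosh_internalCoupling hβ (hκ α') hint).1, (GRS_eq_FRS hβ (hκ α') (hq α') hint α).1,
      neg_mul_freeEnergy_le_GRS hβ hsymm hint α α', (GRS_eq_FRS hβ (hκ α') (hq α') hint α).2⟩⟩⟩
  · filter_upwards [ae_cavityMark (hκ α')] with p hp using tanh_modulatedCoupling hβ p.1 hp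
  · filter_upwards [ae_internalMark (hκ α')] with p hp using tanh_modulatedCoupling hβ p.1 hp
  · have h := trialG_eq_GRS hβ (hκ α') hsymm hint N α
    exact ⟨h.1, h.2.2⟩
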